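/- Let $\mathfrak a$ be a complex vector space of dimension $N$ with positive definite Hermitian form, $4\mid N$, with orthonormal basis $\{a_i\}$ and dual basis $\{a_i^*\}$ of $\mathfrak a^*$. Equip $\mathfrak u=\mathfrak a\oplus\mathfrak a^*$ with the symmetric bilinear form such that $\mathfrak a$ and $\mathfrak a^*$ are isotropic and $\langle a,f\rangle=\tfrac12 f(a)$ for $a\in\mathfrak a$, $f\in\mathfrak a^*$. Let $A(\mathfrak u)$ be the module, generated by a vacuum vector $\mathbf 1$, over the Clifford algebra with generators $u(r)$, linear in $u\in\mathfrak u$, $r\in\mathbb Z+\tfrac12$, and relations $u(r)v(s)+v(s)u(r)=-2\langle u,v\rangle\delta_{r+s,0}$, induced from $u(r)\mathbf 1=0$ for $r>0$. Let $A(\mathfrak u)_\theta$ be the analogous module for $r\in\mathbb Z$, generated by a vector $\mathbf 1_\theta$, induced from $u(r)\mathbf 1_\theta=0$ for $r>0$ and $f(0)\mathbf 1_\theta=0$ for $f\in\mathfrak a^*$. Let $\theta$ be the parity involution, which fixes both vacua and negates every $u(r)$, and let $A^f(\mathfrak u)=A(\mathfrak u)^0\oplus A(\mathfrak u)_\theta^0$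 be the space of its fixed points, a $U(1)$-VOA of rank $c=N$ when $N\equiv4\pmod 8$. Let $L(0)=\omega_{(1)}$ and $J(0)=\jmath_{(0)}$ be modes of the (untwisted and $\theta$-twisted) vertex operators of $$\omega=\tfrac14\sum_i\left(e_i(-\tfrac12)e_i(-\tfrac32)\mathbf 1+e_{i'}(-\tfrac12)e_{i'}(-\tfrac32)\mathbf 1\right),\qquad \jmath=\mathbf i\sum_i a_i^*(-\tfrac12)a_i(-\tfrac12)\mathbf 1,$$ where $e_i=a_i+a_i^*$ and $e_{i'}=\mathbf i(a_i-a_i^*)$. Put $J'(0)=\mathbf iJ(0)$ and, for $n,m\in\mathbb Q$, let $U_n^m\subset A^f(\mathfrak u)$ be the subspace on which $L(0)=n$ and $J'(0)=m$. The group $SU(\mathfrak a)$ acts on $A(\mathfrak u)\oplus A(\mathfrak u)_\theta$ through its action on $\mathfrak u$, fixing both vacua; this induces an action of $SU(\mathfrak a)/\langle\pm1\rangle$ on $A^f(\mathfrak u)$ which commutes with $L(0)$ and $J'(0)$. A weak Frame shape of a linear map $T$ on $\mathfrak a$ is a finite formal product $\prod_j (k_j)^{m_j}_{a_j}$ with integers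 $k_j\ge1$, $a_j\in\mathbb Q/\mathbb Z$ and $m_j\in\mathbb Z$ such that $\det(1-Tx)=\prod_j(1-e^{2\pi\mathbf i a_j}x^{k_j})^{m_j}$ in $\mathbb C(x)$. With $\vartheta(z|\tau)=\sum_{m\in\mathbb Z}e^{2\pi\mathbf i mz+\pi\mathbf i m^2\tau}$, the Dedekind eta function $\eta$, $p=e^{2\pi\mathbf iz}$, $q=e^{2\pi\mathbf i\tau}$ and powers read as $p^s=e^{2\pi\mathbf i zs}$, $q^s=e^{2\pi\mathbf i\tau s}$, set for a given weak Frame shape of $T$ $$\phi_T(z|\tau)=\prod_j\frac{\vartheta(k_jz+\frac12-a_j|k_j\tau)^{m_j}}{\eta(k_j\tau)^{m_j}},\qquad \psi_T(z|\tau)=\prod_j p^{k_jm_j/2}q^{k_jm_j/8}\frac{\vartheta(k_jz+\frac12k_j\tau+\frac12-a_j|k_j\tau)^{m_j}}{\eta(k_j\tau)^{m_j}}.$$ **Theorem.** Let $g\in SU(\mathfrak a)/\langle\pm1\rangle$ have lifts $\pm\bar g\in SU(\mathfrak a)$, and let weak Frame shapes of $\bar g$ and of $-\bar g$ be given. Then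 all $U_n^m$ are finite dimensional and span $A^f(\mathfrak u)$; the series $$\mathrm{tr}|_{A^f(\mathfrak u)}\,g\,p^{J'(0)}q^{L(0)-c/24}=\sum_{n,m}\left(\mathrm{tr}|_{U_n^m}g\right)p^mq^{n-c/24},\qquad c=N,$$ converges absolutely for all $z\in\mathbb C$ and all $\tau$ in the upper half plane; and it equals $$\tfrac12\left(\phi_{-\bar g}(z|\tau)+\phi_{\bar g}(z|\tau)+\psi_{-\bar g}(z|\tau)+\psi_{\bar g}(z|\tau)\right)$$ at all $(z,\tau)$ where no theta function occurring with a negative exponent in these products vanishes. For every $\tau$ the excluded set of $z$ is closed and discrete in $\mathbb C$. -/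

import Mathlib

noncomputable section

namespace CliffordVOA

open Complex (I)

/-! ## The space `𝔲 = 𝔞 ⊕ 𝔞*` and its loop spaces -/

section Algebra

/-- `𝔲 = 𝔞 ⊕ 𝔞*`. -/
abbrev Dbl (V : Type*) [AddCommGroup V] [Module ℂ V] : Type _ := V × Module.Dual ℂ V

variable {V : Type*} [AddCommGroup V] [Module ℂ V]

/-- The symmetric bilinear form on `𝔲`: half of the natural pairing, so that
`⟨a, f⟩ = ⟨f, a⟩ = f(a) / 2`. -/
def form (V : Type*) [AddCommGroup V] [Module ℂ V] : LinearMap.BilinForm ℂ (Dbl V) :=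
  LinearMap.mk₂ ℂ (fun x y => (1 / 2 : ℂ) * (x.2 y.1 + y.2 x.1))
    (by intros; simp; ring) (by intros; simp; ring) (by intros; simp; ring) (by intros; simp; ring)

theorem form_comm (x y : Dbl V) : form V x y = form V y x := by
  simp [form, add_comm]

/-- The untwisted sector has modes `u(r)` with `r ∈ ℤ + 1/2`; the twisted sector has modes
`u(r)` with `r ∈ ℤ`. -/
inductive Sector
  | untwisted
  | twisted

/-- Twice the shift of the modes: in the sector `σ` the `n`-th mode is `u(n + σ.shift / 2)`. -/
def Sector.shift : Sector → ℤ
  | .untwisted => 1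
  | .twisted => 0

/-- The exponent `r = n + σ.shift / 2` of the `n`-th mode, so that the `n`-th mode of `u` is
`u(r) = u ⊗ t ^ r`. -/
def Sector.expo (σ : Sector) (n : ℤ) : ℚ := n + (σ.shift : ℚ) / 2

/-- The spaces `∐ 𝔲 ⊗ t ^ (n + 1/2)` and `∐ 𝔲 ⊗ t ^ n`; `Finsupp.single n u` stands
for `u(σ.expo n)`. -/
abbrev Loop (V : Type*) [AddCommGroup V] [Module ℂ V] : Type _ := ℤ →₀ Dbl V

/-- `⟨u(r), v(s)⟩ = ⟨u, v⟩ δ_{r+s,0}`. -/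
def loopForm (V : Type*) [AddCommGroup V] [Module ℂ V] (σ : Sector) :
    LinearMap.BilinForm ℂ (Loop V) :=
  Finsupp.lsum ℂ fun n : ℤ => (form V).compl₂ (Finsupp.lapply (-n - σ.shift))

/-- The quadratic form `x ↦ -⟨x, x⟩`, so that `x² = -⟨x, x⟩` in the Clifford algebra. -/
def loopQuad (V : Type*) [AddCommGroup V] [Module ℂ V] (σ : Sector) :
    QuadraticForm ℂ (Loop V) :=
  -(loopForm V σ).toQuadraticMap

theorem loopForm_single_left (σ : Sector) (n : ℤ) (u : Dbl V) (y : Loop V) :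
    loopForm V σ (Finsupp.single n u) y = form V u (y (-n - σ.shift)) := by
  simp [loopForm]

theorem loopForm_comm (σ : Sector) (x y : Loop V) : loopForm V σ x y = loopForm V σ y x := by
  induction x using Finsupp.induction_linear with
  | zero => simp
  | add x x' hx hx' => simp [hx, hx']
  | single n u =>
    induction y using Finsupp.induction_linear with
    | zero => simp
    | add y y' hy hy' => simp [hy, hy']
    | single m v =>
      rw [loopForm_single_left, loopForm_single_left, Finsupp.single_apply, Finsupp.single_apply]
      by_cases h : m = -n - σ.shift
      · rw [if_pos h, if_pos (by omega), form_comm]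
      · rw [if_neg h, if_neg (by omega)]
        simp

/-- The Clifford algebra of the loop space. -/
abbrev Cl (V : Type*) [AddCommGroup V] [Module ℂ V] (σ : Sector) : Type _ :=
  CliffordAlgebra (loopQuad V σ)

/-- The element `u(r)`, `r = σ.expo n`, of the Clifford algebra. -/
def cl (σ : Sector) (n : ℤ) (u : Dbl V) : Cl V σ :=
  CliffordAlgebra.ι (loopQuad V σ) (Finsupp.single n u)

/-! ## The modules `A(𝔲)` and `A(𝔲)_θ` -/

/-- The relations of the vacuum: `u(r) 1 = 0` for `u ∈ 𝔲` and `r > 0`, and in the twisted sector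
also `f(0) 1 = 0` for `f ∈ 𝔞*`.  The latter says that the elements `i e_j(0) e_{j'}(0)`, which
equal `2 a_j(0) a_j*(0) + 1`, fix the vacuum. -/
inductive IsAnnihilator (σ : Sector) : Cl V σ → Prop
  | pos (n : ℤ) (u : Dbl V) (h : 0 < σ.expo n) : IsAnnihilator σ (cl σ n u)
  | zero (n : ℤ) (f : Module.Dual ℂ V) (h : σ.expo n = 0) : IsAnnihilator σ (cl σ n (0, f))

/-- The left ideal generated by the elements that annihilate the vacuum. -/
def vacIdeal (V : Type*) [AddCommGroup V] [Module ℂ V] (σ : Sector) :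
    Submodule (Cl V σ) (Cl V σ) :=
  Submodule.span (Cl V σ) {x | IsAnnihilator σ x}

/-- The induced modules: `A(𝔲)` for the untwisted sector and `A(𝔲)_θ` for the twisted sector.
The class of `1` is the vacuum. -/
abbrev Fock (V : Type*) [AddCommGroup V] [Module ℂ V] (σ : Sector) : Type _ :=
  Cl V σ ⧸ (vacIdeal V σ).restrictScalars ℂ

/-- The action of the Clifford algebra on `A(𝔲)` or `A(𝔲)_θ` by left multiplication. -/
def op (σ : Sector) (c : Cl V σ) : Module.End ℂ (Fock V σ) :=
  Submodule.mapQ _ _ (LinearMap.mulLeft ℂ c) fun _ hx => (vacIdeal V σ).smul_mem c hx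

/-- The operator `u(r)`, `r = σ.expo n`. -/
def mode (σ : Sector) (n : ℤ) (u : Dbl V) : Module.End ℂ (Fock V σ) := op σ (cl σ n u)

theorem op_mk (σ : Sector) (c x : Cl V σ) :
    op σ c (Submodule.Quotient.mk x) = Submodule.Quotient.mk (c * x) := rfl

theorem op_add (σ : Sector) (c d : Cl V σ) : op σ (c + d) = op σ c + op σ d := by
  ext x
  simp only [LinearMap.comp_apply, LinearMap.add_apply, Submodule.mkQ_apply, op_mk, add_mul,
    Submodule.Quotient.mk_add]

theorem op_smul (σ : Sector) (t : ℂ) (c : Cl V σ) : op σ (t • c) = t • op σ c := by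
  ext x
  simp only [LinearMap.comp_apply, LinearMap.smul_apply, Submodule.mkQ_apply, op_mk,
    smul_mul_assoc, Submodule.Quotient.mk_smul]

theorem mode_add (σ : Sector) (n : ℤ) (u v : Dbl V) :
    mode σ n (u + v) = mode σ n u + mode σ n v := by
  simp [mode, cl, ← op_add]

theorem mode_smul (σ : Sector) (n : ℤ) (t : ℂ) (u : Dbl V) :
    mode σ n (t • u) = t • mode σ n u := by
  rw [mode, mode, ← op_smul, cl, cl, ← Finsupp.smul_single, map_smul]

theorem cl_mul_ι (σ : Sector) (n : ℤ) (u : Dbl V) (y : Loop V) (h : y (-n - σ.shift) = 0) :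
    cl σ n u * CliffordAlgebra.ι (loopQuad V σ) y =
      -(CliffordAlgebra.ι (loopQuad V σ) y * cl σ n u) := by
  rw [eq_neg_iff_add_eq_zero, cl, CliffordAlgebra.ι_mul_ι_add_swap]
  have h1 : loopForm V σ (Finsupp.single n u) y = 0 := by rw [loopForm_single_left, h, map_zero]
  have h2 : loopForm V σ y (Finsupp.single n u) = 0 := by rw [loopForm_comm, h1]
  have : QuadraticMap.polar (loopQuad V σ) (Finsupp.single n u) y = 0 := by
    simp only [QuadraticMap.polar, loopQuad, neg_apply,
      LinearMap.BilinMap.toQuadraticMap_apply, map_add, LinearMap.add_apply, h1, h2]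
    ring
  rw [this, map_zero]

/-- Every vector is annihilated by all modes of sufficiently large exponent. -/
theorem mode_eventually_zero (σ : Sector) (b : Fock V σ) :
    ∃ K : ℤ, ∀ n : ℤ, K ≤ n → ∀ u : Dbl V, mode σ n u b = 0 := by
  obtain ⟨x, rfl⟩ := Submodule.Quotient.mk_surjective _ b
  suffices H : ∃ K : ℤ, ∀ n : ℤ, K ≤ n → ∀ u : Dbl V, cl σ n u * x ∈ vacIdeal V σ by
    obtain ⟨K, hK⟩ := H
    exact ⟨K, fun n hn u => (Submodule.Quotient.mk_eq_zero _).2 (hK n hn u)⟩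
  induction x using CliffordAlgebra.left_induction with
  | algebraMap r =>
    refine ⟨1, fun n hn u => ?_⟩
    rw [← Algebra.commutes, ← Algebra.smul_def]
    refine Submodule.smul_of_tower_mem _ r (Submodule.subset_span (IsAnnihilator.pos n u ?_))
    have h1 : (1 : ℚ) ≤ n := by exact_mod_cast hn
    cases σ <;> simp [Sector.expo, Sector.shift] <;> linarith
  | add x y hx hy =>
    obtain ⟨K, hK⟩ := hx
    obtain ⟨K', hK'⟩ := hy
    refine ⟨max K K', fun n hn u => ?_⟩
    rw [mul_add]
    exact add_mem (hK n (le_trans (le_max_left _ _) hn) u)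
      (hK' n (le_trans (le_max_right _ _) hn) u)
  | ι_mul x y hx =>
    obtain ⟨K, hK⟩ := hx
    obtain ⟨M, hM⟩ : ∃ M : ℤ, ∀ j : ℤ, j < M → y j = 0 := by
      obtain ⟨M, hM⟩ := y.support.finite_toSet.bddBelow
      refine ⟨M, fun j hj => ?_⟩
      by_contra h
      exact absurd (hM (Finsupp.mem_support_iff.2 h)) (not_le.2 hj)
    refine ⟨max K (1 - M - σ.shift), fun n hn u => ?_⟩
    rw [← mul_assoc, cl_mul_ι σ n u y (hM _ (by have := le_trans (le_max_right _ _) hn; omega)),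
      neg_mul, mul_assoc]
    exact neg_mem ((vacIdeal V σ).smul_mem _ (hK n (le_trans (le_max_left _ _) hn) u))

/-! ## Vertex operators of quadratic vectors -/

/-- The normally ordered product `:u(r) v(s):` where `r = σ.expo n`, `s = σ.expo m`. -/
def normOrd (σ : Sector) (n : ℤ) (u : Dbl V) (m : ℤ) (v : Dbl V) : Module.End ℂ (Fock V σ) :=
  open Classical in
  if n = m ∧ σ.expo n = 0 then
    (1 / 2 : ℂ) • (mode σ n u * mode σ m v - mode σ m v * mode σ n u)
  else if n ≤ m then mode σ n u * mode σ m v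
  else -(mode σ m v * mode σ n u)

/-- The coefficient of `z ^ (-r - 1/2 - k)` in `D_z^{(k)} u(z)`, relative to `u(r)`, where
`u(z) = ∑ u(r) z ^ (-r - 1/2)`, `D_z^{(k)} = (1 / k!) (d/dz) ^ k` and `r = σ.expo n`. -/
def derivCoeff (σ : Sector) (k : ℕ) (n : ℤ) : ℂ :=
  ((Ring.choose (-σ.expo n - 1 / 2) k : ℚ) : ℂ)

/-- The term with first exponent `r = σ.expo i` in the coefficient of `z ^ (-t - 1)` of
`:D_z^{(k)} u(z) D_z^{(l)} v(z):`; the second exponent is `s = t - k - l - r`. -/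
def quadTerm (σ : Sector) (k : ℕ) (u : Dbl V) (l : ℕ) (v : Dbl V) (t i : ℤ) :
    Module.End ℂ (Fock V σ) :=
  (derivCoeff σ k i * derivCoeff σ l (t - k - l - σ.shift - i)) •
    normOrd σ i u (t - k - l - σ.shift - i) v

theorem quadTerm_finite (σ : Sector) (k : ℕ) (u : Dbl V) (l : ℕ) (v : Dbl V) (t : ℤ)
    (b : Fock V σ) : (Function.support fun i : ℤ => quadTerm σ k u l v t i b).Finite := by
  obtain ⟨K, hK⟩ := mode_eventually_zero σ b
  set c : ℤ := t - k - l - σ.shift with hc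
  refine (Set.finite_Icc (min (-|c|) (c - K)) (max K |c|)).subset ?_
  intro i hi
  have h1 := neg_abs_le c
  have h2 := le_abs_self c
  have h3 := abs_nonneg c
  by_contra hn
  rw [Set.mem_Icc, not_and_or, not_le, not_le, lt_min_iff, max_lt_iff] at hn
  apply hi
  change ((derivCoeff σ k i * derivCoeff σ l (c - i)) • normOrd σ i u (c - i) v) b = 0
  rw [LinearMap.smul_apply]
  rcases hn with ⟨h4, h5⟩ | ⟨h4, h5⟩
  · have : normOrd σ i u (c - i) v b = 0 := by
      rw [normOrd, if_neg (by omega), if_pos (by omega), Module.End.mul_apply,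
        hK _ (by omega), map_zero]
    rw [this, smul_zero]
  · have : normOrd σ i u (c - i) v b = 0 := by
      rw [normOrd, if_neg (by omega), if_neg (by omega), LinearMap.neg_apply,
        Module.End.mul_apply, hK _ (by omega), map_zero, neg_zero]
    rw [this, smul_zero]

/-- The constants `C_{kl}` of the twisted vertex operators. -/
def twistConst (k l : ℕ) : ℂ :=
  ((1 / 2 * (((k : ℚ) - l) / (k + l + 1)) * Ring.choose (-1 / 2 : ℚ) k *
    Ring.choose (-1 / 2 : ℚ) l : ℚ) : ℂ)

/-- The correction to the coefficient of `z ^ (-t - 1)` of a vertex operator on the twisted sector: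
with `Δ_z = -(1/4) ∑_i ∑_{m,n} C_{mn} e_i(m + 1/2) e_i(n + 1/2) z ^ (-m-n-1)` one has
`Δ_z u(-k-1/2) v(-l-1/2) 1 = 2 C_{kl} ⟨u, v⟩ z ^ (-k-l-1) 1`, and `Δ_z` kills `1`. -/
def twistTerm (σ : Sector) (k : ℕ) (u : Dbl V) (l : ℕ) (v : Dbl V) (t : ℤ) : ℂ :=
  match σ with
  | .untwisted => 0
  | .twisted => if t = k + l then 2 * twistConst k l * form V u v else 0

/-- The operator `a_(t)`, that is the coefficient of `z ^ (-t - 1)` in the vertex operator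
`Y(a, z)` for `a = u(-k-1/2) v(-l-1/2) 1` in `A(𝔲)`, acting on `A(𝔲)` or on `A(𝔲)_θ`:
`Y(a, z)` is `:D_z^{(k)} u(z) D_z^{(l)} v(z):` on the untwisted sector, and on the
twisted sector the same expression applied to `exp(Δ_z) a`. -/
def quadVertex (σ : Sector) (k : ℕ) (u : Dbl V) (l : ℕ) (v : Dbl V) (t : ℤ) :
    Module.End ℂ (Fock V σ) where
  toFun b := (∑ᶠ i : ℤ, quadTerm σ k u l v t i b) + twistTerm σ k u l v t • b
  map_add' b b' := by
    simp only [map_add, smul_add]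
    rw [finsum_add_distrib (quadTerm_finite σ k u l v t b) (quadTerm_finite σ k u l v t b')]
    abel
  map_smul' r b := by
    simp only [map_smul, RingHom.id_apply, smul_add]
    rw [smul_finsum' r (quadTerm_finite σ k u l v t b), smul_comm]

section Basis

variable {ι : Type*} [Fintype ι] (b : Module.Basis ι ℂ V)

/-- `a_i`, as an element of `𝔲`. -/
def vecA (i : ι) : Dbl V := (b i, 0)

/-- `a_i*`, the dual basis, as an element of `𝔲`. -/
def vecAstar (i : ι) : Dbl V := (0, b.coord i)

/-- `e_i = a_i + a_i*`. -/
def vecE (i : ι) : Dbl V := vecA b i + vecAstar b i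

/-- `e_{i'} = i (a_i - a_i*)`. -/
def vecE' (i : ι) : Dbl V := I • (vecA b i - vecAstar b i)

/-- `L(n) = ω_(n+1)` for the Virasoro element
`ω = (1/4) ∑_i (e_i(-1/2) e_i(-3/2) 1 + e_{i'}(-1/2) e_{i'}(-3/2) 1)`. -/
def opL (σ : Sector) (n : ℤ) : Module.End ℂ (Fock V σ) :=
  (1 / 4 : ℂ) • ∑ i, (quadVertex σ 0 (vecE b i) 1 (vecE b i) (n + 1) +
    quadVertex σ 0 (vecE' b i) 1 (vecE' b i) (n + 1))

/-- `J(n) = ȷ_(n)` for `ȷ = i ∑_i a_i*(-1/2) a_i(-1/2) 1`. -/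
def opJ (σ : Sector) (n : ℤ) : Module.End ℂ (Fock V σ) :=
  I • ∑ i, quadVertex σ 0 (vecAstar b i) 0 (vecA b i) n

end Basis

/-! ## The action of `GL(𝔞)` -/

/-- The orthogonal transformation `(a, f) ↦ (T a, f ∘ T⁻¹)` of `𝔲` defined by `T ∈ GL(𝔞)`. -/
def dblMap (T : V ≃ₗ[ℂ] V) : Dbl V →ₗ[ℂ] Dbl V :=
  LinearMap.prodMap T.toLinearMap T.symm.dualMap.toLinearMap

theorem form_dblMap (T : V ≃ₗ[ℂ] V) (u v : Dbl V) :
    form V (dblMap T u) (dblMap T v) = form V u v := by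
  simp [form, dblMap]

theorem dblMap_one : dblMap (1 : V ≃ₗ[ℂ] V) = LinearMap.id := rfl

theorem dblMap_mul (S T : V ≃ₗ[ℂ] V) : dblMap (S * T) = dblMap S ∘ₗ dblMap T := rfl

/-- `u(r) ↦ (T u)(r)` -/
def loopMap (T : V ≃ₗ[ℂ] V) : Loop V →ₗ[ℂ] Loop V := Finsupp.mapRange.linearMap (dblMap T)

theorem loopForm_loopMap (σ : Sector) (T : V ≃ₗ[ℂ] V) (x y : Loop V) :
    loopForm V σ (loopMap T x) (loopMap T y) = loopForm V σ x y := by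
  induction x using Finsupp.induction_linear with
  | zero => simp
  | add x x' hx hx' => simp [hx, hx']
  | single n u => simp [loopMap, loopForm_single_left, form_dblMap]

/-- The isometry of the loop space defined by `T ∈ GL(𝔞)`. -/
def loopIsom (σ : Sector) (T : V ≃ₗ[ℂ] V) : loopQuad V σ →qᵢ loopQuad V σ :=
  { loopMap T with
    map_app' := fun x => by
      simp [loopQuad, ← loopForm_loopMap σ T x x] }

/-- The automorphism of the Clifford algebra defined by `T ∈ GL(𝔞)`. -/
def clMap (σ : Sector) (T : V ≃ₗ[ℂ] V) : Cl V σ →ₐ[ℂ] Cl V σ :=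
  CliffordAlgebra.map (loopIsom σ T)

theorem clMap_cl (σ : Sector) (T : V ≃ₗ[ℂ] V) (n : ℤ) (u : Dbl V) :
    clMap σ T (cl σ n u) = cl σ n (dblMap T u) := by
  rw [clMap, cl, CliffordAlgebra.map_apply_ι, cl]
  congr 1
  exact Finsupp.mapRange_single (hf := map_zero _)

theorem clMap_mem (σ : Sector) (T : V ≃ₗ[ℂ] V) (x : Cl V σ) (hx : x ∈ vacIdeal V σ) :
    clMap σ T x ∈ vacIdeal V σ := by
  induction hx using Submodule.span_induction with
  | mem x hx =>
    refine Submodule.subset_span ?_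
    cases hx with
    | pos n u h => rw [clMap_cl]; exact .pos n _ h
    | zero n f h =>
      rw [clMap_cl]
      have : dblMap T ((0, f) : Dbl V) = (0, T.symm.dualMap f) := by simp [dblMap]
      rw [this]
      exact .zero n _ h
  | zero => simp
  | add x y _ _ hx hy => rw [map_add]; exact add_mem hx hy
  | smul c x _ hx => rw [smul_eq_mul, map_mul]; exact (vacIdeal V σ).smul_mem _ hx

/-- The natural action of `T ∈ GL(𝔞)` on `A(𝔲)` or `A(𝔲)_θ`: the linear map
`u_1(r_1) ⋯ u_k(r_k) 1 ↦ (T u_1)(r_1) ⋯ (T u_k)(r_k) 1`.  It fixes the vacuum. -/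
def act (σ : Sector) (T : V ≃ₗ[ℂ] V) : Module.End ℂ (Fock V σ) :=
  Submodule.mapQ _ _ (clMap σ T).toLinearMap fun x hx =>
    clMap_mem σ T x hx

theorem act_mk (σ : Sector) (T : V ≃ₗ[ℂ] V) (x : Cl V σ) :
    act σ T (Submodule.Quotient.mk x) = Submodule.Quotient.mk (clMap σ T x) := rfl

theorem act_mode (σ : Sector) (T : V ≃ₗ[ℂ] V) (n : ℤ) (u : Dbl V) (b : Fock V σ) :
    act σ T (mode σ n u b) = mode σ n (dblMap T u) (act σ T b) := by
  obtain ⟨x, rfl⟩ := Submodule.Quotient.mk_surjective _ b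
  rw [mode, mode, op_mk, act_mk, act_mk, op_mk, map_mul, clMap_cl]

theorem act_one (σ : Sector) : act σ (1 : V ≃ₗ[ℂ] V) = 1 := by
  have h : clMap σ (1 : V ≃ₗ[ℂ] V) = AlgHom.id ℂ (Cl V σ) := by
    apply CliffordAlgebra.hom_ext
    refine Finsupp.lhom_ext fun n u => ?_
    exact clMap_cl σ 1 n u
  ext x
  simp only [LinearMap.comp_apply, Submodule.mkQ_apply, act_mk, h]
  rfl

theorem act_mul (σ : Sector) (S T : V ≃ₗ[ℂ] V) : act σ (S * T) = act σ S * act σ T := by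
  have h : clMap σ (S * T) = (clMap σ S).comp (clMap σ T) := by
    apply CliffordAlgebra.hom_ext
    refine Finsupp.lhom_ext fun n u => ?_
    change clMap σ (S * T) (cl σ n u) = clMap σ S (clMap σ T (cl σ n u))
    rw [clMap_cl, clMap_cl, clMap_cl, dblMap_mul]
    rfl
  ext x
  simp only [LinearMap.comp_apply, Submodule.mkQ_apply, Module.End.mul_apply, act_mk, h]
  rfl

theorem act_normOrd (σ : Sector) (T : V ≃ₗ[ℂ] V) (n : ℤ) (u : Dbl V) (m : ℤ) (v : Dbl V)
    (b : Fock V σ) : act σ T (normOrd σ n u m v b) =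
      normOrd σ n (dblMap T u) m (dblMap T v) (act σ T b) := by
  unfold normOrd
  split_ifs <;> simp [act_mode]

theorem act_quadVertex (σ : Sector) (T : V ≃ₗ[ℂ] V) (k : ℕ) (u : Dbl V) (l : ℕ) (v : Dbl V)
    (t : ℤ) (b : Fock V σ) : act σ T (quadVertex σ k u l v t b) =
      quadVertex σ k (dblMap T u) l (dblMap T v) t (act σ T b) := by
  have h1 : act σ T (∑ᶠ i : ℤ, quadTerm σ k u l v t i b) =
      ∑ᶠ i : ℤ, quadTerm σ k (dblMap T u) l (dblMap T v) t i (act σ T b) := by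
    rw [show act σ T (∑ᶠ i : ℤ, quadTerm σ k u l v t i b) =
      (act σ T).toAddMonoidHom (∑ᶠ i : ℤ, quadTerm σ k u l v t i b) from rfl,
      AddMonoidHom.map_finsum _ (quadTerm_finite σ k u l v t b)]
    refine finsum_congr fun i => ?_
    simp [quadTerm, act_normOrd]
  have h2 : twistTerm σ k (dblMap T u) l (dblMap T v) t = twistTerm σ k u l v t := by
    cases σ <;> simp [twistTerm, form_dblMap]
  change act σ T (_ + _) = _ + _
  rw [map_add, map_smul, h1, h2]

theorem normOrd_add_left (σ : Sector) (n : ℤ) (u u' : Dbl V) (m : ℤ) (v : Dbl V) :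
    normOrd σ n (u + u') m v = normOrd σ n u m v + normOrd σ n u' m v := by
  unfold normOrd
  split_ifs <;> simp only [mode_add, add_mul, mul_add, ← smul_add]
  · congr 1; abel
  · abel

theorem normOrd_add_right (σ : Sector) (n : ℤ) (u : Dbl V) (m : ℤ) (v v' : Dbl V) :
    normOrd σ n u m (v + v') = normOrd σ n u m v + normOrd σ n u m v' := by
  unfold normOrd
  split_ifs <;> simp only [mode_add, add_mul, mul_add, ← smul_add]
  · congr 1; abel
  · abel

theorem normOrd_smul_left (σ : Sector) (n : ℤ) (r : ℂ) (u : Dbl V) (m : ℤ) (v : Dbl V) :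
    normOrd σ n (r • u) m v = r • normOrd σ n u m v := by
  unfold normOrd
  refine LinearMap.ext fun b => ?_
  split_ifs <;> simp [mode_smul]
  module

theorem normOrd_smul_right (σ : Sector) (n : ℤ) (r : ℂ) (u : Dbl V) (m : ℤ) (v : Dbl V) :
    normOrd σ n u m (r • v) = r • normOrd σ n u m v := by
  unfold normOrd
  refine LinearMap.ext fun b => ?_
  split_ifs <;> simp [mode_smul]
  module

theorem twistTerm_bilin (σ : Sector) (k l : ℕ) (t : ℤ) :
    ∃ c : ℂ, ∀ u v : Dbl V, twistTerm σ k u l v t = c * form V u v := by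
  cases σ
  · exact ⟨0, fun u v => by simp [twistTerm]⟩
  · by_cases h : t = k + l
    · exact ⟨2 * twistConst k l, fun u v => by simp [twistTerm, h]⟩
    · exact ⟨0, fun u v => by simp [twistTerm, h]⟩

theorem quadVertex_apply (σ : Sector) (k : ℕ) (u : Dbl V) (l : ℕ) (v : Dbl V) (t : ℤ)
    (b : Fock V σ) : quadVertex σ k u l v t b =
      (∑ᶠ i : ℤ, quadTerm σ k u l v t i b) + twistTerm σ k u l v t • b := rfl

/-- The operator `quadVertex` is bilinear in the two vectors of `𝔲`. -/
def quadVertexHom (σ : Sector) (k l : ℕ) (t : ℤ) :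
    Dbl V →ₗ[ℂ] Dbl V →ₗ[ℂ] Module.End ℂ (Fock V σ) :=
  LinearMap.mk₂ ℂ (fun u v => quadVertex σ k u l v t)
    (fun u u' v => by
      refine LinearMap.ext fun b => ?_
      obtain ⟨c, hc⟩ := twistTerm_bilin (V := V) σ k l t
      have := finsum_add_distrib (quadTerm_finite σ k u l v t b) (quadTerm_finite σ k u' l v t b)
      rw [LinearMap.add_apply, quadVertex_apply, quadVertex_apply, quadVertex_apply]
      rw [add_add_add_comm, ← this, hc, hc, hc, map_add, LinearMap.add_apply, mul_add, add_smul]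
      simp [quadTerm, normOrd_add_left])
    (fun r u v => by
      refine LinearMap.ext fun b => ?_
      obtain ⟨c, hc⟩ := twistTerm_bilin (V := V) σ k l t
      have := smul_finsum' r (quadTerm_finite σ k u l v t b)
      rw [LinearMap.smul_apply, quadVertex_apply, quadVertex_apply, smul_add, this, hc, hc,
        map_smul, LinearMap.smul_apply, smul_eq_mul, mul_left_comm, mul_smul]
      simp only [quadTerm, normOrd_smul_left, LinearMap.smul_apply, smul_comm r])
    (fun u v v' => by
      refine LinearMap.ext fun b => ?_
      obtain ⟨c, hc⟩ := twistTerm_bilin (V := V) σ k l t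
      have := finsum_add_distrib (quadTerm_finite σ k u l v t b) (quadTerm_finite σ k u l v' t b)
      rw [LinearMap.add_apply, quadVertex_apply, quadVertex_apply, quadVertex_apply]
      rw [add_add_add_comm, ← this, hc, hc, hc, map_add, mul_add, add_smul]
      simp [quadTerm, normOrd_add_right])
    (fun r u v => by
      refine LinearMap.ext fun b => ?_
      obtain ⟨c, hc⟩ := twistTerm_bilin (V := V) σ k l t
      have := smul_finsum' r (quadTerm_finite σ k u l v t b)
      rw [LinearMap.smul_apply, quadVertex_apply, quadVertex_apply, smul_add, this, hc, hc,
        map_smul, smul_eq_mul, mul_left_comm, mul_smul]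
      simp only [quadTerm, normOrd_smul_right, LinearMap.smul_apply, smul_comm r])

section Basis

variable {ι : Type*} [Fintype ι] (b : Module.Basis ι ℂ V)

/-- The tensor `∑ a_i ⊗ a_i*` is invariant under `GL(𝔞)`. -/
theorem sum_dblMap {X : Type*} [AddCommGroup X] [Module ℂ X]
    (B : Dbl V →ₗ[ℂ] Dbl V →ₗ[ℂ] X) (T : V ≃ₗ[ℂ] V) :
    ∑ i, B (dblMap T (vecA b i)) (dblMap T (vecAstar b i)) = ∑ i, B (vecA b i) (vecAstar b i) := by
  have h1 : ∀ i, dblMap T (vecA b i) = ∑ j, b.coord j (T (b i)) • vecA b j := by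
    intro i
    have h := b.sum_repr (T (b i))
    ext1
    · simp [dblMap, vecA, Prod.fst_sum, h]
    · simp [dblMap, vecA, Prod.snd_sum]
  have h2 : ∀ j, ∑ i, b.coord j (T (b i)) • dblMap T (vecAstar b i) = vecAstar b j := by
    intro j
    have h : b.coord j ∘ₗ T.toLinearMap = ∑ i, b.coord j (T (b i)) • b.coord i := by
      refine b.ext fun i => ?_
      classical
      simp [LinearMap.sum_apply, Finsupp.single_apply]
    have h' : ∀ x, b.coord j (T x) = ∑ i, b.coord j (T (b i)) * b.coord i x := by
      intro x
      simpa using LinearMap.congr_fun h x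
    ext1
    · simp [dblMap, vecAstar, Prod.fst_sum]
    · refine LinearMap.ext fun x => ?_
      have := h' (T.symm x)
      simp only [LinearEquiv.apply_symm_apply] at this
      simp [dblMap, vecAstar, Prod.snd_sum, LinearMap.sum_apply] at this ⊢
      exact this.symm
  calc ∑ i, B (dblMap T (vecA b i)) (dblMap T (vecAstar b i))
      = ∑ i, ∑ j, B (vecA b j) (b.coord j (T (b i)) • dblMap T (vecAstar b i)) := by
        refine Finset.sum_congr rfl fun i _ => ?_
        rw [h1 i, map_sum, LinearMap.sum_apply]
        refine Finset.sum_congr rfl fun j _ => ?_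
        rw [map_smul, map_smul, LinearMap.smul_apply]
    _ = ∑ j, B (vecA b j) (∑ i, b.coord j (T (b i)) • dblMap T (vecAstar b i)) := by
        rw [Finset.sum_comm]
        simp only [map_sum]
    _ = ∑ i, B (vecA b i) (vecAstar b i) := by simp only [h2]

theorem vecE_bilin {X : Type*} [AddCommGroup X] [Module ℂ X]
    (B : Dbl V →ₗ[ℂ] Dbl V →ₗ[ℂ] X) (i : ι) :
    B (vecE b i) (vecE b i) + B (vecE' b i) (vecE' b i) =
      (2 : ℂ) • (B (vecA b i) (vecAstar b i) + B.flip (vecA b i) (vecAstar b i)) := by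
  simp only [vecE, vecE', map_add, map_sub, map_smul, LinearMap.add_apply, LinearMap.sub_apply,
    LinearMap.smul_apply, LinearMap.flip_apply]
  linear_combination (norm := module) Complex.I_sq •
    (B (vecA b i) (vecA b i) + B (vecAstar b i) (vecAstar b i) -
      B (vecA b i) (vecAstar b i) - B (vecAstar b i) (vecA b i))

theorem opL_eq (σ : Sector) (n : ℤ) : opL b σ n = (1 / 2 : ℂ) •
    ∑ i, (quadVertexHom σ 0 1 (n + 1) (vecA b i) (vecAstar b i) +
      (quadVertexHom σ 0 1 (n + 1)).flip (vecA b i) (vecAstar b i)) := by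
  have : ∀ i, quadVertex σ 0 (vecE b i) 1 (vecE b i) (n + 1) +
      quadVertex σ 0 (vecE' b i) 1 (vecE' b i) (n + 1) =
      (2 : ℂ) • (quadVertexHom σ 0 1 (n + 1) (vecA b i) (vecAstar b i) +
      (quadVertexHom σ 0 1 (n + 1)).flip (vecA b i) (vecAstar b i)) := by
    intro i
    exact vecE_bilin b (quadVertexHom σ 0 1 (n + 1)) i
  simp only [opL, this, ← Finset.smul_sum, smul_smul]
  norm_num

theorem act_opL (σ : Sector) (T : V ≃ₗ[ℂ] V) (n : ℤ) (x : Fock V σ) :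
    act σ T (opL b σ n x) = opL b σ n (act σ T x) := by
  have key : ∀ u v, act σ T (quadVertexHom σ 0 1 (n + 1) u v x) =
      quadVertexHom σ 0 1 (n + 1) (dblMap T u) (dblMap T v) (act σ T x) :=
    fun u v => act_quadVertex σ T 0 u 1 v (n + 1) x
  have e : opL b σ n = (1 / 2 : ℂ) •
      (∑ i, quadVertexHom σ 0 1 (n + 1) (dblMap T (vecA b i)) (dblMap T (vecAstar b i)) +
      ∑ i, quadVertexHom σ 0 1 (n + 1) (dblMap T (vecAstar b i)) (dblMap T (vecA b i))) := by
    rw [opL_eq, Finset.sum_add_distrib, ← sum_dblMap b (quadVertexHom σ 0 1 (n + 1)) T,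
      ← sum_dblMap b (quadVertexHom σ 0 1 (n + 1)).flip T]
    rfl
  conv_rhs => rw [e]
  rw [opL_eq, Finset.sum_add_distrib]
  simp only [LinearMap.smul_apply, LinearMap.add_apply, LinearMap.sum_apply, map_smul, map_add,
    map_sum, LinearMap.flip_apply, key]

theorem act_opJ (σ : Sector) (T : V ≃ₗ[ℂ] V) (n : ℤ) (x : Fock V σ) :
    act σ T (opJ b σ n x) = opJ b σ n (act σ T x) := by
  have key : ∀ u v, act σ T (quadVertexHom σ 0 0 n u v x) =
      quadVertexHom σ 0 0 n (dblMap T u) (dblMap T v) (act σ T x) :=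
    fun u v => act_quadVertex σ T 0 u 0 v n x
  have e : opJ b σ n =
      I • ∑ i, quadVertexHom σ 0 0 n (dblMap T (vecAstar b i)) (dblMap T (vecA b i)) :=
    congrArg (I • ·) (sum_dblMap b (quadVertexHom σ 0 0 n).flip T).symm
  have e' : opJ b σ n = I • ∑ i, quadVertexHom σ 0 0 n (vecAstar b i) (vecA b i) := rfl
  conv_rhs => rw [e]
  rw [e']
  simp only [LinearMap.smul_apply, LinearMap.sum_apply, map_smul, map_sum, key]

end Basis

/-! ## The space `A(𝔲)^f = A(𝔲)⁰ ⊕ A(𝔲)_θ⁰` -/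

/-- `A(𝔲)_Θ = A(𝔲) ⊕ A(𝔲)_θ`. -/
abbrev FockSum (V : Type*) [AddCommGroup V] [Module ℂ V] : Type _ :=
  Fock V .untwisted × Fock V .twisted

/-- The action of `GL(𝔞)` on `A(𝔲) ⊕ A(𝔲)_θ`. -/
def actSum (T : V ≃ₗ[ℂ] V) : Module.End ℂ (FockSum V) :=
  (act .untwisted T).prodMap (act .twisted T)

/-- The parity involution `θ` of `A(𝔲) ⊕ A(𝔲)_θ`, induced by `-1` on `𝔲` and fixing the vacua. -/
def parity (V : Type*) [AddCommGroup V] [Module ℂ V] : Module.End ℂ (FockSum V) :=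
  actSum (LinearEquiv.neg ℂ)

/-- `A(𝔲)⁰ ⊕ A(𝔲)_θ⁰`, the fixed points of the parity involution. -/
def Atw (V : Type*) [AddCommGroup V] [Module ℂ V] : Submodule ℂ (FockSum V) :=
  LinearMap.eqLocus (parity V) LinearMap.id

theorem actSum_mul (S T : V ≃ₗ[ℂ] V) : actSum (S * T) = actSum S * actSum T := by
  refine LinearMap.ext fun x => ?_
  simp [actSum, act_mul]

theorem actSum_one : actSum (1 : V ≃ₗ[ℂ] V) = 1 := by
  refine LinearMap.ext fun x => ?_
  simp [actSum, act_one]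

theorem actSum_mem (T : V ≃ₗ[ℂ] V) (x : FockSum V) (hx : x ∈ Atw V) : actSum T x ∈ Atw V := by
  change parity V x = x at hx
  change parity V (actSum T x) = actSum T x
  have h : LinearEquiv.neg ℂ * T = T * LinearEquiv.neg ℂ := by
    ext v
    simp [LinearEquiv.mul_apply]
  rw [parity, ← Module.End.mul_apply, ← actSum_mul, h, actSum_mul, Module.End.mul_apply]
  exact congrArg _ hx

/-- The action of `GL(𝔞)` on `A(𝔲)⁰ ⊕ A(𝔲)_θ⁰`. -/
def actTw (V : Type*) [AddCommGroup V] [Module ℂ V] :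
    (V ≃ₗ[ℂ] V) →* Module.End ℂ (Atw V) where
  toFun T := (actSum T).restrict (actSum_mem T)
  map_one' := by
    refine LinearMap.ext fun x => Subtype.ext ?_
    simp [LinearMap.restrict_apply, actSum_one]
  map_mul' S T := by
    refine LinearMap.ext fun x => Subtype.ext ?_
    simp [LinearMap.restrict_apply, actSum_mul]

theorem actTw_neg : actTw V (LinearEquiv.neg ℂ) = 1 :=
  LinearMap.ext fun x => Subtype.ext x.2

section Basis

variable {ι : Type*} [Fintype ι] (b : Module.Basis ι ℂ V)

/-- The operators `L(n)` on `A(𝔲)⁰ ⊕ A(𝔲)_θ⁰`. -/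
def twL (n : ℤ) : Module.End ℂ (Atw V) :=
  ((opL b .untwisted n).prodMap (opL b .twisted n)).restrict (p := Atw V) (q := Atw V) (by
    intro x hx
    have h1 : act .untwisted (LinearEquiv.neg ℂ) x.1 = x.1 := congrArg Prod.fst hx
    have h2 : act .twisted (LinearEquiv.neg ℂ) x.2 = x.2 := congrArg Prod.snd hx
    refine Prod.ext ?_ ?_
    · change act .untwisted (LinearEquiv.neg ℂ) (opL b .untwisted n x.1) = opL b .untwisted n x.1
      rw [act_opL, h1]
    · change act .twisted (LinearEquiv.neg ℂ) (opL b .twisted n x.2) = opL b .twisted n x.2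
      rw [act_opL, h2])

/-- The operators `J(n)` on `A(𝔲)⁰ ⊕ A(𝔲)_θ⁰`. -/
def twJ (n : ℤ) : Module.End ℂ (Atw V) :=
  ((opJ b .untwisted n).prodMap (opJ b .twisted n)).restrict (p := Atw V) (q := Atw V) (by
    intro x hx
    have h1 : act .untwisted (LinearEquiv.neg ℂ) x.1 = x.1 := congrArg Prod.fst hx
    have h2 : act .twisted (LinearEquiv.neg ℂ) x.2 = x.2 := congrArg Prod.snd hx
    refine Prod.ext ?_ ?_
    · change act .untwisted (LinearEquiv.neg ℂ) (opJ b .untwisted n x.1) = opJ b .untwisted n x.1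
      rw [act_opJ, h1]
    · change act .twisted (LinearEquiv.neg ℂ) (opJ b .twisted n x.2) = opJ b .twisted n x.2
      rw [act_opJ, h2])

/-- The subspace of vectors of degree `n` and charge `m`: `L(0) x = n x` and `J'(0) x = m x` for
`J'(0) = i J(0)`. -/
def gradedPiece (n m : ℚ) : Submodule ℂ (Atw V) :=
  (twL b 0).eigenspace (n : ℂ) ⊓ (I • twJ b 0).eigenspace (m : ℂ)

theorem actTw_gradedPiece (T : V ≃ₗ[ℂ] V) (n m : ℚ) (x : Atw V) (hx : x ∈ gradedPiece b n m) :
    actTw V T x ∈ gradedPiece b n m := by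
  have hL : twL b 0 (actTw V T x) = actTw V T (twL b 0 x) :=
    Subtype.ext (Prod.ext (act_opL b .untwisted T 0 _).symm (act_opL b .twisted T 0 _).symm)
  have hJ : twJ b 0 (actTw V T x) = actTw V T (twJ b 0 x) :=
    Subtype.ext (Prod.ext (act_opJ b .untwisted T 0 _).symm (act_opJ b .twisted T 0 _).symm)
  obtain ⟨h1, h2⟩ := hx
  have h1' := Module.End.mem_eigenspace_iff.1 h1
  have h2' := Module.End.mem_eigenspace_iff.1 h2
  rw [LinearMap.smul_apply] at h2'
  refine ⟨Module.End.mem_eigenspace_iff.2 ?_, Module.End.mem_eigenspace_iff.2 ?_⟩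
  · rw [hL, h1', map_smul]
  · rw [LinearMap.smul_apply, hJ, ← map_smul, h2', map_smul]

end Basis

end Algebra

/-! ## The group `SU(𝔞) / ⟨±1⟩` and the graded traces -/

section Unitary

variable (V : Type*) [NormedAddCommGroup V] [InnerProductSpace ℂ V]

/-- `SU(𝔞)`: the linear isometries of determinant one. -/
def SU : Subgroup (V ≃ₗᵢ[ℂ] V) where
  carrier := {g | LinearMap.det (g.toLinearEquiv : V →ₗ[ℂ] V) = 1}
  one_mem' := LinearMap.det_id
  mul_mem' {g h} hg hh := by
    have := LinearMap.det_comp (g.toLinearEquiv : V →ₗ[ℂ] V) (h.toLinearEquiv : V →ₗ[ℂ] V)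
    rw [Set.mem_ofPred_eq] at hg hh
    rw [hg, hh, one_mul] at this
    exact this
  inv_mem' {g} hg := by
    have := LinearEquiv.det_symm_mul_det g.toLinearEquiv
    rw [Set.mem_ofPred_eq] at hg
    rw [hg, mul_one] at this
    exact this

/-- The subgroup `⟨±1⟩` of `SU(𝔞)`. -/
def pmOne : Subgroup (SU V) where
  carrier := {g | g.1 = 1 ∨ g.1 = LinearIsometryEquiv.neg ℂ}
  one_mem' := Or.inl rfl
  mul_mem' {g h} hg hh := by
    have hn : (LinearIsometryEquiv.neg ℂ : V ≃ₗᵢ[ℂ] V) * LinearIsometryEquiv.neg ℂ = 1 := by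
      ext v; simp
    change g.1 * h.1 = 1 ∨ g.1 * h.1 = LinearIsometryEquiv.neg ℂ
    rcases hg with hg | hg <;> rcases hh with hh | hh <;> rw [hg, hh] <;> simp [hn]
  inv_mem' {g} hg := by
    have hn : (LinearIsometryEquiv.neg ℂ : V ≃ₗᵢ[ℂ] V)⁻¹ = LinearIsometryEquiv.neg ℂ := by
      ext v; simp
    change g.1⁻¹ = 1 ∨ g.1⁻¹ = LinearIsometryEquiv.neg ℂ
    rcases hg with hg | hg <;> rw [hg] <;> simp [hn]

instance : (pmOne V).Normal where
  conj_mem n hn g := by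
    have hc : g.1 * LinearIsometryEquiv.neg ℂ = LinearIsometryEquiv.neg ℂ * g.1 := by
      ext v; simp
    rcases hn with hn | hn
    · left; simp [hn]
    · right; simp [hn, hc]

/-- `SU(𝔞) / ⟨±1⟩`. -/
abbrev PMSU : Type _ := SU V ⧸ pmOne V

/-- The action of `SU(𝔞)` on `A(𝔲)⁰ ⊕ A(𝔲)_θ⁰`. -/
def suAct : SU V →* Module.End ℂ (Atw V) where
  toFun g := actTw V g.1.toLinearEquiv
  map_one' := map_one (actTw V)
  map_mul' g h := map_mul (actTw V) g.1.toLinearEquiv h.1.toLinearEquiv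

/-- The action of `SU(𝔞) / ⟨±1⟩` on `A(𝔲)⁰ ⊕ A(𝔲)_θ⁰`. -/
def pmsuAct : PMSU V →* Module.End ℂ (Atw V) :=
  QuotientGroup.lift (pmOne V) (suAct V) (by
    rintro g (hg | hg)
    · have : g = 1 := Subtype.ext hg
      simp [this]
    · change actTw V g.1.toLinearEquiv = 1
      rw [hg]
      exact actTw_neg)

variable {V}
variable {ι : Type*} [Fintype ι] (b : Module.Basis ι ℂ V)

theorem pmsuAct_gradedPiece (g : PMSU V) (n m : ℚ) (x : Atw V) (hx : x ∈ gradedPiece b n m) :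
    pmsuAct V g x ∈ gradedPiece b n m := by
  obtain ⟨h, rfl⟩ := QuotientGroup.mk_surjective g
  exact actTw_gradedPiece b _ n m x hx

/-- The trace of `g` on the subspace of vectors of degree `n` and charge `m`. -/
def gradedTrace (g : PMSU V) (n m : ℚ) : ℂ :=
  LinearMap.trace ℂ (gradedPiece b n m)
    ((pmsuAct V g).restrict (pmsuAct_gradedPiece b g n m))

/-- The term `(tr g | U_n^m) p^m q^(n - c/24)` of the two variable McKay-Thompson series of `g`
on `U = A(𝔲)⁰ ⊕ A(𝔲)_θ⁰`, where `x = (n, m)`, `p = e^{2πiz}`, `q = e^{2πiτ}` and the rank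
`c` is the dimension of `𝔞`. -/
def seriesTerm (g : PMSU V) (z τ : ℂ) (x : ℚ × ℚ) : ℂ :=
  gradedTrace b g x.1 x.2 * Complex.exp (2 * Real.pi * I * z * (x.2 : ℂ)) *
    Complex.exp (2 * Real.pi * I * τ * ((x.1 : ℂ) - (Module.finrank ℂ V : ℂ) / 24))

end Unitary

/-! ## Weak Frame shapes and the functions `φ` and `ψ` -/

/-- A symbol `k_a^m`, standing for `(1 - e^{2πia} x^k)^m`. Here `a` represents a class in `ℚ/ℤ`. -/
structure FrameSymbol where
  /-- the positive integer `k` -/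
  k : ℕ+
  /-- the rational number `a` -/
  a : ℚ
  /-- the exponent `m` -/
  m : ℤ

/-- The product `∏_j (k_j)_{a_j}^{m_j}` is a weak Frame shape of `T`: the identity
`det(1 - T x) = ∏_j (1 - e^{2πi a_j} x^{k_j})^{m_j}` holds in `ℂ(x)`. -/
def IsWeakFrameShape {V : Type*} [AddCommGroup V] [Module ℂ V] {ι : Type*} [Fintype ι]
    [DecidableEq ι] (b : Module.Basis ι ℂ V) (T : V →ₗ[ℂ] V) (S : List FrameSymbol) : Prop :=
  algebraMap (Polynomial ℂ) (RatFunc ℂ) (LinearMap.toMatrix b b T).charpolyRev =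
    (S.map fun f => (1 - RatFunc.C (Complex.exp (2 * Real.pi * I * (f.a : ℂ))) *
      RatFunc.X ^ (f.k : ℕ)) ^ f.m).prod

/-- `ϑ(k z + 1/2 - a | k τ)`, where `jacobiTheta₂ z τ = ∑_n e^{2πi n z + πi n² τ}` -/
def FrameSymbol.thetaPhi (f : FrameSymbol) (z τ : ℂ) : ℂ :=
  jacobiTheta₂ (f.k * z + 1 / 2 - f.a) (f.k * τ)

/-- `ϑ(k z + k τ / 2 + 1/2 - a | k τ)` -/
def FrameSymbol.thetaPsi (f : FrameSymbol) (z τ : ℂ) : ℂ :=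
  jacobiTheta₂ (f.k * z + 1 / 2 * f.k * τ + 1 / 2 - f.a) (f.k * τ)

/-- `φ(z | τ) = ∏_j ϑ(k_j z + 1/2 - a_j | k_j τ)^{m_j} / η(k_j τ)^{m_j}` -/
def phi (S : List FrameSymbol) (z τ : ℂ) : ℂ :=
  (S.map fun f => f.thetaPhi z τ ^ f.m / ModularForm.eta (f.k * τ) ^ f.m).prod

/-- `ψ(z | τ) = ∏_j p^{k_j m_j / 2} q^{k_j m_j / 8}
ϑ(k_j z + k_j τ / 2 + 1/2 - a_j | k_j τ)^{m_j} / η(k_j τ)^{m_j}`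
with `p = e^{2πiz}` and `q = e^{2πiτ}` -/
def psi (S : List FrameSymbol) (z τ : ℂ) : ℂ :=
  (S.map fun f => Complex.exp (2 * Real.pi * I * z * (f.k * f.m / 2)) *
    Complex.exp (2 * Real.pi * I * τ * (f.k * f.m / 8)) *
    (f.thetaPsi z τ ^ f.m / ModularForm.eta (f.k * τ) ^ f.m)).prod

/-- No theta function that occurs with a negative exponent in `φ` or `ψ` vanishes at `(z, τ)`, so
that the products `φ` and `ψ` are defined there. -/
def IsRegularAt (S : List FrameSymbol) (z τ : ℂ) : Prop :=
  ∀ f ∈ S, f.m < 0 → f.thetaPhi z τ ≠ 0 ∧ f.thetaPsi z τ ≠ 0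

end CliffordVOA

end

noncomputable section

namespace CliffordVOA

open Complex (I)
open Filter Topology

/-! ## The Jacobi triple product -/

section TripleProduct

/-! Both sides are computed as the same infinite products over the eigenvalues of a lift `ḡ`.

Trace side. A unitary `ḡ` has an eigenbasis `a_i` with eigenvalues `λ_i` of modulus one, and `L(0)`,
`J'(0)` do not depend on the basis that defines them (`gradedPiece_congr`). The monomials in
distinct creation operators, applied to the vacuum, form a basis of each module (`fockBasis`) that
diagonalizes `ḡ`, `L(0)` and `J'(0)` at once: `a_i(-r)` contributes `λ_i p⁻¹ q^r`, `a_i*(-r)`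
contributes `λ_i⁻¹ p q^r`, and the twisted vacuum contributes `p^(N/2) q^(N/8)` (`opL_mode`,
`opJ_mode`, `opL_vacuum`, `opJ_vacuum`). Summation over finite sets of creation operators expands
the product of the factors `(1 + λ_i p⁻¹ q^r)(1 + λ_i⁻¹ p q^r)` (`hasSum_prod_creationFactor`).
Passing to the fixed points of `θ` amounts to averaging over `ḡ` and `-ḡ` (`hasSum_evenStates`).
Absolute convergence of the product yields summability, and even the finiteness of the graded pieces
(`finite_bidegree`).

Theta side. By the Jacobi triple product each quotient `ϑ/η` of a symbol is, up to a power of `q`, a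
product of factors `(1 - e(a) (p⁻¹ q^r)^k)(1 - e(-a) (p q^r)^k)` (`FrameSymbol.theta_div_eta`). The
identity that defines a weak Frame shape, evaluated at `x = p⁻¹ q^r`, together with its complex
conjugate, regroups the product over symbols into a product over eigenvalues (`prod_theta_div_eta`).
The signs are now negative, so `φ_T + ψ_T` is the trace of `-T` on the whole of `A(𝔲) ⊕ A(𝔲)_θ`
(`phi_add_psi_eq_fullTrace`).

The algebraic substance is that the induced modules do not collapse: `vacuum_ne_zero` shows this by
normal ordering into an exterior algebra, and the anticommutation relations then force linear
independence (`IsFockRep.linearIndependent_stateOf`). -/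

/-- The finite product `(1 - q) (1 - q ^ 2) ⋯ (1 - q ^ n)`. -/
def qFact (q : ℂ) (n : ℕ) : ℂ := ∏ k ∈ Finset.range n, (1 - q ^ (k + 1))

theorem qFact_succ (q : ℂ) (n : ℕ) : qFact q (n + 1) = qFact q n * (1 - q ^ (n + 1)) :=
  Finset.prod_range_succ _ _

theorem one_sub_pow_succ_ne_zero {q : ℂ} (hq : ‖q‖ < 1) (k : ℕ) : 1 - q ^ (k + 1) ≠ 0 := by
  intro h
  have h1 : ‖q ^ (k + 1)‖ < 1 := by
    rw [norm_pow]
    exact pow_lt_one₀ (norm_nonneg _) hq (Nat.succ_ne_zero _)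
  rw [← sub_eq_zero.1 h, norm_one] at h1
  exact lt_irrefl _ h1

theorem qFact_ne_zero {q : ℂ} (hq : ‖q‖ < 1) (n : ℕ) : qFact q n ≠ 0 :=
  Finset.prod_ne_zero_iff.2 fun k _ => one_sub_pow_succ_ne_zero hq k

/-- The Gaussian binomial coefficients. -/
def qChoose (q : ℂ) (M j : ℕ) : ℂ :=
  if j ≤ M then qFact q M / (qFact q j * qFact q (M - j)) else 0

theorem qChoose_zero_right {q : ℂ} (hq : ‖q‖ < 1) (M : ℕ) : qChoose q M 0 = 1 := by
  have h := qFact_ne_zero hq M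
  simp only [qChoose, Nat.zero_le, if_true, Nat.sub_zero]
  rw [show qFact q 0 = 1 from rfl, one_mul, div_self h]

theorem qChoose_eq_zero {q : ℂ} {M j : ℕ} (h : M < j) : qChoose q M j = 0 :=
  if_neg (not_le.2 h)

/-- This is the variant of the `q`-Pascal rule that matches multiplication by a new last factor `1 +
y q^M`, since `q^M = q^(M-j) q^j` and `q^j` raises `j.choose 2` to `(j+1).choose 2`. -/
theorem qChoose_succ_succ {q : ℂ} (hq : ‖q‖ < 1) (M j : ℕ) :
    qChoose q (M + 1) (j + 1) = qChoose q M (j + 1) + q ^ (M - j) * qChoose q M j := by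
  rcases lt_trichotomy j M with h | rfl | h
  · obtain ⟨d, rfl⟩ := Nat.exists_eq_add_of_lt h
    have h1 := qFact_ne_zero hq j
    have h2 := qFact_ne_zero hq d
    have h3 := one_sub_pow_succ_ne_zero hq j
    have h4 := one_sub_pow_succ_ne_zero hq d
    rw [qChoose, qChoose, qChoose, if_pos (by omega), if_pos (by omega), if_pos (by omega),
      show j + d + 1 + 1 - (j + 1) = d + 1 by omega, show j + d + 1 - (j + 1) = d by omega,
      show j + d + 1 - j = d + 1 by omega, qFact_succ q (j + d + 1), qFact_succ q j,
      qFact_succ q d]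
    field_simp
    ring
  · have h1 := qFact_ne_zero hq j
    have h2 := qFact_ne_zero hq (j + 1)
    rw [qChoose_eq_zero (Nat.lt_succ_self j), qChoose, qChoose, if_pos le_rfl, if_pos le_rfl]
    simp [qFact] at h1 h2 ⊢
    rw [div_self h1, div_self h2]
  -- For `j > M` the exponent `M - j` truncates to `0`, which is harmless because every coefficient
  -- vanishes.
  · rw [qChoose_eq_zero (by omega), qChoose_eq_zero (by omega), qChoose_eq_zero h]
    simp

/-- The `q`-binomial theorem. -/
theorem prod_one_add_mul_pow {q : ℂ} (hq : ‖q‖ < 1) (y : ℂ) (M : ℕ) :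
    ∏ k ∈ Finset.range M, (1 + y * q ^ k) =
      ∑ j ∈ Finset.range (M + 1), qChoose q M j * q ^ (j.choose 2) * y ^ j := by
  induction M with
  | zero => simp [qChoose_zero_right hq]
  | succ M ih =>
    have hrec : ∀ j ∈ Finset.range (M + 1),
        qChoose q (M + 1) (j + 1) * q ^ ((j + 1).choose 2) * y ^ (j + 1) =
        qChoose q M (j + 1) * q ^ ((j + 1).choose 2) * y ^ (j + 1) +
          q ^ M * y * (qChoose q M j * q ^ (j.choose 2) * y ^ j) := by
      intro j hj
      have hj' : j ≤ M := Nat.lt_succ_iff.1 (Finset.mem_range.1 hj)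
      have : q ^ M = q ^ (M - j) * q ^ j := by rw [← pow_add, Nat.sub_add_cancel hj']
      rw [qChoose_succ_succ hq, this, Nat.choose_succ_succ' j 1, Nat.choose_one_right, pow_add]
      ring
    rw [Finset.prod_range_succ, ih, Finset.sum_range_succ' _ (M + 1), Finset.sum_congr rfl hrec,
      Finset.sum_add_distrib, ← Finset.mul_sum, qChoose_zero_right hq]
    have h1 : ∑ j ∈ Finset.range (M + 1), qChoose q M j * q ^ (j.choose 2) * y ^ j =
        ∑ j ∈ Finset.range (M + 1),
          qChoose q M (j + 1) * q ^ ((j + 1).choose 2) * y ^ (j + 1) + 1 := by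
      have h2 := Finset.sum_range_succ (fun j => qChoose q M j * q ^ (j.choose 2) * y ^ j) (M + 1)
      rw [qChoose_eq_zero (Nat.lt_succ_self M), zero_mul, zero_mul, add_zero] at h2
      rw [← h2, Finset.sum_range_succ' _ (M + 1), qChoose_zero_right hq]
      simp
    simp only [Nat.choose_zero_succ, pow_zero, mul_one]
    linear_combination h1

/-- The finite form of the Jacobi triple product. -/
theorem prod_triple_finite {t x : ℂ} (ht : ‖t‖ < 1) (ht0 : t ≠ 0) (hx : x ≠ 0) (n : ℕ) :
    ∏ k ∈ Finset.range n, ((1 + x * t ^ (2 * k + 1)) * (1 + x⁻¹ * t ^ (2 * k + 1))) =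
      ∑ j ∈ Finset.range (2 * n + 1),
        qChoose (t ^ 2) (2 * n) j * (x ^ ((j : ℤ) - n) * t ^ (((j : ℤ) - n) ^ 2)) := by
  have hq : ‖t ^ 2‖ < 1 := by
    rw [norm_pow]
    exact pow_lt_one₀ (norm_nonneg _) ht two_ne_zero
  have hxn : x ^ n * t ^ (-(n : ℤ) ^ 2) ≠ 0 :=
    mul_ne_zero (pow_ne_zero _ hx) (zpow_ne_zero _ ht0)
  have hprod : ∀ m : ℕ, ∏ k ∈ Finset.range m, (x * t ^ (-(2 * k + 1 : ℤ))) =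
      x ^ m * t ^ (-(m : ℤ) ^ 2) := by
    intro m
    induction m with
    | zero => simp
    | succ m ih =>
      rw [Finset.prod_range_succ, ih, pow_succ, mul_mul_mul_comm, ← zpow_add₀ ht0]
      congr 2
      push_cast
      ring
  -- With base `t²` and `y = x t^(1-2n)` the `2n` factors are `1 + x t^s` for the odd `s` from
  -- `1-2n` to `2n-1`. Pulling `x t^s` out of each factor with `s < 0` turns it into `1 + x⁻¹
  -- t^(-s)`; the extracted monomials multiply to `x^n t^(-n²)`.
  have key := prod_one_add_mul_pow hq (x * t ^ (1 - 2 * (n : ℤ))) (2 * n)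
  have hl : ∏ k ∈ Finset.range (2 * n), (1 + x * t ^ (1 - 2 * (n : ℤ)) * (t ^ 2) ^ k) =
      x ^ n * t ^ (-(n : ℤ) ^ 2) *
      ∏ k ∈ Finset.range n, ((1 + x * t ^ (2 * k + 1)) * (1 + x⁻¹ * t ^ (2 * k + 1))) := by
    have h3 : ∏ k ∈ Finset.range n, ((1 + x * t ^ (2 * k + 1)) * (1 + x⁻¹ * t ^ (2 * k + 1))) =
        (∏ k ∈ Finset.range n, (1 + x⁻¹ * t ^ (2 * k + 1))) *
          ∏ k ∈ Finset.range n, (1 + x * t ^ (2 * k + 1)) := by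
      rw [Finset.prod_mul_distrib, mul_comm]
    rw [h3, two_mul n, Finset.prod_range_add, ← Finset.prod_range_reflect, ← hprod,
      ← mul_assoc]
    refine congrArg₂ (· * ·) ?_ ?_
    · rw [← Finset.prod_mul_distrib]
      refine Finset.prod_congr rfl fun k hk => ?_
      have hk' := Finset.mem_range.1 hk
      have h1 : t ^ (1 - 2 * (n : ℤ)) * (t ^ 2) ^ (n - 1 - k) = t ^ (-(2 * k + 1 : ℤ)) := by
        rw [← pow_mul, ← zpow_natCast t, ← zpow_add₀ ht0]
        congr 1
        push_cast [Nat.cast_sub (show k ≤ n - 1 by omega), Nat.cast_sub (show 1 ≤ n by omega)]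
        ring
      have h2 : t ^ (-(2 * k + 1 : ℤ)) * t ^ (2 * k + 1) = 1 := by
        rw [← zpow_natCast t, ← zpow_add₀ ht0]
        simp
      rw [mul_assoc, h1, mul_add, mul_one, mul_mul_mul_comm, mul_inv_cancel₀ hx, h2]
      ring
    · refine Finset.prod_congr rfl fun k _ => ?_
      rw [mul_assoc, ← pow_mul, ← zpow_natCast t, ← zpow_natCast t, ← zpow_add₀ ht0]
      congr 3
      push_cast
      ring
  rw [hl] at key
  apply mul_left_cancel₀ hxn
  rw [key, Finset.mul_sum]
  refine Finset.sum_congr rfl fun j _ => ?_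
  have h1 : x ^ ((j : ℤ) - n) = x ^ j * (x ^ n)⁻¹ := by
    rw [zpow_sub₀ hx, zpow_natCast, zpow_natCast, div_eq_mul_inv]
  have h2 : (t ^ 2) ^ (j.choose 2) * (t ^ (1 - 2 * (n : ℤ))) ^ j =
      t ^ (-(n : ℤ) ^ 2) * t ^ (((j : ℤ) - n) ^ 2) := by
    rw [← pow_mul, ← zpow_natCast t, ← zpow_natCast (t ^ (1 - 2 * (n : ℤ))), ← zpow_mul,
      ← zpow_add₀ ht0, ← zpow_add₀ ht0]
    congr 1
    have h3 : ((2 * j.choose 2 : ℕ) : ℤ) = j * (j - 1) := by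
      rw [Nat.choose_two_right, Nat.mul_div_cancel' (Nat.even_mul_pred_self j).two_dvd]
      rcases j with _ | j
      · simp
      · push_cast [Nat.add_sub_cancel]
        ring
    rw [h3]
    ring
  have h4 : x ^ n * (x ^ n)⁻¹ = 1 := mul_inv_cancel₀ (pow_ne_zero _ hx)
  rw [mul_pow, h1]
  linear_combination qChoose (t ^ 2) (2 * n) j * x ^ j * h2 - qChoose (t ^ 2) (2 * n) j *
    x ^ j * t ^ (-(n : ℤ) ^ 2) * t ^ (((j : ℤ) - n) ^ 2) * h4

theorem multipliable_one_sub_pow_succ {q : ℂ} (hq : ‖q‖ < 1) :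
    Multipliable fun n : ℕ => 1 - q ^ (n + 1) :=
  ModularForm.multipliable_one_sub_pow hq

theorem summable_norm_pow_succ {q : ℂ} (hq : ‖q‖ < 1) : Summable fun n : ℕ => ‖q ^ (n + 1)‖ := by
  simpa using (summable_nat_add_iff 1).mpr (summable_geometric_of_lt_one (norm_nonneg _) hq)

theorem tprod_one_sub_pow_succ_ne_zero {q : ℂ} (hq : ‖q‖ < 1) :
    ∏' n : ℕ, (1 - q ^ (n + 1)) ≠ 0 := by
  simp only [sub_eq_add_neg]
  refine tprod_one_add_ne_zero_of_summable (fun n => ?_) ?_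
  · rw [← sub_eq_add_neg]
    exact one_sub_pow_succ_ne_zero hq n
  · simpa using summable_norm_pow_succ hq

theorem tendsto_qFact {q : ℂ} (hq : ‖q‖ < 1) :
    Tendsto (qFact q) atTop (𝓝 (∏' n : ℕ, (1 - q ^ (n + 1)))) :=
  (multipliable_one_sub_pow_succ hq).hasProd.tendsto_prod_nat

/-- With `P` the limit of `qFact q`, the coefficient tends to `P / (P * P)`, because `2n`, `n + m`
and `n - m` all tend to infinity. -/
theorem tendsto_qChoose {q : ℂ} (hq : ‖q‖ < 1) (m : ℤ) :
    Tendsto (fun n : ℕ => qChoose q (2 * n) (n + m).toNat) atTop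
      (𝓝 (∏' n : ℕ, (1 - q ^ (n + 1)))⁻¹) := by
  have h0 := tprod_one_sub_pow_succ_ne_zero hq
  have h1 : Tendsto (fun n : ℕ => 2 * n) atTop atTop :=
    tendsto_atTop_mono (f := fun n => n) (fun n => by omega) tendsto_id
  have h2 : ∀ m : ℤ, Tendsto (fun n : ℕ => ((n : ℤ) + m).toNat) atTop atTop := by
    intro m
    refine tendsto_atTop.2 fun b => ?_
    filter_upwards [eventually_ge_atTop (b + m.natAbs)] with n hn
    omega
  have h3 := ((tendsto_qFact hq).comp h1).div
    (((tendsto_qFact hq).comp (h2 m)).mul ((tendsto_qFact hq).comp (h2 (-m)))) (mul_ne_zero h0 h0)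
  rw [div_mul_cancel_left₀ h0] at h3
  refine h3.congr' ?_
  filter_upwards [eventually_ge_atTop m.natAbs] with n hn
  rw [qChoose, if_pos (by omega)]
  simp only [Pi.div_apply, Function.comp_apply]
  rw [show 2 * n - ((n : ℤ) + m).toNat = ((n : ℤ) + -m).toNat by omega]

/-- Uniform in both indices, because `qFact q` converges to a nonzero limit, so that it and its
inverse are bounded. This supplies the dominating series for the limit in `tprod_triple`. -/
theorem exists_norm_qChoose_le {q : ℂ} (hq : ‖q‖ < 1) :
    ∃ C : ℝ, ∀ M j : ℕ, ‖qChoose q M j‖ ≤ C := by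
  have h0 := tprod_one_sub_pow_succ_ne_zero hq
  obtain ⟨A, hA⟩ := (tendsto_qFact hq).norm.bddAbove_range
  obtain ⟨B, hB⟩ := ((tendsto_qFact hq).inv₀ h0).norm.bddAbove_range
  have hA' : ∀ n, ‖qFact q n‖ ≤ A := fun n => hA ⟨n, rfl⟩
  have hB' : ∀ n, ‖(qFact q n)⁻¹‖ ≤ B := fun n => hB ⟨n, rfl⟩
  have hA0 : 0 ≤ A := (norm_nonneg _).trans (hA' 0)
  have hB0 : 0 ≤ B := (norm_nonneg _).trans (hB' 0)
  refine ⟨A * (B * B), fun M j => ?_⟩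
  rw [qChoose]
  split_ifs
  · rw [div_eq_mul_inv, mul_inv, norm_mul, norm_mul]
    exact mul_le_mul (hA' _) (mul_le_mul (hB' _) (hB' _) (norm_nonneg _) hB0)
      (by positivity) hA0
  · rw [norm_zero]
    positivity

/-- The limit `n → ∞` of `prod_triple_finite`, by dominated convergence for series after the
summation index is centred. -/
theorem tprod_triple {t x : ℂ} (ht : ‖t‖ < 1) (ht0 : t ≠ 0) (hx : x ≠ 0)
    (hs : Summable fun m : ℤ => x ^ m * t ^ (m ^ 2))
    (hm : Multipliable fun k : ℕ => (1 + x * t ^ (2 * k + 1)) * (1 + x⁻¹ * t ^ (2 * k + 1))) :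
    ∑' m : ℤ, x ^ m * t ^ (m ^ 2) = (∏' n : ℕ, (1 - (t ^ 2) ^ (n + 1))) *
      ∏' k : ℕ, ((1 + x * t ^ (2 * k + 1)) * (1 + x⁻¹ * t ^ (2 * k + 1))) := by
  have hq : ‖t ^ 2‖ < 1 := by
    rw [norm_pow]
    exact pow_lt_one₀ (norm_nonneg _) ht two_ne_zero
  -- The test `0 ≤ n + m` is needed because `toNat` would send all smaller `m` to the index `0`,
  -- where the coefficient is `1`. For `m > n` the coefficient vanishes by itself.
  set F : ℕ → ℤ → ℂ := fun n m =>
    if 0 ≤ n + m then qChoose (t ^ 2) (2 * n) (n + m).toNat * (x ^ m * t ^ (m ^ 2)) else 0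
    with hF
  have hfin : ∀ n : ℕ, ∑' m : ℤ, F n m =
      ∏ k ∈ Finset.range n, ((1 + x * t ^ (2 * k + 1)) * (1 + x⁻¹ * t ^ (2 * k + 1))) := by
    intro n
    have hinj : Function.Injective fun j : ℕ => (j : ℤ) - n := fun i j h => by
      simpa using h
    have hsupp : Function.support (F n) ⊆ Set.range fun j : ℕ => (j : ℤ) - n := by
      intro m hm
      by_cases h : 0 ≤ n + m
      · exact ⟨(n + m).toNat, by simp only; omega⟩
      · exact absurd (if_neg h) hm
    rw [prod_triple_finite ht ht0 hx, ← hinj.tsum_eq hsupp, tsum_eq_sum (s := Finset.range (2 * n + 1))]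
    · refine Finset.sum_congr rfl fun j _ => ?_
      simp only [hF, add_sub_cancel, Nat.cast_nonneg, if_true, Int.toNat_natCast]
    · intro j hj
      have hj' : 2 * n < j := by simpa using hj
      simp only [hF, add_sub_cancel, Int.toNat_natCast, qChoose_eq_zero hj', zero_mul, ite_self]
  obtain ⟨C, hC⟩ := exists_norm_qChoose_le hq
  have hC0 : 0 ≤ C := (norm_nonneg _).trans (hC 0 0)
  have hlim : Tendsto (fun n => ∑' m : ℤ, F n m) atTop
      (𝓝 (∑' m : ℤ, (∏' n : ℕ, (1 - (t ^ 2) ^ (n + 1)))⁻¹ * (x ^ m * t ^ (m ^ 2)))) := by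
    refine tendsto_tsum_of_dominated_convergence (bound := fun m => C * ‖x ^ m * t ^ (m ^ 2)‖)
      (hs.norm.mul_left C) (fun m => ?_) (Eventually.of_forall fun n m => ?_)
    · refine ((tendsto_qChoose hq m).mul_const _).congr' ?_
      filter_upwards [eventually_ge_atTop m.natAbs] with n hn
      rw [hF]
      simp only
      rw [if_pos (by omega)]
    · rw [hF]
      simp only
      split_ifs
      · rw [norm_mul]
        exact mul_le_mul_of_nonneg_right (hC _ _) (norm_nonneg _)
      · rw [norm_zero]
        positivity
  simp only [hfin] at hlim
  have := tendsto_nhds_unique hlim hm.hasProd.tendsto_prod_nat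
  rw [tsum_mul_left] at this
  rw [← this, mul_inv_cancel_left₀ (tprod_one_sub_pow_succ_ne_zero hq)]

end TripleProduct

/-! ## Product expansions of the theta quotients -/

section ThetaProduct

/-- `e(x) = e^{2πix}` -/
def expTwoPi (x : ℂ) : ℂ := Complex.exp (2 * Real.pi * I * x)

theorem expTwoPi_add (x y : ℂ) : expTwoPi (x + y) = expTwoPi x * expTwoPi y := by
  rw [expTwoPi, mul_add, Complex.exp_add, expTwoPi, expTwoPi]

theorem expTwoPi_zero : expTwoPi 0 = 1 := by simp [expTwoPi]

theorem expTwoPi_neg (x : ℂ) : expTwoPi (-x) = (expTwoPi x)⁻¹ := by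
  rw [expTwoPi, mul_neg, Complex.exp_neg, expTwoPi]

theorem expTwoPi_ne_zero (x : ℂ) : expTwoPi x ≠ 0 := Complex.exp_ne_zero _

theorem expTwoPi_natCast_mul (n : ℕ) (x : ℂ) : expTwoPi (n * x) = expTwoPi x ^ n := by
  rw [expTwoPi, mul_left_comm, Complex.exp_nat_mul, expTwoPi]

theorem expTwoPi_half : expTwoPi (1 / 2) = -1 := by
  rw [expTwoPi, show 2 * (Real.pi : ℂ) * I * (1 / 2) = Real.pi * I by ring, Complex.exp_pi_mul_I]

theorem expTwoPi_neg_half : expTwoPi (-(1 / 2)) = -1 := by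
  rw [expTwoPi_neg, expTwoPi_half, inv_neg, inv_one]

theorem norm_expTwoPi (x : ℂ) : ‖expTwoPi x‖ = Real.exp (-(2 * Real.pi * x.im)) := by
  rw [expTwoPi, Complex.norm_exp]
  congr 1
  simp [Complex.mul_re, Complex.mul_im]

theorem norm_expTwoPi_lt_one {τ : ℂ} (hτ : 0 < τ.im) : ‖expTwoPi τ‖ < 1 := by
  rw [norm_expTwoPi, Real.exp_lt_one_iff]
  have := Real.pi_pos
  have : 0 < 2 * Real.pi * τ.im := by positivity
  linarith

theorem norm_expTwoPi_ratCast (a : ℚ) : ‖expTwoPi a‖ = 1 := by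
  rw [norm_expTwoPi]
  simp

theorem summable_norm_const_mul_pow (c : ℂ) {q : ℂ} (hq : ‖q‖ < 1) :
    Summable fun n : ℕ => ‖c * q ^ n‖ := by
  simp only [norm_mul, norm_pow]
  exact (summable_geometric_of_lt_one (norm_nonneg _) hq).mul_left _

theorem multipliable_one_sub_const_mul_pow (c : ℂ) {q : ℂ} (hq : ‖q‖ < 1) :
    Multipliable fun n : ℕ => 1 - c * q ^ n := by
  simp only [sub_eq_add_neg]
  refine multipliable_one_add_of_summable ?_
  simp only [norm_neg]
  exact summable_norm_const_mul_pow c hq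

theorem multipliable_one_add_const_mul_pow (c : ℂ) {q : ℂ} (hq : ‖q‖ < 1) :
    Multipliable fun n : ℕ => 1 + c * q ^ n :=
  multipliable_one_add_of_summable (summable_norm_const_mul_pow c hq)

/-- The Jacobi triple product identity for `ϑ`. -/
theorem jacobiTheta₂_eq_tprod (w : ℂ) {τ : ℂ} (hτ : 0 < τ.im) :
    jacobiTheta₂ w τ = (∏' n : ℕ, (1 - expTwoPi τ ^ (n + 1))) *
      ∏' n : ℕ, ((1 + expTwoPi (w + τ / 2) * expTwoPi τ ^ n) *
        (1 + expTwoPi (-w + τ / 2) * expTwoPi τ ^ n)) := by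
  have ht : ‖expTwoPi (τ / 2)‖ < 1 := norm_expTwoPi_lt_one (by
    rw [Complex.div_ofNat_im]
    positivity)
  have hq := norm_expTwoPi_lt_one hτ
  have hsq : expTwoPi (τ / 2) ^ 2 = expTwoPi τ := by
    rw [← expTwoPi_natCast_mul]
    congr 1
    push_cast
    ring
  have hterm : ∀ m : ℤ, jacobiTheta₂_term m w τ =
      expTwoPi w ^ m * expTwoPi (τ / 2) ^ (m ^ 2) := by
    intro m
    rw [jacobiTheta₂_term, expTwoPi, expTwoPi, ← Complex.exp_int_mul, ← Complex.exp_int_mul,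
      ← Complex.exp_add]
    congr 1
    push_cast
    ring
  have hfac : ∀ k : ℕ, (1 + expTwoPi w * expTwoPi (τ / 2) ^ (2 * k + 1)) *
      (1 + (expTwoPi w)⁻¹ * expTwoPi (τ / 2) ^ (2 * k + 1)) =
      (1 + expTwoPi (w + τ / 2) * expTwoPi τ ^ k) *
        (1 + expTwoPi (-w + τ / 2) * expTwoPi τ ^ k) := by
    intro k
    rw [expTwoPi_add, expTwoPi_add, expTwoPi_neg, pow_succ, pow_mul, hsq]
    ring
  have key := tprod_triple (t := expTwoPi (τ / 2)) (x := expTwoPi w) ht (expTwoPi_ne_zero _)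
    (expTwoPi_ne_zero _)
    (((summable_jacobiTheta₂_term_iff w τ).2 hτ).congr hterm)
    (((multipliable_one_add_const_mul_pow _ hq).mul
      (multipliable_one_add_const_mul_pow _ hq)).congr fun k => (hfac k).symm)
  rw [hsq] at key
  simp only [hfac] at key
  rw [← key, jacobiTheta₂]
  exact tsum_congr hterm

theorem eta_eq (τ : ℂ) :
    ModularForm.eta τ = expTwoPi (τ / 24) * ∏' n : ℕ, (1 - expTwoPi τ ^ (n + 1)) := by
  rw [ModularForm.eta]
  simp only [ModularForm.eta_q_eq_pow]
  congr 1
  rw [Function.Periodic.qParam, expTwoPi]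
  congr 1
  push_cast
  ring

/-- `p^{-1} q^r` for the `n`-th exponent `r` of the creation operators of `𝔞`. -/
def argA (σ : Sector) (z τ : ℂ) (n : ℕ) : ℂ := expTwoPi (-z + τ * (n + σ.shift / 2))

/-- `p q^r` for the `n`-th exponent `r` of the creation operators of `𝔞*`. -/
def argAstar (σ : Sector) (z τ : ℂ) (n : ℕ) : ℂ := expTwoPi (z + τ * (n + 1 - σ.shift / 2))

theorem argA_eq (σ : Sector) (z τ : ℂ) (n : ℕ) :
    argA σ z τ n = argA σ z τ 0 * expTwoPi τ ^ n := by
  rw [argA, argA, ← expTwoPi_natCast_mul, ← expTwoPi_add]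
  congr 1
  push_cast
  ring

theorem argAstar_eq (σ : Sector) (z τ : ℂ) (n : ℕ) :
    argAstar σ z τ n = argAstar σ z τ 0 * expTwoPi τ ^ n := by
  rw [argAstar, argAstar, ← expTwoPi_natCast_mul, ← expTwoPi_add]
  congr 1
  push_cast
  ring

theorem summable_norm_argA (σ : Sector) (z : ℂ) {τ : ℂ} (hτ : 0 < τ.im) :
    Summable fun n => ‖argA σ z τ n‖ := by
  exact (summable_norm_const_mul_pow _ (norm_expTwoPi_lt_one hτ)).congr fun n => by
    rw [argA_eq σ z τ n]

theorem summable_norm_argAstar (σ : Sector) (z : ℂ) {τ : ℂ} (hτ : 0 < τ.im) :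
    Summable fun n => ‖argAstar σ z τ n‖ := by
  exact (summable_norm_const_mul_pow _ (norm_expTwoPi_lt_one hτ)).congr fun n => by
    rw [argAstar_eq σ z τ n]

/-- The constant `e^{2πia}` of a symbol `k_a^m`. -/
def FrameSymbol.const (f : FrameSymbol) : ℂ := expTwoPi f.a

/-- The theta function of a symbol in the sector `σ`. -/
def FrameSymbol.theta (σ : Sector) (f : FrameSymbol) (z τ : ℂ) : ℂ :=
  match σ with
  | .untwisted => f.thetaPhi z τ
  | .twisted => f.thetaPsi z τ

theorem FrameSymbol.theta_eq (σ : Sector) (f : FrameSymbol) (z τ : ℂ) :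
    f.theta σ z τ = jacobiTheta₂ (f.k * z + (1 - σ.shift) / 2 * f.k * τ + 1 / 2 - f.a)
      (f.k * τ) := by
  cases σ <;> simp [FrameSymbol.theta, FrameSymbol.thetaPhi, FrameSymbol.thetaPsi, Sector.shift]

/-- The `n`-th factor of the product expansion of the theta quotient of a symbol. -/
def FrameSymbol.factor (σ : Sector) (f : FrameSymbol) (z τ : ℂ) (n : ℕ) : ℂ :=
  (1 - f.const * argA σ z τ n ^ (f.k : ℕ)) * (1 - f.const⁻¹ * argAstar σ z τ n ^ (f.k : ℕ))

theorem natCast_mul_im_pos (k : ℕ+) {τ : ℂ} (hτ : 0 < τ.im) : 0 < ((k : ℂ) * τ).im := by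
  have : (0 : ℝ) < (k : ℕ) := by exact_mod_cast k.pos
  simp only [Complex.mul_im, Complex.natCast_re, Complex.natCast_im, zero_mul, add_zero]
  positivity

theorem FrameSymbol.factor_eq (σ : Sector) (f : FrameSymbol) (z τ : ℂ) (n : ℕ) :
    f.factor σ z τ n =
      (1 - f.const * argA σ z τ 0 ^ (f.k : ℕ) * expTwoPi (f.k * τ) ^ n) *
      (1 - f.const⁻¹ * argAstar σ z τ 0 ^ (f.k : ℕ) * expTwoPi (f.k * τ) ^ n) := by
  rw [FrameSymbol.factor, argA_eq, argAstar_eq, mul_pow, mul_pow, expTwoPi_natCast_mul, ← pow_mul,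
    ← pow_mul, mul_comm n]
  ring

theorem FrameSymbol.multipliable_factor (σ : Sector) (f : FrameSymbol) (z : ℂ) {τ : ℂ}
    (hτ : 0 < τ.im) : Multipliable (f.factor σ z τ) := by
  have hq := norm_expTwoPi_lt_one (natCast_mul_im_pos f.k hτ)
  exact ((multipliable_one_sub_const_mul_pow _ hq).mul
    (multipliable_one_sub_const_mul_pow _ hq)).congr fun n => (f.factor_eq σ z τ n).symm

/-- The Euler product in the triple product cancels against that of `η(kτ)` and leaves only the
factor `q^(-k/24)`. -/
theorem FrameSymbol.theta_div_eta (σ : Sector) (f : FrameSymbol) (z : ℂ) {τ : ℂ}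
    (hτ : 0 < τ.im) : f.theta σ z τ / ModularForm.eta (f.k * τ) =
      expTwoPi (-(f.k * τ / 24)) * ∏' n, f.factor σ z τ n := by
  have hkτ := natCast_mul_im_pos f.k hτ
  have h0 := tprod_one_sub_pow_succ_ne_zero (norm_expTwoPi_lt_one hkτ)
  -- The half in the argument of `ϑ` turns the plus signs of the triple product into minus signs.
  -- Writing the sign as `e(-1/2)` here and as `e(1/2)` in `h2` makes it cancel inside the
  -- exponential.
  have h1 : -expTwoPi (f.k * z + (1 - σ.shift) / 2 * f.k * τ + 1 / 2 - f.a + f.k * τ / 2) =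
      f.const⁻¹ * argAstar σ z τ 0 ^ (f.k : ℕ) := by
    rw [FrameSymbol.const, argAstar, ← expTwoPi_neg, ← expTwoPi_natCast_mul, ← expTwoPi_add,
      ← neg_one_mul, ← expTwoPi_neg_half, ← expTwoPi_add]
    congr 1
    push_cast
    ring
  have h2 : -expTwoPi (-(f.k * z + (1 - σ.shift) / 2 * f.k * τ + 1 / 2 - f.a) + f.k * τ / 2) =
      f.const * argA σ z τ 0 ^ (f.k : ℕ) := by
    rw [FrameSymbol.const, argA, ← expTwoPi_natCast_mul, ← expTwoPi_add,
      ← neg_one_mul, ← expTwoPi_half, ← expTwoPi_add]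
    congr 1
    push_cast
    ring
  rw [f.theta_eq, jacobiTheta₂_eq_tprod _ hkτ, eta_eq, mul_comm (expTwoPi _), mul_div_mul_left _ _ h0,
    div_eq_mul_inv, ← expTwoPi_neg, mul_comm]
  congr 1
  refine tprod_congr fun n => ?_
  rw [f.factor_eq, ← h1, ← h2]
  ring

end ThetaProduct

/-! ## Theta quotients of weak Frame shapes -/

section FrameShape

/-- Rests on `m + (-m)⁺ = m⁺`. With denominators cleared, the Frame shape identity can be
specialized at every point, including zeros of single factors, and passed to infinite products. -/
theorem prod_zpow_mul_prod_pow {K : Type*} [Field K] (S : List FrameSymbol) (P : FrameSymbol → K)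
    (hP : ∀ f ∈ S, f.m < 0 → P f ≠ 0) :
    (S.map fun f => P f ^ f.m).prod * (S.map fun f => P f ^ (-f.m).toNat).prod =
      (S.map fun f => P f ^ f.m.toNat).prod := by
  rw [← List.prod_map_mul]
  refine congrArg List.prod (List.map_congr_left fun f hf => ?_)
  rcases le_or_gt 0 f.m with h | h
  · rw [show (-f.m).toNat = 0 by omega, pow_zero, mul_one, ← zpow_natCast, Int.toNat_of_nonneg h]
  · have h0 := hP f hf h
    rw [show f.m.toNat = 0 by omega, pow_zero, ← zpow_natCast, ← zpow_add₀ h0,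
      Int.toNat_of_nonneg (by omega), add_neg_cancel, zpow_zero]

theorem prod_pow_ne_zero {K : Type*} [Field K] (S : List FrameSymbol) (P : FrameSymbol → K)
    (hP : ∀ f ∈ S, f.m < 0 → P f ≠ 0) : (S.map fun f => P f ^ (-f.m).toNat).prod ≠ 0 := by
  refine List.prod_ne_zero fun h => ?_
  obtain ⟨f, hf, h0⟩ := List.mem_map.1 h
  rcases le_or_gt 0 f.m with hm | hm
  · rw [show (-f.m).toNat = 0 by omega, pow_zero] at h0
    exact one_ne_zero h0
  · exact pow_ne_zero _ (hP f hf hm) h0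

/-- The polynomial `1 - e^{2πia} x^k`. -/
def FrameSymbol.poly (f : FrameSymbol) : Polynomial ℂ :=
  1 - Polynomial.C f.const * Polynomial.X ^ (f.k : ℕ)

theorem FrameSymbol.const_ne_zero (f : FrameSymbol) : f.const ≠ 0 := expTwoPi_ne_zero _

theorem FrameSymbol.natDegree_poly (f : FrameSymbol) : f.poly.natDegree = (f.k : ℕ) := by
  have h1 : (Polynomial.C f.const * Polynomial.X ^ (f.k : ℕ)).natDegree = (f.k : ℕ) :=
    Polynomial.natDegree_C_mul_X_pow _ _ f.const_ne_zero
  rw [FrameSymbol.poly, Polynomial.natDegree_sub_eq_right_of_natDegree_lt, h1]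
  rw [h1, Polynomial.natDegree_one]
  exact f.k.pos

theorem FrameSymbol.poly_ne_zero (f : FrameSymbol) : f.poly ≠ 0 := by
  intro h
  have := f.natDegree_poly
  rw [h, Polynomial.natDegree_zero] at this
  exact f.k.pos.ne this

theorem FrameSymbol.eval_poly (f : FrameSymbol) (x : ℂ) :
    f.poly.eval x = 1 - f.const * x ^ (f.k : ℕ) := by
  simp [FrameSymbol.poly]

/-- A weak Frame shape, with denominators cleared. -/
theorem charpolyRev_mul_prod {χ : Polynomial ℂ} {S : List FrameSymbol}
    (h : algebraMap (Polynomial ℂ) (RatFunc ℂ) χ =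
      (S.map fun f => (1 - RatFunc.C (Complex.exp (2 * Real.pi * I * (f.a : ℂ))) *
        RatFunc.X ^ (f.k : ℕ)) ^ f.m).prod) :
    χ * (S.map fun f => f.poly ^ (-f.m).toNat).prod = (S.map fun f => f.poly ^ f.m.toNat).prod := by
  have h1 : ∀ f : FrameSymbol, 1 - RatFunc.C (Complex.exp (2 * Real.pi * I * (f.a : ℂ))) *
      RatFunc.X ^ (f.k : ℕ) = algebraMap (Polynomial ℂ) (RatFunc ℂ) f.poly := by
    intro f
    simp [FrameSymbol.poly, FrameSymbol.const, expTwoPi]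
  apply RatFunc.algebraMap_injective ℂ
  simp only [h1] at h
  rw [map_mul, h, map_list_prod, map_list_prod, List.map_map, List.map_map]
  simp only [Function.comp_def, map_pow]
  refine prod_zpow_mul_prod_pow S _ fun f _ _ => ?_
  rw [Ne, map_eq_zero_iff _ (RatFunc.algebraMap_injective ℂ)]
  exact f.poly_ne_zero

theorem natDegree_prod_poly (S : List FrameSymbol) (e : FrameSymbol → ℕ) :
    (S.map fun f => f.poly ^ e f).prod ≠ 0 ∧
    (S.map fun f => f.poly ^ e f).prod.natDegree = (S.map fun f => (f.k : ℕ) * e f).sum := by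
  induction S with
  | nil => simp
  | cons f S ih =>
    have h1 := pow_ne_zero (e f) f.poly_ne_zero
    simp only [List.map_cons, List.prod_cons, List.sum_cons]
    refine ⟨mul_ne_zero h1 ih.1, ?_⟩
    rw [Polynomial.natDegree_mul h1 ih.1, ih.2, Polynomial.natDegree_pow, f.natDegree_poly,
      mul_comm]

theorem sum_map_toNat (S : List FrameSymbol) :
    (S.map fun f => (f.k : ℤ) * f.m).sum + ((S.map fun f => (f.k : ℕ) * (-f.m).toNat).sum : ℕ) =
      ((S.map fun f => (f.k : ℕ) * f.m.toNat).sum : ℕ) := by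
  induction S with
  | nil => simp
  | cons f S ih =>
    have h : f.m + ((-f.m).toNat : ℤ) = (f.m.toNat : ℤ) := by omega
    simp only [List.map_cons, List.sum_cons]
    push_cast at ih ⊢
    linear_combination ih + (f.k : ℤ) * h

variable {κ : Type*} [Fintype κ]

theorem natDegree_prod_one_sub {lam : κ → ℂ} (hlam : ∀ i, lam i ≠ 0) :
    (∏ i, (1 - Polynomial.C (lam i) * Polynomial.X)).natDegree = Fintype.card κ := by
  have h1 : ∀ i, (1 - Polynomial.C (lam i) * Polynomial.X).natDegree = 1 := by
    intro i
    have h2 := Polynomial.natDegree_C_mul_X (lam i) (hlam i)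
    rw [Polynomial.natDegree_sub_eq_right_of_natDegree_lt, h2]
    rw [h2, Polynomial.natDegree_one]
    exact one_pos
  rw [Polynomial.natDegree_prod]
  · simp [h1]
  · intro i _ h
    have := h1 i
    rw [h, Polynomial.natDegree_zero] at this
    exact zero_ne_one this

/-- A weak Frame shape of an invertible operator has degree `dim 𝔞`. -/
theorem sum_k_mul_m {lam : κ → ℂ} (hlam : ∀ i, lam i ≠ 0) {S : List FrameSymbol}
    (h : (∏ i, (1 - Polynomial.C (lam i) * Polynomial.X)) *
      (S.map fun f => f.poly ^ (-f.m).toNat).prod = (S.map fun f => f.poly ^ f.m.toNat).prod) :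
    (S.map fun f => (f.k : ℤ) * f.m).sum = Fintype.card κ := by
  have h1 := natDegree_prod_poly S fun f => (-f.m).toNat
  have h2 := natDegree_prod_poly S fun f => f.m.toNat
  have h3 : (∏ i, (1 - Polynomial.C (lam i) * Polynomial.X)) ≠ 0 := by
    intro h0
    rw [h0, zero_mul] at h
    exact h2.1 h.symm
  have h4 := congrArg Polynomial.natDegree h
  rw [Polynomial.natDegree_mul h3 h1.1, h1.2, h2.2, natDegree_prod_one_sub hlam] at h4
  have h5 := sum_map_toNat S
  rw [← h4] at h5
  push_cast at h5
  linarith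

theorem FrameSymbol.conj_const (f : FrameSymbol) :
    (starRingEnd ℂ) f.const = f.const⁻¹ :=
  (Complex.inv_eq_conj (norm_expTwoPi_ratCast f.a)).symm

/-- The `n`-th factor of the product expansion of the graded trace. -/
def traceFactor (lam : κ → ℂ) (σ : Sector) (z τ : ℂ) (n : ℕ) : ℂ :=
  ∏ i, ((1 - lam i * argA σ z τ n) * (1 - (lam i)⁻¹ * argAstar σ z τ n))

theorem traceFactor_mul_prod {lam : κ → ℂ} (hlam : ∀ i, ‖lam i‖ = 1) {S : List FrameSymbol}
    (h : (∏ i, (1 - Polynomial.C (lam i) * Polynomial.X)) *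
      (S.map fun f => f.poly ^ (-f.m).toNat).prod = (S.map fun f => f.poly ^ f.m.toNat).prod)
    (σ : Sector) (z τ : ℂ) (n : ℕ) :
    traceFactor lam σ z τ n * (S.map fun f => f.factor σ z τ n ^ (-f.m).toNat).prod =
      (S.map fun f => f.factor σ z τ n ^ f.m.toNat).prod := by
  have hev : ∀ x : ℂ, (∏ i, (1 - lam i * x)) *
      (S.map fun f => (1 - f.const * x ^ (f.k : ℕ)) ^ (-f.m).toNat).prod =
      (S.map fun f => (1 - f.const * x ^ (f.k : ℕ)) ^ f.m.toNat).prod := by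
    intro x
    have := congrArg (Polynomial.eval x) h
    simpa [Polynomial.eval_mul, Polynomial.eval_prod, Polynomial.eval_list_prod, List.map_map,
      Function.comp_def, FrameSymbol.eval_poly] using this
  -- The factors with inverse eigenvalues come from complex conjugation: both `λ_i` and `e(a)` have
  -- modulus one, so conjugation inverts them.
  have hev' : ∀ y : ℂ, (∏ i, (1 - (lam i)⁻¹ * y)) *
      (S.map fun f => (1 - f.const⁻¹ * y ^ (f.k : ℕ)) ^ (-f.m).toNat).prod =
      (S.map fun f => (1 - f.const⁻¹ * y ^ (f.k : ℕ)) ^ f.m.toNat).prod := by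
    intro y
    have := congrArg (starRingEnd ℂ) (hev ((starRingEnd ℂ) y))
    simpa [map_list_prod, List.map_map, Function.comp_def, FrameSymbol.conj_const,
      ← Complex.inv_eq_conj (hlam _)] using this
  simp only [traceFactor, FrameSymbol.factor, mul_pow, List.prod_map_mul, Finset.prod_mul_distrib]
  rw [← hev, ← hev']
  ring

theorem hasProd_list_prod (S : List FrameSymbol) (F : FrameSymbol → ℕ → ℂ)
    (hF : ∀ f, Multipliable (F f)) (e : FrameSymbol → ℕ) :
    HasProd (fun n => (S.map fun f => F f n ^ e f).prod)
      (S.map fun f => (∏' n, F f n) ^ e f).prod := by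
  induction S with
  | nil => simp
  | cons f S ih =>
    simp only [List.map_cons, List.prod_cons]
    exact ((hF f).hasProd.pow (e f)).mul ih

theorem multipliable_traceFactor (lam : κ → ℂ) (σ : Sector) (z : ℂ) {τ : ℂ} (hτ : 0 < τ.im) :
    Multipliable (traceFactor lam σ z τ) := by
  have hq := norm_expTwoPi_lt_one hτ
  refine multipliable_prod fun i _ => ?_
  refine ((multipliable_one_sub_const_mul_pow (lam i * argA σ z τ 0) hq).mul
    (multipliable_one_sub_const_mul_pow ((lam i)⁻¹ * argAstar σ z τ 0) hq)).congr fun n => ?_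
  rw [argA_eq σ z τ n, argAstar_eq σ z τ n, mul_assoc, mul_assoc]

/-- The product of the theta quotients of a weak Frame shape. -/
theorem prod_theta_div_eta {lam : κ → ℂ} (hlam : ∀ i, ‖lam i‖ = 1) {S : List FrameSymbol}
    (h : (∏ i, (1 - Polynomial.C (lam i) * Polynomial.X)) *
      (S.map fun f => f.poly ^ (-f.m).toNat).prod = (S.map fun f => f.poly ^ f.m.toNat).prod)
    (σ : Sector) (z : ℂ) {τ : ℂ} (hτ : 0 < τ.im)
    (hreg : ∀ f ∈ S, f.m < 0 → f.theta σ z τ ≠ 0) :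
    (S.map fun f => f.theta σ z τ ^ f.m / ModularForm.eta (f.k * τ) ^ f.m).prod =
      expTwoPi (-(Fintype.card κ * τ / 24)) * ∏' n, traceFactor lam σ z τ n := by
  have hlam0 : ∀ i, lam i ≠ 0 := fun i => norm_ne_zero_iff.1 (by rw [hlam i]; exact one_ne_zero)
  -- Since `η` has no zeros, a vanishing product would force a zero of a theta function with
  -- negative exponent, which regularity excludes.
  have hP : ∀ f ∈ S, f.m < 0 → ∏' n, f.factor σ z τ n ≠ 0 := by
    intro f hf hm h0
    have h1 := f.theta_div_eta σ z hτ
    have h2 : ModularForm.eta (f.k * τ) ≠ 0 :=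
      ModularForm.eta_ne_zero (natCast_mul_im_pos f.k hτ)
    rw [h0, mul_zero, div_eq_zero_iff] at h1
    exact h1.elim (hreg f hf hm) h2
  have hprod : (∏' n, traceFactor lam σ z τ n) *
      (S.map fun f => (∏' n, f.factor σ z τ n) ^ (-f.m).toNat).prod =
      (S.map fun f => (∏' n, f.factor σ z τ n) ^ f.m.toNat).prod := by
    have hF : ∀ f : FrameSymbol, Multipliable (f.factor σ z τ) :=
      fun f => f.multipliable_factor σ z hτ
    have h1 := (multipliable_traceFactor lam σ z hτ).hasProd.mul
      (hasProd_list_prod S (fun f => f.factor σ z τ) hF fun f => (-f.m).toNat)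
    simp only [traceFactor_mul_prod hlam h] at h1
    exact h1.unique (hasProd_list_prod S (fun f => f.factor σ z τ) hF fun f => f.m.toNat)
  rw [← prod_zpow_mul_prod_pow S _ hP] at hprod
  have hprod' := mul_right_cancel₀ (prod_pow_ne_zero S _ hP) hprod
  -- The powers `q^(-k/24)` of the symbols combine to `q^(-N/24)`, as `∑ k_j m_j = N` by comparison
  -- of degrees in the Frame shape.
  have hsum : ∀ S : List FrameSymbol, (S.map fun f => expTwoPi (-(f.k * τ / 24)) ^ f.m).prod =
      expTwoPi (-((S.map fun f => (f.k : ℤ) * f.m).sum * τ / 24)) := by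
    intro S
    induction S with
    | nil => simp [expTwoPi]
    | cons f S ih =>
      rw [List.map_cons, List.prod_cons, ih, List.map_cons, List.sum_cons, expTwoPi, expTwoPi,
        expTwoPi, ← Complex.exp_int_mul, ← Complex.exp_add]
      congr 1
      push_cast
      ring
  rw [hprod', show (Fintype.card κ : ℂ) = ((Fintype.card κ : ℤ) : ℂ) by simp,
    ← sum_k_mul_m hlam0 h, ← hsum, ← List.prod_map_mul]
  simp only [← div_zpow, ← mul_zpow]
  refine congrArg List.prod (List.map_congr_left fun f _ => ?_)
  rw [f.theta_div_eta σ z hτ]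

theorem phi_eq_tprod {lam : κ → ℂ} (hlam : ∀ i, ‖lam i‖ = 1) {S : List FrameSymbol}
    (h : (∏ i, (1 - Polynomial.C (lam i) * Polynomial.X)) *
      (S.map fun f => f.poly ^ (-f.m).toNat).prod = (S.map fun f => f.poly ^ f.m.toNat).prod)
    (z : ℂ) {τ : ℂ} (hτ : 0 < τ.im) (hreg : IsRegularAt S z τ) :
    phi S z τ = expTwoPi (-(Fintype.card κ * τ / 24)) *
      ∏' n, traceFactor lam .untwisted z τ n :=
  prod_theta_div_eta hlam h .untwisted z hτ fun f hf hm => (hreg f hf hm).1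

theorem psi_eq_tprod {lam : κ → ℂ} (hlam : ∀ i, ‖lam i‖ = 1) {S : List FrameSymbol}
    (h : (∏ i, (1 - Polynomial.C (lam i) * Polynomial.X)) *
      (S.map fun f => f.poly ^ (-f.m).toNat).prod = (S.map fun f => f.poly ^ f.m.toNat).prod)
    (z : ℂ) {τ : ℂ} (hτ : 0 < τ.im) (hreg : IsRegularAt S z τ) :
    psi S z τ = expTwoPi (z * (Fintype.card κ / 2)) * expTwoPi (τ * (Fintype.card κ / 8)) *
      (expTwoPi (-(Fintype.card κ * τ / 24)) * ∏' n, traceFactor lam .twisted z τ n) := by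
  have hlam0 : ∀ i, lam i ≠ 0 := fun i => norm_ne_zero_iff.1 (by rw [hlam i]; exact one_ne_zero)
  rw [← prod_theta_div_eta hlam h .twisted z hτ fun f hf hm => (hreg f hf hm).2, psi,
    List.prod_map_mul]
  refine congrArg₂ (· * ·) ?_ rfl
  have hsum : ∀ S : List FrameSymbol, (S.map fun f =>
      Complex.exp (2 * Real.pi * I * z * (f.k * f.m / 2)) *
      Complex.exp (2 * Real.pi * I * τ * (f.k * f.m / 8))).prod =
      expTwoPi (z * (((S.map fun f => (f.k : ℤ) * f.m).sum : ℤ) / 2)) *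
      expTwoPi (τ * (((S.map fun f => (f.k : ℤ) * f.m).sum : ℤ) / 8)) := by
    intro S
    induction S with
    | nil => simp [expTwoPi]
    | cons f S ih =>
      rw [List.map_cons, List.prod_cons, ih, List.map_cons, List.sum_cons]
      simp only [expTwoPi, ← Complex.exp_add]
      congr 1
      push_cast
      ring
  rw [hsum, sum_k_mul_m hlam0 h]
  simp

/-! ## The regular points -/

/-- At `z = 0` every factor of the triple product is `1 + q^(n+1/2)`, squared, or `1 - q^(n+1)`, and
the powers of `q` have modulus less than one. One nonzero value suffices to make the zeros in `z`
isolated. -/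
theorem jacobiTheta₂_zero_ne_zero {τ : ℂ} (hτ : 0 < τ.im) : jacobiTheta₂ 0 τ ≠ 0 := by
  have hq := norm_expTwoPi_lt_one hτ
  have ht : ‖expTwoPi (τ / 2)‖ < 1 := norm_expTwoPi_lt_one (by
    rw [Complex.div_ofNat_im]
    positivity)
  have hm := multipliable_one_add_const_mul_pow (expTwoPi (τ / 2)) hq
  have h1 : ∏' n : ℕ, (1 + expTwoPi (τ / 2) * expTwoPi τ ^ n) ≠ 0 := by
    refine tprod_one_add_ne_zero_of_summable (fun n h => ?_) (summable_norm_const_mul_pow _ hq)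
    have h2 : ‖expTwoPi (τ / 2) * expTwoPi τ ^ n‖ < 1 := by
      rw [norm_mul, norm_pow]
      exact mul_lt_one_of_nonneg_of_lt_one_left (norm_nonneg _) ht
        (pow_le_one₀ (norm_nonneg _) hq.le)
    rw [eq_neg_of_add_eq_zero_right h, norm_neg, norm_one] at h2
    exact lt_irrefl _ h2
  rw [jacobiTheta₂_eq_tprod 0 hτ, neg_zero, zero_add, hm.tprod_mul hm]
  exact mul_ne_zero (tprod_one_sub_pow_succ_ne_zero hq) (mul_ne_zero h1 h1)

theorem FrameSymbol.eventually_theta_ne_zero (σ : Sector) (f : FrameSymbol) {τ : ℂ}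
    (hτ : 0 < τ.im) : ∀ᶠ z in Filter.codiscrete ℂ, f.theta σ z τ ≠ 0 := by
  have hk : ((f.k : ℕ) : ℂ) ≠ 0 := Nat.cast_ne_zero.2 f.k.ne_zero
  have hkτ := natCast_mul_im_pos f.k hτ
  have hd : Differentiable ℂ fun z => f.theta σ z τ := by
    intro z
    simp only [f.theta_eq]
    exact (differentiableAt_jacobiTheta₂_fst _ hkτ).comp z (by fun_prop)
  have ha : AnalyticOnNhd ℂ (fun z => f.theta σ z τ) Set.univ :=
    hd.differentiableOn.analyticOnNhd isOpen_univ
  -- The witness is the `z` at which the first argument of `ϑ` is zero.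
  refine ha.preimage_zero_mem_codiscrete
    (x := -((1 - σ.shift) / 2 * f.k * τ + 1 / 2 - f.a) / f.k) ?_
  simp only [f.theta_eq]
  rw [mul_div_cancel₀ _ hk, show -((1 - σ.shift) / 2 * (f.k : ℂ) * τ + 1 / 2 - f.a) +
    (1 - σ.shift) / 2 * f.k * τ + 1 / 2 - f.a = 0 by ring]
  exact jacobiTheta₂_zero_ne_zero hkτ

theorem eventually_isRegularAt (S : List FrameSymbol) {τ : ℂ} (hτ : 0 < τ.im) :
    ∀ᶠ z in Filter.codiscrete ℂ, IsRegularAt S z τ := by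
  refine (Filter.eventually_all_finite S.finite_toSet).2 fun f _ => ?_
  filter_upwards [f.eventually_theta_ne_zero .untwisted hτ,
    f.eventually_theta_ne_zero .twisted hτ] with z h1 h2 _
  exact ⟨h1, h2⟩

end FrameShape

/-! ## Fock representations of the canonical anticommutation relations -/

section Anticommutation

variable {K E : Type*} [AddCommGroup E] [Module ℂ E]

/-- Creation operators `c k`, annihilation operators `d k` and a nonzero vacuum. -/
structure IsFockRep (c d : K → Module.End ℂ E) (vac : E) : Prop where
  create_create : ∀ k l x, c k (c l x) = -c l (c k x)
  annihilate_create_self : ∀ k x, d k (c k x) = x - c k (d k x)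
  annihilate_create_of_ne : ∀ k l x, k ≠ l → d k (c l x) = -c l (d k x)
  annihilate_vac : ∀ k, d k vac = 0
  vac_ne_zero : vac ≠ 0

/-- The vector `c k₁ ⋯ c kₙ vac`. -/
def word (c : K → Module.End ℂ E) (vac : E) (l : List K) : E := l.foldr (fun k x => c k x) vac

theorem word_cons (c : K → Module.End ℂ E) (vac : E) (k : K) (l : List K) :
    word c vac (k :: l) = c k (word c vac l) := rfl

/-- The vector obtained from the vacuum by applying the creation operators in a finite set. -/
def stateOf (c : K → Module.End ℂ E) (vac : E) (S : Finset K) : E := word c vac S.toList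

theorem apply_word_of_add {c : K → Module.End ℂ E} {vac : E} {L : Module.End ℂ E} {w : K → ℂ}
    {e : ℂ} (hL : ∀ k x, L (c k x) = c k (L x) + w k • c k x) (hvac : L vac = e • vac)
    (l : List K) : L (word c vac l) = (e + (l.map w).sum) • word c vac l := by
  induction l with
  | nil => simpa [word] using hvac
  | cons k l ih =>
    rw [word_cons, hL, ih, map_smul, List.map_cons, List.sum_cons]
    module

theorem apply_stateOf_of_add {c : K → Module.End ℂ E} {vac : E} {L : Module.End ℂ E} {w : K → ℂ}
    {e : ℂ} (hL : ∀ k x, L (c k x) = c k (L x) + w k • c k x) (hvac : L vac = e • vac)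
    (S : Finset K) : L (stateOf c vac S) = (e + ∑ k ∈ S, w k) • stateOf c vac S := by
  rw [stateOf, apply_word_of_add hL hvac, Finset.sum_map_toList]

theorem apply_stateOf_of_mul {c : K → Module.End ℂ E} {vac : E} {G : Module.End ℂ E} {w : K → ℂ}
    (hG : ∀ k x, G (c k x) = w k • c k (G x)) (hvac : G vac = vac)
    (S : Finset K) : G (stateOf c vac S) = (∏ k ∈ S, w k) • stateOf c vac S := by
  have h : ∀ l : List K, G (word c vac l) = (l.map w).prod • word c vac l := by
    intro l
    induction l with
    | nil => simpa [word] using hvac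
    | cons k l ih =>
      rw [word_cons, hG, ih, map_smul, List.map_cons, List.prod_cons, smul_smul]
  rw [stateOf, h, Finset.prod_map_toList]

namespace IsFockRep

variable {c d : K → Module.End ℂ E} {vac : E}

theorem create_self (h : IsFockRep c d vac) (k : K) (x : E) : c k (c k x) = 0 := by
  have h1 := h.create_create k k x
  have h2 : (2 : ℂ) • c k (c k x) = 0 := by
    rw [two_smul]
    nth_rw 1 [h1]
    exact neg_add_cancel _
  exact (smul_eq_zero.1 h2).resolve_left two_ne_zero

theorem create_word_of_mem (h : IsFockRep c d vac) {k : K} {l : List K} (hk : k ∈ l) : c k (word c vac l) = 0 := by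
  induction l with
  | nil => simp at hk
  | cons j l ih =>
    rw [word_cons]
    rcases List.mem_cons.1 hk with rfl | hk
    · exact h.create_self _ _
    · rw [h.create_create, ih hk, map_zero, neg_zero]

theorem word_of_not_nodup (h : IsFockRep c d vac) {l : List K} (hl : ¬l.Nodup) : word c vac l = 0 := by
  induction l with
  | nil => simp at hl
  | cons j l ih =>
    rw [word_cons]
    by_cases hj : j ∈ l
    · exact h.create_word_of_mem hj
    · rw [ih fun hn => hl (List.nodup_cons.2 ⟨hj, hn⟩), map_zero]

/-- Reordering a word changes at most its sign, so the arbitrary order chosen by `Finset.toList`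
does not affect the spans. -/
theorem word_perm (h : IsFockRep c d vac) {l l' : List K} (hp : l.Perm l') :
    word c vac l = word c vac l' ∨ word c vac l = -word c vac l' := by
  induction hp with
  | nil => exact Or.inl rfl
  | cons k _ ih =>
    rw [word_cons, word_cons]
    rcases ih with ih | ih
    · exact Or.inl (by rw [ih])
    · exact Or.inr (by rw [ih, map_neg])
  | swap k j l => exact Or.inr (h.create_create _ _ _)
  | trans _ _ ih ih' =>
    rcases ih with ih | ih <;> rcases ih' with ih' | ih' <;> rw [ih, ih'] <;> simp

theorem annihilate_word_of_not_mem (h : IsFockRep c d vac) {k : K} {l : List K} (hk : k ∉ l) :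
    d k (word c vac l) = 0 := by
  induction l with
  | nil => exact h.annihilate_vac k
  | cons j l ih =>
    rw [List.mem_cons, not_or] at hk
    rw [word_cons, h.annihilate_create_of_ne k j _ hk.1, ih hk.2, map_zero, neg_zero]

theorem word_ne_zero (h : IsFockRep c d vac) {l : List K} (hl : l.Nodup) : word c vac l ≠ 0 := by
  induction l with
  | nil => exact h.vac_ne_zero
  | cons j l ih =>
    rw [List.nodup_cons] at hl
    intro h0
    rw [word_cons] at h0
    have h1 := h.annihilate_create_self j (word c vac l)
    rw [h0, map_zero, h.annihilate_word_of_not_mem hl.1, map_zero, sub_zero] at h1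
    exact ih hl.2 h1.symm

theorem create_annihilate_word_of_mem (h : IsFockRep c d vac) {k : K} {l : List K} (hk : k ∈ l) (hl : l.Nodup) :
    c k (d k (word c vac l)) = word c vac l := by
  induction l with
  | nil => simp at hk
  | cons j l ih =>
    rw [List.nodup_cons] at hl
    rw [word_cons]
    rcases List.mem_cons.1 hk with rfl | hk
    · rw [h.annihilate_create_self, h.annihilate_word_of_not_mem hl.1, map_zero, sub_zero]
    · have hne : k ≠ j := fun e => hl.1 (e ▸ hk)
      rw [h.annihilate_create_of_ne k j _ hne, map_neg, h.create_create, neg_neg, ih hk hl.2]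

open Classical in
-- The operator `c k * d k` is the occupation number of `k`: it fixes a state that contains `k` and
-- kills the others. The product therefore projects to the states that agree with `T` on `l`.
theorem projection_stateOf (h : IsFockRep c d vac) (T S : Finset K) (l : List K) :
    (l.map fun k => if k ∈ T then c k * d k else 1 - c k * d k).prod (stateOf c vac S) =
      if ∀ k ∈ l, (k ∈ S ↔ k ∈ T) then stateOf c vac S else 0 := by
  have h1 : ∀ k ∈ S, c k (d k (stateOf c vac S)) = stateOf c vac S := fun k hk =>
    h.create_annihilate_word_of_mem (Finset.mem_toList.2 hk) S.nodup_toList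
  have h2 : ∀ k ∉ S, c k (d k (stateOf c vac S)) = 0 := fun k hk => by
    rw [stateOf, h.annihilate_word_of_not_mem (fun hm => hk (Finset.mem_toList.1 hm)), map_zero]
  induction l with
  | nil => simp
  | cons k l ih =>
    rw [List.map_cons, List.prod_cons, Module.End.mul_apply, ih]
    simp only [List.mem_cons, forall_eq_or_imp]
    by_cases hl : ∀ k ∈ l, (k ∈ S ↔ k ∈ T)
    · rw [if_pos hl]
      by_cases hS : k ∈ S <;> by_cases hT : k ∈ T <;>
        simp only [hS, hT, if_true, if_false, Module.End.mul_apply, LinearMap.sub_apply,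
          Module.End.one_apply, h1, h2, iff_true, iff_false, not_true, not_false_eq_true,
          false_and, sub_self, sub_zero]
      all_goals simp_all
    · simp [hl]

theorem linearIndependent_stateOf (h : IsFockRep c d vac) : LinearIndependent ℂ (stateOf c vac) := by
  classical
  rw [linearIndependent_iff']
  intro s a hsum T hT
  -- Testing all indices that occur in any set of `s` isolates the single state `T` in the relation.
  have h1 := congrArg (((s.sup id).toList.map fun k =>
    if k ∈ T then c k * d k else 1 - c k * d k).prod) hsum
  rw [map_sum, map_zero, Finset.sum_eq_single T] at h1
  · rw [map_smul, h.projection_stateOf, if_pos fun _ _ => Iff.rfl] at h1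
    exact (smul_eq_zero.1 h1).resolve_right (h.word_ne_zero T.nodup_toList)
  · intro S hS hne
    rw [map_smul, h.projection_stateOf, if_neg, smul_zero]
    intro hall
    refine hne (Finset.ext fun k => ?_)
    by_cases hk : k ∈ s.sup id
    · exact hall k (Finset.mem_toList.2 hk)
    · exact iff_of_false (fun h' => hk (Finset.le_sup (f := id) hS h'))
        (fun h' => hk (Finset.le_sup (f := id) hT h'))
  · exact fun h' => absurd hT h'

theorem word_mem_span (h : IsFockRep c d vac) (l : List K) : word c vac l ∈ Submodule.span ℂ (Set.range (stateOf c vac)) := by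
  classical
  by_cases hl : l.Nodup
  · have hmem : stateOf c vac l.toFinset ∈ Submodule.span ℂ (Set.range (stateOf c vac)) :=
      Submodule.subset_span ⟨_, rfl⟩
    rcases h.word_perm (List.toFinset_toList hl).symm with h1 | h1 <;> rw [h1]
    · exact hmem
    · exact neg_mem hmem
  · rw [h.word_of_not_nodup hl]
    exact zero_mem _

theorem create_mem_span (k : K) {x : E} (hx : x ∈ Submodule.span ℂ (Set.range (word c vac))) :
    c k x ∈ Submodule.span ℂ (Set.range (word c vac)) := by
  induction hx using Submodule.span_induction with
  | mem x hx =>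
    obtain ⟨l, rfl⟩ := hx
    exact Submodule.subset_span ⟨k :: l, rfl⟩
  | zero => simp
  | add x y _ _ hx hy => rw [map_add]; exact add_mem hx hy
  | smul a x _ hx => rw [map_smul]; exact Submodule.smul_mem _ _ hx

theorem annihilate_mem_span (h : IsFockRep c d vac) (k : K) {x : E}
    (hx : x ∈ Submodule.span ℂ (Set.range (word c vac))) :
    d k x ∈ Submodule.span ℂ (Set.range (word c vac)) := by
  induction hx using Submodule.span_induction with
  | mem x hx =>
    obtain ⟨l, rfl⟩ := hx
    induction l with
    | nil => rw [show word c vac [] = vac from rfl, h.annihilate_vac]; exact zero_mem _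
    | cons j l ih =>
      rw [word_cons]
      by_cases hkj : k = j
      · subst hkj
        rw [h.annihilate_create_self]
        exact sub_mem (Submodule.subset_span ⟨l, rfl⟩) (create_mem_span k ih)
      · rw [h.annihilate_create_of_ne k j _ hkj]
        exact neg_mem (create_mem_span j ih)
  | zero => simp
  | add x y _ _ hx hy => rw [map_add]; exact add_mem hx hy
  | smul a x _ hx => rw [map_smul]; exact Submodule.smul_mem _ _ hx

/-- The basis of a Fock representation generated by the vacuum. -/
def basis (h : IsFockRep c d vac) (hspan : Submodule.span ℂ (Set.range (word c vac)) = ⊤) :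
    Module.Basis (Finset K) ℂ E :=
  Module.Basis.mk h.linearIndependent_stateOf (by
    rw [← hspan, Submodule.span_le]
    rintro _ ⟨l, rfl⟩
    exact h.word_mem_span l)

theorem basis_apply (h : IsFockRep c d vac) (hspan : Submodule.span ℂ (Set.range (word c vac)) = ⊤) (S : Finset K) :
    h.basis hspan S = stateOf c vac S := Module.Basis.mk_apply _ _ _

end IsFockRep

end Anticommutation

/-! ## The modules `A(𝔲)` and `A(𝔲)_θ` as Fock representations -/

section FockModule

variable {V : Type*} [AddCommGroup V] [Module ℂ V]

theorem polar_loopQuad (σ : Sector) (x y : Loop V) :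
    QuadraticMap.polar (loopQuad V σ) x y = -2 * loopForm V σ x y := by
  simp only [QuadraticMap.polar, loopQuad, neg_apply,
    LinearMap.BilinMap.toQuadraticMap_apply, map_add, LinearMap.add_apply]
  rw [loopForm_comm σ y x]
  ring

theorem cl_mul_cl_add_swap (σ : Sector) (n : ℤ) (u : Dbl V) (m : ℤ) (v : Dbl V) :
    cl σ n u * cl σ m v + cl σ m v * cl σ n u =
      algebraMap ℂ _ (if m = -n - σ.shift then -2 * form V u v else 0) := by
  rw [cl, cl, CliffordAlgebra.ι_mul_ι_add_swap, polar_loopQuad, loopForm_single_left,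
    Finsupp.single_apply]
  split_ifs <;> simp

theorem op_algebraMap (σ : Sector) (r : ℂ) (x : Fock V σ) :
    op σ (algebraMap ℂ _ r) x = r • x := by
  obtain ⟨y, rfl⟩ := Submodule.Quotient.mk_surjective _ x
  rw [op_mk, ← Algebra.smul_def, Submodule.Quotient.mk_smul]

theorem op_mul (σ : Sector) (c d : Cl V σ) (x : Fock V σ) : op σ (c * d) x = op σ c (op σ d x) := by
  obtain ⟨y, rfl⟩ := Submodule.Quotient.mk_surjective _ x
  rw [op_mk, op_mk, op_mk, mul_assoc]

theorem mode_mode_add_swap (σ : Sector) (n : ℤ) (u : Dbl V) (m : ℤ) (v : Dbl V) (x : Fock V σ) :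
    mode σ n u (mode σ m v x) + mode σ m v (mode σ n u x) =
      (if m = -n - σ.shift then -2 * form V u v else 0 : ℂ) • x := by
  rw [mode, mode, ← op_mul, ← op_mul, ← LinearMap.add_apply, ← op_add, cl_mul_cl_add_swap,
    op_algebraMap]

/-- The vacuum vector. -/
def vacuum (V : Type*) [AddCommGroup V] [Module ℂ V] (σ : Sector) : Fock V σ :=
  Submodule.Quotient.mk 1

theorem op_vacuum (σ : Sector) (c : Cl V σ) : op σ c (vacuum V σ) = Submodule.Quotient.mk c := by
  rw [vacuum, op_mk, mul_one]

theorem act_vacuum (σ : Sector) (T : V ≃ₗ[ℂ] V) : act σ T (vacuum V σ) = vacuum V σ := by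
  rw [vacuum, act_mk, map_one]

theorem mode_vacuum_of_pos (σ : Sector) (n : ℤ) (u : Dbl V) (h : 0 < σ.expo n) :
    mode σ n u (vacuum V σ) = 0 := by
  rw [mode, op_vacuum, Submodule.Quotient.mk_eq_zero]
  exact Submodule.subset_span (.pos n u h)

theorem mode_vacuum_of_zero (σ : Sector) (n : ℤ) (f : Module.Dual ℂ V) (h : σ.expo n = 0) :
    mode σ n (0, f) (vacuum V σ) = 0 := by
  rw [mode, op_vacuum, Submodule.Quotient.mk_eq_zero]
  exact Submodule.subset_span (.zero n f h)

theorem Sector.expo_neg (σ : Sector) (n : ℤ) : σ.expo (-n - σ.shift) = -σ.expo n := by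
  simp only [Sector.expo]
  push_cast
  ring

/-! ### The vacuum is not zero -/

/-- The projection of `𝔲 ⊗ t ^ r` to its creation part. -/
def creationProj (V : Type*) [AddCommGroup V] [Module ℂ V] (σ : Sector) (n : ℤ) :
    Dbl V →ₗ[ℂ] Dbl V :=
  open Classical in
  if σ.expo n < 0 then LinearMap.id
  else if σ.expo n = 0 then LinearMap.inl ℂ V (Module.Dual ℂ V) ∘ₗ LinearMap.fst ℂ _ _
  else 0

/-- The bilinear form `(x, y) ↦ 2 ⟨x, y_-⟩` where `y_-` is the creation part of `y`. -/
def contractionForm (V : Type*) [AddCommGroup V] [Module ℂ V] (σ : Sector) :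
    LinearMap.BilinForm ℂ (Loop V) :=
  (2 : ℂ) • (loopForm V σ).compl₂
    (Finsupp.lsum ℂ fun n : ℤ => Finsupp.lsingle n ∘ₗ creationProj V σ n)

theorem contractionForm_single (σ : Sector) (x : Loop V) (n : ℤ) (u : Dbl V) :
    contractionForm V σ x (Finsupp.single n u) =
      2 * loopForm V σ x (Finsupp.single n (creationProj V σ n u)) := by
  simp [contractionForm]

/-- For `r ≠ 0` exactly one of the exponents `r` and `-r` is creating. For `r = 0` the two terms are
the two halves of the pairing between `𝔞` and `𝔞*`. Hence the contraction form is a nonsymmetric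
bilinear form with quadratic form `⟨x, x⟩`, as `CliffordAlgebra.changeForm` requires in order to
deform the Clifford algebra to the exterior algebra. -/
theorem form_creationProj (σ : Sector) (n : ℤ) (u v : Dbl V) :
    form V u (creationProj V σ (-n - σ.shift) v) + form V v (creationProj V σ n u) =
      form V u v := by
  simp only [creationProj, σ.expo_neg]
  rcases lt_trichotomy (σ.expo n) 0 with h | h | h
  · rw [if_neg (by linarith), if_neg (by linarith), if_pos h]
    simp [form_comm v u]
  · rw [if_neg (by linarith), if_pos (by linarith), if_neg (by linarith), if_pos h]
    simp [form]
    ring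
  · rw [if_pos (by linarith), if_neg (by linarith), if_neg (by linarith)]
    simp

theorem contractionForm_add_swap (σ : Sector) (x y : Loop V) :
    contractionForm V σ x y + contractionForm V σ y x = 2 * loopForm V σ x y := by
  induction x using Finsupp.induction_linear with
  | zero => simp
  | add x x' hx hx' =>
    simp only [map_add, LinearMap.add_apply]
    linear_combination hx + hx'
  | single n u =>
    induction y using Finsupp.induction_linear with
    | zero => simp
    | add y y' hy hy' =>
      simp only [map_add, LinearMap.add_apply]
      linear_combination hy + hy'
    | single m v =>
      rw [contractionForm_single, contractionForm_single, loopForm_single_left,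
        loopForm_single_left, loopForm_single_left, Finsupp.single_apply, Finsupp.single_apply,
        Finsupp.single_apply]
      by_cases h : m = -n - σ.shift
      · subst h
        rw [if_pos rfl, if_pos (by omega), if_pos rfl, ← form_creationProj σ n u v]
        ring
      · rw [if_neg h, if_neg (by omega), if_neg h]
        simp

theorem contractionForm_toQuadraticMap (σ : Sector) :
    (contractionForm V σ).toQuadraticMap = 0 - loopQuad V σ := by
  ext x
  have := contractionForm_add_swap σ x x
  simp only [loopQuad, LinearMap.BilinMap.toQuadraticMap_apply, sub_apply,
    _root_.zero_apply, neg_apply]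
  linear_combination this / 2

theorem creationProj_of_isAnnihilator {σ : Sector} {w : Cl V σ} (hw : IsAnnihilator σ w) :
    ∃ n u, w = cl σ n u ∧ creationProj V σ n u = 0 := by
  cases hw with
  | pos n u h =>
    refine ⟨n, u, rfl, ?_⟩
    rw [creationProj, if_neg (by linarith), if_neg (by linarith)]
    rfl
  | zero n f h =>
    refine ⟨n, (0, f), rfl, ?_⟩
    rw [creationProj, if_neg (by linarith), if_pos h]
    simp

/-- The normal ordering map to the exterior algebra. -/
def normalOrder (V : Type*) [AddCommGroup V] [Module ℂ V] (σ : Sector) :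
    Cl V σ →ₗ[ℂ] ExteriorAlgebra ℂ (Loop V) :=
  CliffordAlgebra.changeForm (contractionForm_toQuadraticMap (V := V) σ)

theorem contractLeft_mul_ι {M : Type*} [AddCommGroup M] [Module ℂ M] (d : Module.Dual ℂ M) (m : M)
    (hd : d m = 0) (x : ExteriorAlgebra ℂ M) :
    CliffordAlgebra.contractLeft d (x * ExteriorAlgebra.ι ℂ m) =
      CliffordAlgebra.contractLeft d x * ExteriorAlgebra.ι ℂ m := by
  induction x using CliffordAlgebra.left_induction with
  | algebraMap r =>
    rw [CliffordAlgebra.contractLeft_algebraMap_mul, CliffordAlgebra.contractLeft_algebraMap,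
      CliffordAlgebra.contractLeft_ι, hd]
    simp
  | add x y hx hy => rw [add_mul, map_add, map_add, hx, hy, add_mul]
  | ι_mul x y hx =>
    rw [mul_assoc, CliffordAlgebra.contractLeft_ι_mul, CliffordAlgebra.contractLeft_ι_mul, hx]
    noncomm_ring

/-- An annihilator has no creation part, so all contractions against it vanish, and right
multiplication by it is unchanged under normal ordering. -/
theorem normalOrder_mul_cl (σ : Sector) (n : ℤ) (u : Dbl V) (hu : creationProj V σ n u = 0)
    (x : Cl V σ) : normalOrder V σ (x * cl σ n u) =
      normalOrder V σ x * ExteriorAlgebra.ι ℂ (Finsupp.single n u) := by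
  induction x using CliffordAlgebra.left_induction with
  | algebraMap r =>
    rw [← Algebra.smul_def, map_smul, normalOrder, CliffordAlgebra.changeForm_algebraMap, cl,
      CliffordAlgebra.changeForm_ι, Algebra.smul_def]
  | add x y hx hy => rw [add_mul, map_add, map_add, hx, hy, add_mul]
  | ι_mul x y hx =>
    rw [mul_assoc, normalOrder, CliffordAlgebra.changeForm_ι_mul,
      CliffordAlgebra.changeForm_ι_mul, ← normalOrder, hx, sub_mul, mul_assoc,
      contractLeft_mul_ι]
    rw [contractionForm_single, hu, Finsupp.single_zero, map_zero, mul_zero]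

/-- Normal ordering sends the left ideal into elements ending in a vector of the exterior algebra,
whose scalar part is zero, whereas `1` is sent to `1`. -/
theorem vacuum_ne_zero (σ : Sector) : vacuum V σ ≠ 0 := by
  rw [vacuum, Ne, Submodule.Quotient.mk_eq_zero]
  intro h
  have key : ∀ x ∈ vacIdeal V σ, ExteriorAlgebra.algebraMapInv (normalOrder V σ x) = 0 := by
    intro x hx
    -- The claim is strengthened to all left multiples so that the induction passes through the
    -- scalar action of the Clifford algebra.
    suffices H : ∀ c, ExteriorAlgebra.algebraMapInv (normalOrder V σ (c * x)) = 0 by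
      simpa using H 1
    refine Submodule.span_induction (p := fun x _ =>
      ∀ c, ExteriorAlgebra.algebraMapInv (normalOrder V σ (c * x)) = 0) ?_ ?_ ?_ ?_ hx
    · intro w hw c
      obtain ⟨n, u, rfl, hu⟩ := creationProj_of_isAnnihilator hw
      rw [normalOrder_mul_cl σ n u hu, map_mul]
      simp [ExteriorAlgebra.algebraMapInv]
    · simp
    · intro x y _ _ hx hy c
      rw [mul_add, map_add, map_add, hx, hy, add_zero]
    · intro a x _ hx c
      rw [smul_eq_mul, ← mul_assoc]
      exact hx _
  have h1 := key 1 h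
  rw [normalOrder, CliffordAlgebra.changeForm_one, map_one] at h1
  exact one_ne_zero h1

end FockModule

section FockBasis

variable {V : Type*} [AddCommGroup V] [Module ℂ V] {κ : Type*}
  (b : Module.Basis κ ℂ V)

/-! ### Creation and annihilation operators -/

/-- The basis `a_i`, `a_i*` of `𝔲`. -/
def dblVec : κ ⊕ κ → Dbl V := Sum.elim (vecA b) (vecAstar b)

theorem form_dblVec [DecidableEq κ] (s t : κ ⊕ κ) :
    form V (dblVec b s) (dblVec b t) = if t = s.swap then 1 / 2 else 0 := by
  rcases s with i | i <;> rcases t with j | j <;>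
    simp [form, dblVec, vecA, vecAstar, Finsupp.single_apply, eq_comm]

/-- The index of the modes of the creation operators. -/
def creationIdx (σ : Sector) (k : ℕ × (κ ⊕ κ)) : ℤ :=
  -- The exponents are `-n - 1/2` for both kinds in the untwisted sector. In the twisted sector they
  -- are `-n` for `a_i` but `-(n+1)` for `a_i*`: the zero mode `a_i(0)` creates and `a_i*(0)`
  -- annihilates.
  k.2.elim (fun _ => -k.1 - σ.shift) fun _ => -(k.1 + 1)

/-- The creation operators `a_i(r)` and `a_i*(r)`. -/
def creation (σ : Sector) (k : ℕ × (κ ⊕ κ)) : Module.End ℂ (Fock V σ) :=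
  mode σ (creationIdx σ k) (dblVec b k.2)

/-- The annihilation operators `-a_i*(-r)` and `-a_i(-r)`. -/
def annihilation (σ : Sector) (k : ℕ × (κ ⊕ κ)) : Module.End ℂ (Fock V σ) :=
  -mode σ (-creationIdx σ k - σ.shift) (dblVec b k.2.swap)

/-- Dual basis vectors pair to `1/2` and the Clifford relation carries the factor `-2`; the sign in
`annihilation` normalizes the anticommutators to `1`. -/
theorem isFockRep (σ : Sector) : IsFockRep (creation b σ) (annihilation b σ) (vacuum V σ) := by
  classical
  have hac : ∀ k l x, annihilation b σ k (creation b σ l x) +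
      creation b σ l (annihilation b σ k x) = (if k = l then 1 else 0 : ℂ) • x := by
    intro k l x
    have h := mode_mode_add_swap σ (-creationIdx σ k - σ.shift) (dblVec b k.2.swap)
      (creationIdx σ l) (dblVec b l.2) x
    rw [form_dblVec, Sum.swap_swap] at h
    simp only [annihilation, creation, LinearMap.neg_apply, map_neg]
    rw [← neg_add, h, ← neg_smul]
    congr 1
    obtain ⟨n, s⟩ := k
    obtain ⟨m, t⟩ := l
    simp only [Prod.mk.injEq]
    by_cases hst : t = s
    · subst hst
      by_cases hnm : n = m
      · subst hnm
        simp
      · have hne : ¬(n = m ∧ t = t) := fun e => hnm e.1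
        rw [if_neg hne, if_neg, neg_zero]
        rcases t with i | i <;> simp only [creationIdx, Sum.elim_inl, Sum.elim_inr] <;> omega
    · have hne : ¬(n = m ∧ s = t) := fun e => hst e.2.symm
      rw [if_neg hne]
      simp [hst]
  refine ⟨fun k l x => ?_, fun k x => ?_, fun k l x hkl => ?_, fun k => ?_, vacuum_ne_zero σ⟩
  · have h := mode_mode_add_swap σ (creationIdx σ k) (dblVec b k.2)
      (creationIdx σ l) (dblVec b l.2) x
    rw [form_dblVec] at h
    rw [eq_neg_iff_add_eq_zero, creation, creation, h]
    by_cases hl : l.2 = k.2.swap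
    · rw [if_neg, zero_smul]
      obtain ⟨n, s⟩ := k
      obtain ⟨m, t⟩ := l
      simp only at hl
      subst hl
      rcases s with i | i <;>
        simp only [creationIdx, Sum.elim_inl, Sum.elim_inr, Sum.swap_inl, Sum.swap_inr] <;> omega
    · rw [if_neg hl]
      simp
  · rw [eq_sub_iff_add_eq, hac, if_pos rfl, one_smul]
  · rw [eq_neg_iff_add_eq_zero, hac, if_neg hkl, zero_smul]
  · rw [annihilation, LinearMap.neg_apply, neg_eq_zero]
    obtain ⟨n, i | i⟩ := k
    · have h0 : (0 : ℚ) ≤ n := Nat.cast_nonneg n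
      have hidx : -creationIdx σ ((n, Sum.inl i) : ℕ × (κ ⊕ κ)) - σ.shift = n := by
        simp [creationIdx]
      rw [hidx]
      by_cases h : σ.expo n = 0
      · exact mode_vacuum_of_zero σ n _ h
      · refine mode_vacuum_of_pos σ n _ (lt_of_le_of_ne ?_ (Ne.symm h))
        cases σ <;> simp [Sector.expo, Sector.shift] <;> positivity
    · refine mode_vacuum_of_pos σ _ _ ?_
      have h0 : (0 : ℚ) ≤ n := Nat.cast_nonneg n
      cases σ <;> simp [Sector.expo, Sector.shift, creationIdx] <;> linarith

theorem mode_dblVec_eq (σ : Sector) (n : ℤ) (s : κ ⊕ κ) :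
    (∃ k, mode σ n (dblVec b s) = creation b σ k) ∨
      ∃ k, mode σ n (dblVec b s) = -annihilation b σ k := by
  rcases s with i | i
  · by_cases h : n ≤ -σ.shift
    · refine Or.inl ⟨((-n - σ.shift).toNat, Sum.inl i), ?_⟩
      rw [creation, creationIdx]
      congr 1
      simp only [Sum.elim_inl]
      omega
    · refine Or.inr ⟨((n - 1 + σ.shift).toNat, Sum.inr i), ?_⟩
      rw [annihilation, creationIdx, neg_neg]
      congr 1
      simp only [Sum.elim_inr]
      omega
  · by_cases h : n ≤ -1
    · refine Or.inl ⟨((-n - 1).toNat, Sum.inr i), ?_⟩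
      rw [creation, creationIdx]
      congr 1
      simp only [Sum.elim_inr]
      omega
    · refine Or.inr ⟨(n.toNat, Sum.inl i), ?_⟩
      rw [annihilation, creationIdx, neg_neg]
      congr 1
      simp only [Sum.elim_inl]
      omega

/-- The eigenvalues on `𝔲` of the operator with eigenvalues `lam` on `𝔞`. -/
def dblEigenvalue (lam : κ → ℂ) : κ ⊕ κ → ℂ := Sum.elim lam fun i => (lam i)⁻¹

theorem dblMap_dblVec {T : V ≃ₗ[ℂ] V} {lam : κ → ℂ} (hT : ∀ i, T (b i) = lam i • b i)
    (hlam : ∀ i, lam i ≠ 0) (s : κ ⊕ κ) :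
    dblMap T (dblVec b s) = dblEigenvalue lam s • dblVec b s := by
  have hs : ∀ i, T.symm (b i) = (lam i)⁻¹ • b i := by
    intro i
    rw [LinearEquiv.symm_apply_eq, map_smul, hT, smul_smul, inv_mul_cancel₀ (hlam i), one_smul]
  rcases s with i | i
  · simp [dblMap, dblVec, vecA, dblEigenvalue, hT]
  · ext1
    · simp [dblMap, dblVec, vecAstar]
    · refine b.ext fun j => ?_
      classical
      by_cases hij : j = i
      · subst hij
        simp [dblMap, dblVec, vecAstar, dblEigenvalue, hs]
      · simp [dblMap, dblVec, vecAstar, hs, hij]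

variable [Fintype κ]

theorem dbl_eq_sum (u : Dbl V) :
    u = ∑ i, b.coord i u.1 • dblVec b (Sum.inl i) + ∑ i, u.2 (b i) • dblVec b (Sum.inr i) := by
  ext1
  · have h := b.sum_repr u.1
    simp [dblVec, vecA, vecAstar, Prod.fst_sum, h]
  · refine b.ext fun i => ?_
    classical
    simp [dblVec, vecA, vecAstar, Prod.snd_sum]

/-- The span of the words is stable under every mode, since each mode of a basis vector of `𝔲` is a
creation operator or minus an annihilation operator. A stable subspace that contains the vacuum is
everything. -/
theorem span_word (σ : Sector) :
    Submodule.span ℂ (Set.range (word (creation b σ) (vacuum V σ))) = ⊤ := by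
  set W := Submodule.span ℂ (Set.range (word (creation b σ) (vacuum V σ))) with hW
  have h := isFockRep b σ
  have h1 : ∀ n s, ∀ x ∈ W, mode σ n (dblVec b s) x ∈ W := by
    intro n s x hx
    rcases mode_dblVec_eq b σ n s with ⟨k, hk⟩ | ⟨k, hk⟩ <;> rw [hk]
    · exact IsFockRep.create_mem_span k hx
    · exact neg_mem (h.annihilate_mem_span k hx)
  have h2 : ∀ n u, ∀ x ∈ W, mode σ n u x ∈ W := by
    intro n u x hx
    let φ : Dbl V →ₗ[ℂ] Module.End ℂ (Fock V σ) :=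
      { toFun := mode σ n, map_add' := mode_add σ n, map_smul' := mode_smul σ n }
    change φ u x ∈ W
    rw [dbl_eq_sum b u]
    simp only [map_add, map_sum, map_smul, LinearMap.add_apply, LinearMap.sum_apply,
      LinearMap.smul_apply]
    exact add_mem (sum_mem fun i _ => W.smul_mem _ (h1 n _ x hx))
      (sum_mem fun i _ => W.smul_mem _ (h1 n _ x hx))
  have h3 : ∀ y : Loop V, ∀ x ∈ W, op σ (CliffordAlgebra.ι (loopQuad V σ) y) x ∈ W := by
    intro y x hx
    induction y using Finsupp.induction_linear with
    | zero =>
      rw [map_zero, ← map_zero (algebraMap ℂ (Cl V σ)), op_algebraMap, zero_smul]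
      exact W.zero_mem
    | add y y' hy hy' => rw [map_add, op_add]; exact add_mem hy hy'
    | single n u => exact h2 n u x hx
  have h4 : ∀ c : Cl V σ, op σ c (vacuum V σ) ∈ W := by
    intro c
    induction c using CliffordAlgebra.left_induction with
    | algebraMap r =>
      rw [op_algebraMap]
      exact W.smul_mem _ (Submodule.subset_span ⟨[], rfl⟩)
    | add x y hx hy => rw [op_add]; exact add_mem hx hy
    | ι_mul x y hx => rw [op_mul]; exact h3 y _ hx
  rw [eq_top_iff]
  rintro x -
  obtain ⟨c, rfl⟩ := Submodule.Quotient.mk_surjective _ x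
  rw [← op_vacuum]
  exact h4 c

/-- The basis of `A(𝔲)` or `A(𝔲)_θ` defined by a basis of `𝔞`. -/
def fockBasis (σ : Sector) : Module.Basis (Finset (ℕ × (κ ⊕ κ))) ℂ (Fock V σ) :=
  (isFockRep b σ).basis (span_word b σ)

theorem fockBasis_apply (σ : Sector) (S : Finset (ℕ × (κ ⊕ κ))) :
    fockBasis b σ S = stateOf (creation b σ) (vacuum V σ) S :=
  (isFockRep b σ).basis_apply _ S

/-! ### The action of a diagonal operator -/

theorem act_fockBasis {T : V ≃ₗ[ℂ] V} {lam : κ → ℂ} (hT : ∀ i, T (b i) = lam i • b i)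
    (hlam : ∀ i, lam i ≠ 0) (σ : Sector) (S : Finset (ℕ × (κ ⊕ κ))) :
    act σ T (fockBasis b σ S) = (∏ k ∈ S, dblEigenvalue lam k.2) • fockBasis b σ S := by
  rw [fockBasis_apply]
  refine apply_stateOf_of_mul (fun k x => ?_) (act_vacuum σ T) S
  rw [creation, act_mode, dblMap_dblVec b hT hlam, mode_smul, LinearMap.smul_apply]

/-! ### The operators `L(0)` and `J(0)` -/

/-- The orderings of a quadratic expression differ by scalars, so the commutator with a mode is the
same in all three cases of `normOrd`. -/
theorem normOrd_mode (σ : Sector) (n : ℤ) (u : Dbl V) (m : ℤ) (v : Dbl V) (k : ℤ) (w : Dbl V)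
    (x : Fock V σ) : normOrd σ n u m v (mode σ k w x) = mode σ k w (normOrd σ n u m v x) +
      ((if k = -m - σ.shift then -2 * form V v w else 0 : ℂ) • mode σ n u x -
      (if k = -n - σ.shift then -2 * form V u w else 0 : ℂ) • mode σ m v x) := by
  have key : ∀ n u m v, mode σ n u (mode σ m v (mode σ k w x)) =
      mode σ k w (mode σ n u (mode σ m v x)) +
      ((if k = -m - σ.shift then -2 * form V v w else 0 : ℂ) • mode σ n u x -
      (if k = -n - σ.shift then -2 * form V u w else 0 : ℂ) • mode σ m v x) := by
    intro n u m v
    rw [eq_sub_of_add_eq (mode_mode_add_swap σ m v k w x), map_sub, map_smul,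
      eq_sub_of_add_eq (mode_mode_add_swap σ n u k w (mode σ m v x))]
    abel
  have h1 := key n u m v
  have h2 := key m v n u
  generalize (if k = -m - σ.shift then -2 * form V v w else 0 : ℂ) = β at h1 h2 ⊢
  generalize (if k = -n - σ.shift then -2 * form V u w else 0 : ℂ) = γ at h1 h2 ⊢
  rw [normOrd]
  split_ifs
  · simp only [LinearMap.smul_apply, LinearMap.sub_apply, Module.End.mul_apply, h1, h2, map_smul,
      map_sub]
    module
  · simp only [Module.End.mul_apply, h1]
  · simp only [LinearMap.neg_apply, Module.End.mul_apply, h2, map_neg]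
    abel

end FockBasis

/-! ### Commutators and vacuum values of the quadratic vertex operators -/

section Grading

variable {V : Type*} [AddCommGroup V] [Module ℂ V]

theorem quadTerm_of_eq (σ : Sector) (k : ℕ) (u : Dbl V) (l : ℕ) (v : Dbl V) {t : ℤ}
    (ht : t = k + l) (i : ℤ) : quadTerm σ k u l v t i =
      (derivCoeff σ k i * derivCoeff σ l (-i - σ.shift)) • normOrd σ i u (-i - σ.shift) v := by
  rw [quadTerm, show t - k - l - σ.shift - i = -i - σ.shift by rw [ht]; ring]

/-- For `t = k + l` the two exponents in each term add up to zero, so only the terms `i = m` and `i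
= -m - σ.shift` fail to commute with the mode. The scalar twist correction commutes with everything.
-/
theorem quadVertex_mode (σ : Sector) (k : ℕ) (u : Dbl V) (l : ℕ) (v : Dbl V) {t : ℤ}
    (ht : t = k + l) (m : ℤ) (w : Dbl V) (x : Fock V σ) :
    quadVertex σ k u l v t (mode σ m w x) = mode σ m w (quadVertex σ k u l v t x) +
      ((derivCoeff σ k m * derivCoeff σ l (-m - σ.shift) * (-2 * form V v w)) • mode σ m u x +
      (derivCoeff σ k (-m - σ.shift) * derivCoeff σ l m * (2 * form V u w)) • mode σ m v x) := by
  set A : ℤ → Fock V σ := fun i => if i = m then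
    (derivCoeff σ k m * derivCoeff σ l (-m - σ.shift) * (-2 * form V v w)) • mode σ m u x else 0
    with hA
  set B : ℤ → Fock V σ := fun i => if i = -m - σ.shift then
    (derivCoeff σ k (-m - σ.shift) * derivCoeff σ l m * (2 * form V u w)) • mode σ m v x else 0
    with hB
  have hterm : ∀ i, quadTerm σ k u l v t i (mode σ m w x) =
      mode σ m w (quadTerm σ k u l v t i x) + (A i + B i) := by
    intro i
    rw [quadTerm_of_eq σ k u l v ht, LinearMap.smul_apply, LinearMap.smul_apply, normOrd_mode,
      smul_add, map_smul, hA, hB]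
    beta_reduce
    congr 1
    by_cases h1 : i = m
    -- The two indices coincide only for a zero mode, and then the term carries both contributions.
    · by_cases h2 : i = -m - σ.shift
      · have h3 : -m - σ.shift = m := by omega
        simp only [h1, h3, if_true]
        module
      · subst h1
        rw [if_pos (by omega), if_neg (by omega), if_pos rfl, if_neg h2]
        module
    · by_cases h2 : i = -m - σ.shift
      · subst h2
        rw [if_neg (by omega), if_pos (by omega), if_neg h1, if_pos rfl,
          show -(-m - σ.shift) - σ.shift = m by ring]
        module
      · rw [if_neg (by omega), if_neg (by omega), if_neg h1, if_neg h2]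
        module
  have hAfin : (Function.support A).Finite :=
    (Set.finite_singleton m).subset fun i hi => by
      by_contra h
      exact hi (if_neg h)
  have hBfin : (Function.support B).Finite :=
    (Set.finite_singleton (-m - σ.shift)).subset fun i hi => by
      by_contra h
      exact hi (if_neg h)
  have hQ := quadTerm_finite σ k u l v t x
  have hQ' : (Function.support fun i => mode σ m w (quadTerm σ k u l v t i x)).Finite :=
    hQ.subset fun i hi h => hi ((congrArg (mode σ m w) h).trans (map_zero _))
  have hAB : (Function.support fun i => A i + B i).Finite :=
    (hAfin.union hBfin).subset (Function.support_add A B)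
  have hsumA : ∑ᶠ i, A i = A m := finsum_eq_single A m fun i hi => if_neg hi
  have hsumB : ∑ᶠ i, B i = B (-m - σ.shift) := finsum_eq_single B _ fun i hi => if_neg hi
  have hmap : mode σ m w (∑ᶠ i, quadTerm σ k u l v t i x) =
      ∑ᶠ i, mode σ m w (quadTerm σ k u l v t i x) :=
    AddMonoidHom.map_finsum (mode σ m w).toAddMonoidHom hQ
  rw [quadVertex_apply, quadVertex_apply, finsum_congr hterm, finsum_add_distrib hQ' hAB,
    finsum_add_distrib hAfin hBfin, hsumA, hsumB, map_add, map_smul, hmap, hA, hB]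
  simp only [if_true]
  abel

/-- The exponents are `r` and `-r`; if `r ≠ 0`, normal ordering puts the positive one on the right,
where it kills the vacuum. Only the zero modes of the twisted sector can survive. -/
theorem quadTerm_vacuum (σ : Sector) (k : ℕ) (u : Dbl V) (l : ℕ) (v : Dbl V) {t : ℤ}
    (ht : t = k + l) (i : ℤ) (hi : σ.expo i ≠ 0) :
    quadTerm σ k u l v t i (vacuum V σ) = 0 := by
  rw [quadTerm_of_eq σ k u l v ht, LinearMap.smul_apply, normOrd, if_neg fun h => hi h.2]
  have hneg := σ.expo_neg i
  split_ifs with h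
  · have h1 : σ.expo i ≤ σ.expo (-i - σ.shift) := by
      simp only [Sector.expo]
      have : (i : ℚ) ≤ ((-i - σ.shift : ℤ) : ℚ) := by exact_mod_cast h
      linarith
    rw [Module.End.mul_apply, mode_vacuum_of_pos, map_zero, smul_zero]
    rw [hneg] at h1 ⊢
    have : σ.expo i ≤ 0 := by linarith
    have := lt_of_le_of_ne this hi
    linarith
  · have h1 : σ.expo (-i - σ.shift) < σ.expo i := by
      simp only [Sector.expo]
      have : ((-i - σ.shift : ℤ) : ℚ) < (i : ℚ) := by exact_mod_cast not_le.1 h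
      linarith
    rw [LinearMap.neg_apply, Module.End.mul_apply, mode_vacuum_of_pos, map_zero, neg_zero,
      smul_zero]
    rw [hneg] at h1
    linarith

theorem quadVertex_vacuum_untwisted (k : ℕ) (u : Dbl V) (l : ℕ) (v : Dbl V) {t : ℤ}
    (ht : t = k + l) : quadVertex .untwisted k u l v t (vacuum V .untwisted) = 0 := by
  have h : ∀ i : ℤ, quadTerm .untwisted k u l v t i (vacuum V .untwisted) = 0 := by
    intro i
    refine quadTerm_vacuum _ k u l v ht i fun h => ?_
    simp only [Sector.expo, Sector.shift] at h
    have h1 : ((2 * i + 1 : ℤ) : ℚ) = 0 := by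
      push_cast at h ⊢
      linarith
    have h2 : 2 * i + 1 = 0 := by exact_mod_cast h1
    omega
  rw [quadVertex_apply, finsum_congr h, finsum_zero, twistTerm, zero_smul, add_zero]

theorem quadVertex_vacuum_twisted (k : ℕ) (u : Dbl V) (l : ℕ) (v : Dbl V) {t : ℤ}
    (ht : t = k + l) : quadVertex .twisted k u l v t (vacuum V .twisted) =
      (derivCoeff .twisted k 0 * derivCoeff .twisted l 0 * (1 / 2)) •
        (mode .twisted 0 u (mode .twisted 0 v (vacuum V .twisted)) -
          mode .twisted 0 v (mode .twisted 0 u (vacuum V .twisted))) +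
      (2 * twistConst k l * form V u v) • vacuum V .twisted := by
  rw [quadVertex_apply, finsum_eq_single _ 0, quadTerm_of_eq _ k u l v ht, twistTerm]
  · simp only [if_pos ht]
    congr 1
    rw [LinearMap.smul_apply, normOrd, if_pos ⟨by simp [Sector.shift], by
      simp [Sector.expo, Sector.shift]⟩]
    simp [Sector.shift, mul_smul]
  · intro i hi
    refine quadTerm_vacuum _ k u l v ht i fun h => hi ?_
    simpa [Sector.expo, Sector.shift] using h

theorem derivCoeff_zero (σ : Sector) (n : ℤ) : derivCoeff σ 0 n = 1 := by
  simp [derivCoeff]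

theorem derivCoeff_one (σ : Sector) (n : ℤ) : derivCoeff σ 1 n = -(σ.expo n : ℂ) - 1 / 2 := by
  simp [derivCoeff]

theorem twistConst_zero_one : twistConst 0 1 = 1 / 8 := by
  simp [twistConst]
  norm_num

theorem twistConst_one_zero : twistConst 0 0 = 0 := by
  simp [twistConst]

variable {κ : Type*} (b : Module.Basis κ ℂ V)

theorem form_vecA_vecA (i j : κ) : form V (vecA b i) (vecA b j) = 0 := by
  simp [form, vecA]

theorem form_vecAstar_vecAstar (i j : κ) : form V (vecAstar b i) (vecAstar b j) = 0 := by
  simp [form, vecAstar]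

theorem form_vecA_vecAstar [DecidableEq κ] (i j : κ) :
    form V (vecA b i) (vecAstar b j) = if i = j then 1 / 2 else 0 := by
  simp [form, vecA, vecAstar, Finsupp.single_apply]

theorem mode_zero_vecAstar_vacuum (i : κ) :
    mode .twisted 0 (vecAstar b i) (vacuum V .twisted) = 0 :=
  mode_vacuum_of_zero _ 0 _ (by simp [Sector.expo, Sector.shift])

theorem mode_zero_vecAstar_vecA_vacuum (i : κ) :
    mode .twisted 0 (vecAstar b i) (mode .twisted 0 (vecA b i) (vacuum V .twisted)) =
      -vacuum V .twisted := by
  classical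
  have h := mode_mode_add_swap .twisted 0 (vecAstar b i) 0 (vecA b i) (vacuum V .twisted)
  rw [mode_zero_vecAstar_vacuum, map_zero, add_zero, if_pos (by simp [Sector.shift]),
    form_comm, form_vecA_vecAstar, if_pos rfl] at h
  rw [h]
  module

variable [Fintype κ]

theorem opL_apply (σ : Sector) (x : Fock V σ) : opL b σ 0 x = (1 / 2 : ℂ) •
    ∑ i, (quadVertex σ 0 (vecA b i) 1 (vecAstar b i) 1 x +
      quadVertex σ 0 (vecAstar b i) 1 (vecA b i) 1 x) := by
  rw [opL_eq, LinearMap.smul_apply, LinearMap.sum_apply]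
  rfl

theorem opJ_apply (σ : Sector) (x : Fock V σ) : opJ b σ 0 x =
    I • ∑ i, quadVertex σ 0 (vecAstar b i) 0 (vecA b i) 0 x := by
  rw [opJ, LinearMap.smul_apply, LinearMap.sum_apply]

/-- This is `[L(0), u(r)] = -r u(r)`. The derivative coefficients give `-r + 1/2` and `-r - 1/2`
from the two orders of `a_i`, `a_i*`, so that the halves cancel. -/
theorem opL_mode (σ : Sector) (m : ℤ) (s : κ ⊕ κ) (x : Fock V σ) :
    opL b σ 0 (mode σ m (dblVec b s) x) =
      mode σ m (dblVec b s) (opL b σ 0 x) + (-(σ.expo m : ℂ)) • mode σ m (dblVec b s) x := by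
  classical
  obtain ⟨j₀, hj₀⟩ : ∃ j₀ : κ, j₀ = s.elim id id := ⟨_, rfl⟩
  have h : ∀ i, quadVertex σ 0 (vecA b i) 1 (vecAstar b i) 1 (mode σ m (dblVec b s) x) +
      quadVertex σ 0 (vecAstar b i) 1 (vecA b i) 1 (mode σ m (dblVec b s) x) =
      mode σ m (dblVec b s) (quadVertex σ 0 (vecA b i) 1 (vecAstar b i) 1 x +
        quadVertex σ 0 (vecAstar b i) 1 (vecA b i) 1 x) +
      if i = j₀ then (-2 * (σ.expo m : ℂ)) • mode σ m (dblVec b s) x else 0 := by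
    intro i
    rw [quadVertex_mode σ 0 _ 1 _ (by simp), quadVertex_mode σ 0 _ 1 _ (by simp), map_add]
    simp only [derivCoeff_zero, derivCoeff_one, σ.expo_neg]
    push_cast
    rcases s with j | j <;> change j₀ = j at hj₀ <;> subst j₀
    · simp only [dblVec, Sum.elim_inl, form_vecA_vecA, form_comm (vecAstar b i),
        form_vecA_vecAstar]
      by_cases hij : i = j
      · subst hij
        simp only [if_true]
        module
      · rw [if_neg hij, if_neg (Ne.symm hij)]
        module
    · simp only [dblVec, Sum.elim_inr, form_vecAstar_vecAstar, form_vecA_vecAstar]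
      by_cases hij : i = j
      · subst hij
        simp only [if_true]
        module
      · rw [if_neg hij, if_neg hij]
        module
  rw [opL_apply, opL_apply, Finset.sum_congr rfl fun i _ => h i, Finset.sum_add_distrib,
    Finset.sum_ite_eq' , if_pos (Finset.mem_univ _), ← map_sum, map_smul]
  module

/-- The charge of `a_i` is `-1` and that of `a_i*` is `1`. -/
def charge (κ : Type*) : κ ⊕ κ → ℚ := Sum.elim (fun _ => -1) fun _ => 1

theorem opJ_mode (σ : Sector) (m : ℤ) (s : κ ⊕ κ) (x : Fock V σ) :
    opJ b σ 0 (mode σ m (dblVec b s) x) =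
      mode σ m (dblVec b s) (opJ b σ 0 x) + (-I * charge κ s) • mode σ m (dblVec b s) x := by
  classical
  obtain ⟨j₀, hj₀⟩ : ∃ j₀ : κ, j₀ = s.elim id id := ⟨_, rfl⟩
  have h : ∀ i, quadVertex σ 0 (vecAstar b i) 0 (vecA b i) 0 (mode σ m (dblVec b s) x) =
      mode σ m (dblVec b s) (quadVertex σ 0 (vecAstar b i) 0 (vecA b i) 0 x) +
      if i = j₀ then (-charge κ s : ℂ) • mode σ m (dblVec b s) x else 0 := by
    intro i
    rw [quadVertex_mode σ 0 _ 0 _ (by simp)]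
    simp only [derivCoeff_zero]
    rcases s with j | j <;> change j₀ = j at hj₀ <;> subst j₀
    · simp only [dblVec, Sum.elim_inl, form_vecA_vecA, form_comm (vecAstar b i),
        form_vecA_vecAstar, charge]
      by_cases hij : i = j
      · subst hij
        simp only [if_true]
        push_cast
        module
      · rw [if_neg hij, if_neg (Ne.symm hij)]
        module
    · simp only [dblVec, Sum.elim_inr, form_vecAstar_vecAstar, form_vecA_vecAstar, charge]
      by_cases hij : i = j
      · subst hij
        simp only [if_true]
        push_cast
        module
      · rw [if_neg hij, if_neg hij]
        module
  rw [opJ_apply, opJ_apply, Finset.sum_congr rfl fun i _ => h i, Finset.sum_add_distrib,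
    Finset.sum_ite_eq', if_pos (Finset.mem_univ _), ← map_sum, map_smul]
  module

/-- The degree of the vacuum. -/
def vacDegree (κ : Type*) [Fintype κ] : Sector → ℚ
  | .untwisted => 0
  | .twisted => Fintype.card κ / 8

/-- The charge of the vacuum. -/
def vacCharge (κ : Type*) [Fintype κ] : Sector → ℚ
  | .untwisted => 0
  | .twisted => Fintype.card κ / 2

theorem opL_vacuum (σ : Sector) : opL b σ 0 (vacuum V σ) = (vacDegree κ σ : ℂ) • vacuum V σ := by
  classical
  rw [opL_apply]
  cases σ with
  | untwisted =>
    simp only [quadVertex_vacuum_untwisted 0 _ 1 _ (t := 1) (by simp), vacDegree]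
    simp
  | twisted =>
    -- The zero modes contribute `-1/4` and `1/4` and cancel. What remains is the twist correction,
    -- `2 * (1/8) * (1/2)` from each of the two terms.
    have h : ∀ i, quadVertex .twisted 0 (vecA b i) 1 (vecAstar b i) 1 (vacuum V .twisted) +
        quadVertex .twisted 0 (vecAstar b i) 1 (vecA b i) 1 (vacuum V .twisted) =
        (1 / 4 : ℂ) • vacuum V .twisted := by
      intro i
      rw [quadVertex_vacuum_twisted 0 _ 1 _ (by simp), quadVertex_vacuum_twisted 0 _ 1 _ (by simp),
        mode_zero_vecAstar_vacuum, mode_zero_vecAstar_vecA_vacuum, form_comm (vecAstar b i),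
        form_vecA_vecAstar, if_pos rfl, twistConst_zero_one, map_zero]
      module
    rw [Finset.sum_congr rfl fun i _ => h i, Finset.sum_const, Finset.card_univ, vacDegree,
      ← Nat.cast_smul_eq_nsmul ℂ, smul_smul, smul_smul]
    congr 1
    push_cast
    ring

theorem opJ_vacuum (σ : Sector) :
    opJ b σ 0 (vacuum V σ) = (-I * (vacCharge κ σ : ℂ)) • vacuum V σ := by
  classical
  rw [opJ_apply]
  cases σ with
  | untwisted =>
    simp only [quadVertex_vacuum_untwisted 0 _ 0 _ (t := 0) (by simp), vacCharge]
    simp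
  | twisted =>
    -- Here the twist constant is zero, and the value comes entirely from the antisymmetrized zero
    -- modes.
    have h : ∀ i, quadVertex .twisted 0 (vecAstar b i) 0 (vecA b i) 0 (vacuum V .twisted) =
        (-1 / 2 : ℂ) • vacuum V .twisted := by
      intro i
      rw [quadVertex_vacuum_twisted 0 _ 0 _ (by simp),
        mode_zero_vecAstar_vacuum, mode_zero_vecAstar_vecA_vacuum, twistConst_one_zero, map_zero,
        derivCoeff_zero]
      module
    rw [Finset.sum_congr rfl fun i _ => h i, Finset.sum_const, Finset.card_univ, vacCharge,
      ← Nat.cast_smul_eq_nsmul ℂ, smul_smul, smul_smul]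
    congr 1
    push_cast
    ring

/-- The degree of a vector of the basis of the Fock module. -/
def stateDegree (σ : Sector) (S : Finset (ℕ × (κ ⊕ κ))) : ℚ :=
  vacDegree κ σ + ∑ k ∈ S, -σ.expo (creationIdx σ k)

/-- The charge of a vector of the basis of the Fock module. -/
def stateCharge (σ : Sector) (S : Finset (ℕ × (κ ⊕ κ))) : ℚ :=
  vacCharge κ σ + ∑ k ∈ S, charge κ k.2

theorem opL_fockBasis (σ : Sector) (S : Finset (ℕ × (κ ⊕ κ))) :
    opL b σ 0 (fockBasis b σ S) = (stateDegree σ S : ℂ) • fockBasis b σ S := by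
  rw [fockBasis_apply, apply_stateOf_of_add (fun k x => opL_mode b σ _ k.2 x) (opL_vacuum b σ),
    stateDegree]
  push_cast
  rfl

theorem opJ_fockBasis (σ : Sector) (S : Finset (ℕ × (κ ⊕ κ))) :
    (I • opJ b σ 0) (fockBasis b σ S) = (stateCharge σ S : ℂ) • fockBasis b σ S := by
  rw [fockBasis_apply, LinearMap.smul_apply,
    apply_stateOf_of_add (fun k x => opJ_mode b σ _ k.2 x) (opJ_vacuum b σ), smul_smul,
    stateCharge, ← Finset.mul_sum, ← mul_add, ← mul_assoc, mul_neg, Complex.I_mul_I]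
  push_cast
  rw [neg_neg, one_mul]

end Grading

/-! ## Subspaces spanned by part of a basis -/

section SubBasis

variable {X E : Type*} [AddCommGroup E] [Module ℂ E]

theorem repr_apply_of_diagonal (β : Module.Basis X ℂ E) {A : Module.End ℂ E} {a : X → ℂ}
    (hA : ∀ x, A (β x) = a x • β x) (v : E) (x : X) : β.repr (A v) x = a x * β.repr v x := by
  classical
  have h : (Finsupp.lapply x ∘ₗ β.repr.toLinearMap) ∘ₗ A =
      a x • (Finsupp.lapply x ∘ₗ β.repr.toLinearMap) := by
    refine β.ext fun y => ?_
    by_cases hxy : y = x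
    · subst hxy
      simp [hA]
    · simp [hA, hxy]
  exact LinearMap.congr_fun h v

theorem mem_eigenspace_iff_of_diagonal (β : Module.Basis X ℂ E) {A : Module.End ℂ E} {a : X → ℂ}
    (hA : ∀ x, A (β x) = a x • β x) (μ : ℂ) (v : E) :
    v ∈ A.eigenspace μ ↔ ∀ x, β.repr v x ≠ 0 → a x = μ := by
  rw [Module.End.mem_eigenspace_iff, ← β.repr.injective.eq_iff, Finsupp.ext_iff]
  refine forall_congr' fun x => ?_
  rw [repr_apply_of_diagonal β hA, map_smul, Finsupp.smul_apply, smul_eq_mul]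
  constructor
  · intro h h0
    exact mul_right_cancel₀ h0 h
  · intro h
    by_cases h0 : β.repr v x = 0
    · rw [h0, mul_zero, mul_zero]
    · rw [h h0]

/-- The basis of a subspace spanned by part of a basis. -/
def subBasis (β : Module.Basis X ℂ E) (P : Submodule ℂ E) (F : Set X)
    (hP : ∀ v, v ∈ P ↔ ∀ x, β.repr v x ≠ 0 → x ∈ F) : Module.Basis F ℂ P :=
  have hmem : ∀ x : F, β x ∈ P := fun x => (hP _).2 fun y hy => by
    classical
    rw [β.repr_self, Finsupp.single_apply] at hy
    by_cases h : (x : X) = y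
    · exact h ▸ x.2
    · exact absurd (if_neg h) hy
  Module.Basis.mk (v := fun x : F => (⟨β x, hmem x⟩ : P))
    (LinearIndependent.of_comp P.subtype
      (β.linearIndependent.comp (fun x : F => (x : X)) Subtype.val_injective))
    (by
      rintro ⟨v, hv⟩ -
      have h1 : v ∈ Submodule.span ℂ (β '' F) :=
        β.mem_span_image.2 fun x hx => (hP v).1 hv x (Finsupp.mem_support_iff.1 hx)
      have h2 : P.subtype '' Set.range (fun x : F => (⟨β x, hmem x⟩ : P)) = β '' F := by
        rw [← Set.range_comp]
        ext w
        simp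
      rw [← h2, Submodule.span_image] at h1
      obtain ⟨w, hw, hwv⟩ := h1
      rwa [show (⟨v, hv⟩ : P) = w from Subtype.ext hwv.symm])

theorem coe_subBasis (β : Module.Basis X ℂ E) (P : Submodule ℂ E) (F : Set X)
    (hP : ∀ v, v ∈ P ↔ ∀ x, β.repr v x ≠ 0 → x ∈ F) (x : F) :
    (subBasis β P F hP x : E) = β x := by
  rw [subBasis, Module.Basis.mk_apply]

theorem finite_of_subBasis (β : Module.Basis X ℂ E) (P : Submodule ℂ E) (F : Set X)
    (hP : ∀ v, v ∈ P ↔ ∀ x, β.repr v x ≠ 0 → x ∈ F) (hF : F.Finite) : Module.Finite ℂ P :=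
  have := hF.to_subtype
  Module.Finite.of_basis (subBasis β P F hP)

theorem trace_of_subBasis (β : Module.Basis X ℂ E) (P : Submodule ℂ E) (F : Set X)
    (hP : ∀ v, v ∈ P ↔ ∀ x, β.repr v x ≠ 0 → x ∈ F) [Fintype F] {G : Module.End ℂ E} {γ : X → ℂ}
    (hG : ∀ x, G (β x) = γ x • β x) (hGP : ∀ x ∈ P, G x ∈ P) :
    LinearMap.trace ℂ P (G.restrict hGP) = ∑ x : F, γ x := by
  classical
  rw [LinearMap.trace_eq_matrix_trace ℂ (subBasis β P F hP), Matrix.trace]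
  refine Finset.sum_congr rfl fun x _ => ?_
  have h : G.restrict hGP (subBasis β P F hP x) = γ x • subBasis β P F hP x := by
    apply Subtype.ext
    rw [LinearMap.coe_restrict_apply, coe_subBasis, hG, Submodule.coe_smul, coe_subBasis]
  rw [Matrix.diag_apply, LinearMap.toMatrix_apply, h]
  simp

end SubBasis

/-! ## The graded traces -/

section ChangeOfBasis

variable {V : Type*} [AddCommGroup V] [Module ℂ V] {κ : Type*} (b : Module.Basis κ ℂ V)

theorem dblMap_equiv_vecA (b' : Module.Basis κ ℂ V) (i : κ) :
    dblMap (b.equiv b' (Equiv.refl κ)) (vecA b i) = vecA b' i := by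
  simp [dblMap, vecA]

theorem dblMap_equiv_vecAstar (b' : Module.Basis κ ℂ V) (i : κ) :
    dblMap (b.equiv b' (Equiv.refl κ)) (vecAstar b i) = vecAstar b' i := by
  ext1
  · simp [dblMap, vecAstar]
  · refine b'.ext fun j => ?_
    classical
    simp [dblMap, vecAstar, Finsupp.single_apply]

end ChangeOfBasis

section GradedTrace

variable {V : Type*} [AddCommGroup V] [Module ℂ V] {κ : Type*} [Fintype κ]
  (b : Module.Basis κ ℂ V)

/-- The index set of a basis of `A(𝔲) ⊕ A(𝔲)_θ`. -/
abbrev StateIdx (κ : Type*) : Type _ := Finset (ℕ × (κ ⊕ κ)) ⊕ Finset (ℕ × (κ ⊕ κ))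

/-- The basis of `A(𝔲) ⊕ A(𝔲)_θ` defined by a basis of `𝔞`. -/
def sumBasis : Module.Basis (StateIdx κ) ℂ (FockSum V) :=
  (fockBasis b .untwisted).prod (fockBasis b .twisted)

theorem prodMap_sumBasis {A : Module.End ℂ (Fock V .untwisted)} {B : Module.End ℂ (Fock V .twisted)}
    {f g : Finset (ℕ × (κ ⊕ κ)) → ℂ}
    (hA : ∀ S, A (fockBasis b .untwisted S) = f S • fockBasis b .untwisted S)
    (hB : ∀ S, B (fockBasis b .twisted S) = g S • fockBasis b .twisted S) (y : StateIdx κ) :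
    A.prodMap B (sumBasis b y) = Sum.elim f g y • sumBasis b y := by
  rcases y with S | S <;> ext1 <;> simp [sumBasis, Module.Basis.prod_apply, hA, hB]

/-- The number of creation operators. -/
def stateCard : StateIdx κ → ℕ := Sum.elim Finset.card Finset.card

theorem parity_sumBasis (y : StateIdx κ) :
    parity V (sumBasis b y) = ((-1) ^ stateCard y : ℂ) • sumBasis b y := by
  have h : ∀ σ S, act σ (LinearEquiv.neg ℂ) (fockBasis b σ S) =
      ((-1) ^ S.card : ℂ) • fockBasis b σ S := by
    intro σ S
    rw [act_fockBasis b (lam := fun _ => -1) (by simp) (by simp)]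
    congr 1
    rw [← Finset.prod_const]
    refine Finset.prod_congr rfl fun k _ => ?_
    rcases k with ⟨n, i | i⟩ <;> simp [dblEigenvalue, inv_neg]
  rw [parity, actSum, prodMap_sumBasis b (h _) (h _)]
  rcases y with S | S <;> rfl

/-- The states with an even number of creation operators. -/
def evenStates (κ : Type*) : Set (StateIdx κ) := {y | Even (stateCard y)}

theorem mem_Atw_iff (v : FockSum V) :
    v ∈ Atw V ↔ ∀ y, (sumBasis b).repr v y ≠ 0 → y ∈ evenStates κ := by
  have h1 : v ∈ Atw V ↔ v ∈ (parity V).eigenspace 1 := by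
    rw [Module.End.mem_eigenspace_iff, one_smul]
    rfl
  rw [h1, mem_eigenspace_iff_of_diagonal (sumBasis b) (parity_sumBasis b)]
  refine forall_congr' fun y => imp_congr_right fun _ => ?_
  rw [evenStates, Set.mem_ofPred_eq]
  exact neg_one_pow_eq_one_iff_even (by norm_num)

/-- The basis of `A(𝔲)⁰ ⊕ A(𝔲)_θ⁰` defined by a basis of `𝔞`. -/
def atwBasis : Module.Basis (evenStates κ) ℂ (Atw V) :=
  subBasis (sumBasis b) (Atw V) (evenStates κ) (mem_Atw_iff b)

theorem coe_atwBasis (y : evenStates κ) : (atwBasis b y : FockSum V) = sumBasis b y :=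
  coe_subBasis _ _ _ _ _

/-- The degree of a state. -/
def degreeOf : StateIdx κ → ℚ := Sum.elim (stateDegree .untwisted) (stateDegree .twisted)

/-- The charge of a state. -/
def chargeOf : StateIdx κ → ℚ := Sum.elim (stateCharge .untwisted) (stateCharge .twisted)

/-- The eigenvalue on a state of the operator with eigenvalues `lam` on `𝔞`. -/
def eigenvalueOf (lam : κ → ℂ) : StateIdx κ → ℂ :=
  Sum.elim (fun S => ∏ k ∈ S, dblEigenvalue lam k.2) fun S => ∏ k ∈ S, dblEigenvalue lam k.2

theorem coe_twL (n : ℤ) (x : Atw V) : (twL b n x : FockSum V) =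
    (opL b .untwisted n).prodMap (opL b .twisted n) x := rfl

theorem coe_twJ (n : ℤ) (x : Atw V) : (twJ b n x : FockSum V) =
    (opJ b .untwisted n).prodMap (opJ b .twisted n) x := rfl

theorem twL_atwBasis (y : evenStates κ) :
    twL b 0 (atwBasis b y) = (degreeOf (y : StateIdx κ) : ℂ) • atwBasis b y := by
  apply Subtype.ext
  rw [coe_twL, coe_atwBasis,
    prodMap_sumBasis b (opL_fockBasis b _) (opL_fockBasis b _), Submodule.coe_smul, coe_atwBasis]
  rcases y with ⟨S | S, _⟩ <;> rfl

theorem twJ_atwBasis (y : evenStates κ) :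
    (I • twJ b 0) (atwBasis b y) = (chargeOf (y : StateIdx κ) : ℂ) • atwBasis b y := by
  apply Subtype.ext
  rw [LinearMap.smul_apply, Submodule.coe_smul, coe_twJ, coe_atwBasis,
    ← LinearMap.smul_apply, ← LinearMap.prodMap_smul,
    prodMap_sumBasis b (opJ_fockBasis b _) (opJ_fockBasis b _), Submodule.coe_smul, coe_atwBasis]
  rcases y with ⟨S | S, _⟩ <;> rfl

theorem actTw_atwBasis {T : V ≃ₗ[ℂ] V} {lam : κ → ℂ} (hT : ∀ i, T (b i) = lam i • b i)
    (hlam : ∀ i, lam i ≠ 0) (y : evenStates κ) :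
    actTw V T (atwBasis b y) = eigenvalueOf lam (y : StateIdx κ) • atwBasis b y := by
  apply Subtype.ext
  change actSum T (atwBasis b y : FockSum V) = _
  rw [coe_atwBasis, actSum, prodMap_sumBasis b (act_fockBasis b hT hlam _)
    (act_fockBasis b hT hlam _), Submodule.coe_smul, coe_atwBasis]
  rfl

theorem mem_gradedPiece_iff (n m : ℚ) (v : Atw V) :
    v ∈ gradedPiece b n m ↔ ∀ y, (atwBasis b).repr v y ≠ 0 →
      y ∈ {y : evenStates κ | (degreeOf (y : StateIdx κ), chargeOf (y : StateIdx κ)) = (n, m)} := by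
  rw [gradedPiece, Submodule.mem_inf,
    mem_eigenspace_iff_of_diagonal (atwBasis b) (twL_atwBasis b),
    mem_eigenspace_iff_of_diagonal (atwBasis b) (twJ_atwBasis b), ← forall_and]
  refine forall_congr' fun y => ?_
  rw [← imp_and, Set.mem_ofPred_eq, Prod.mk.injEq]
  norm_cast

theorem iSup_gradedPiece : ⨆ x : ℚ × ℚ, gradedPiece b x.1 x.2 = ⊤ := by
  rw [eq_top_iff, ← (atwBasis b).span_eq, Submodule.span_le]
  rintro _ ⟨y, rfl⟩
  refine Submodule.mem_iSup_of_mem (degreeOf (y : StateIdx κ), chargeOf (y : StateIdx κ)) ?_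
  exact ⟨Module.End.mem_eigenspace_iff.2 (twL_atwBasis b y),
    Module.End.mem_eigenspace_iff.2 (twJ_atwBasis b y)⟩

/-! ### Independence of the basis -/

/-- A change of basis is an element of `GL(𝔞)`, under which `∑ a_i ⊗ a_i*` is invariant. This allows
the graded pieces, defined by one basis, to be computed in an eigenbasis. -/
theorem opL_congr (b' : Module.Basis κ ℂ V) (σ : Sector) (n : ℤ) : opL b σ n = opL b' σ n := by
  have h1 := sum_dblMap b (quadVertexHom σ 0 1 (n + 1)) (b.equiv b' (Equiv.refl κ))
  have h2 := sum_dblMap b (quadVertexHom σ 0 1 (n + 1)).flip (b.equiv b' (Equiv.refl κ))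
  simp only [dblMap_equiv_vecA, dblMap_equiv_vecAstar] at h1 h2
  rw [opL_eq, opL_eq, Finset.sum_add_distrib, Finset.sum_add_distrib, h1, h2]

theorem opJ_congr (b' : Module.Basis κ ℂ V) (σ : Sector) (n : ℤ) : opJ b σ n = opJ b' σ n := by
  have h := sum_dblMap b (quadVertexHom σ 0 0 n).flip (b.equiv b' (Equiv.refl κ))
  simp only [dblMap_equiv_vecA, dblMap_equiv_vecAstar] at h
  exact congrArg (I • ·) h.symm

theorem gradedPiece_congr (b' : Module.Basis κ ℂ V) (n m : ℚ) :
    gradedPiece b n m = gradedPiece b' n m := by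
  have h1 : twL b 0 = twL b' 0 := by
    refine LinearMap.ext fun x => Subtype.ext ?_
    rw [coe_twL, coe_twL, opL_congr b b', opL_congr b b']
  have h2 : twJ b 0 = twJ b' 0 := by
    refine LinearMap.ext fun x => Subtype.ext ?_
    rw [coe_twJ, coe_twJ, opJ_congr b b', opJ_congr b b']
  rw [gradedPiece, gradedPiece, h1, h2]

end GradedTrace

/-! ## Summation over the states -/

section Summation

variable {κ : Type*}

theorem expTwoPi_sum {X : Type*} (S : Finset X) (f : X → ℂ) :
    expTwoPi (∑ k ∈ S, f k) = ∏ k ∈ S, expTwoPi (f k) := by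
  simp only [expTwoPi, Finset.mul_sum, Complex.exp_sum]

/-- The contribution of a creation operator to the graded trace. -/
def creationFactor (lam : κ → ℂ) (σ : Sector) (z τ : ℂ) (k : ℕ × (κ ⊕ κ)) : ℂ :=
  dblEigenvalue lam k.2 * k.2.elim (fun _ => argA σ z τ k.1) fun _ => argAstar σ z τ k.1

theorem creation_weight (lam : κ → ℂ) (σ : Sector) (z τ : ℂ) (k : ℕ × (κ ⊕ κ)) :
    dblEigenvalue lam k.2 * expTwoPi (z * charge κ k.2) *
      expTwoPi (τ * -σ.expo (creationIdx σ k)) = creationFactor lam σ z τ k := by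
  obtain ⟨n, i | i⟩ := k <;>
  · simp only [creationFactor, creationIdx, charge, argA, argAstar, Sector.expo, Sum.elim_inl,
      Sum.elim_inr]
    rw [mul_assoc, ← expTwoPi_add]
    congr 2
    push_cast
    ring

variable [Fintype κ]

theorem summable_norm_creationFactor (lam : κ → ℂ) (σ : Sector) (z : ℂ) {τ : ℂ}
    (hτ : 0 < τ.im) : Summable fun k => ‖creationFactor lam σ z τ k‖ := by
  refine (summable_prod_of_nonneg fun _ => norm_nonneg _).2
    ⟨fun n => (hasSum_fintype _).summable, ?_⟩
  simp only [tsum_fintype, Fintype.sum_sum_type]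
  refine (summable_sum fun i _ => ?_).add (summable_sum fun i _ => ?_)
  · simp only [creationFactor, norm_mul, Sum.elim_inl]
    exact (summable_norm_argA σ z hτ).mul_left _
  · simp only [creationFactor, norm_mul, Sum.elim_inr]
    exact (summable_norm_argAstar σ z hτ).mul_left _

theorem hasSum_prod_creationFactor (lam : κ → ℂ) (σ : Sector) (z : ℂ) {τ : ℂ} (hτ : 0 < τ.im) :
    HasSum (fun S => ∏ k ∈ S, creationFactor lam σ z τ k)
      (∏' n, traceFactor (fun i => -lam i) σ z τ n) := by
  have hs := summable_norm_creationFactor lam σ z hτ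
  have h1 := summable_finsetProd_of_summable_norm hs
  have h2 := (multipliable_one_add_of_summable hs).hasProd
  -- Expanding the product of `1 + creationFactor` sums over finite sets of creation operators.
  -- Grouping its factors by mode number then gives `traceFactor`, where the plus signs become the
  -- eigenvalues `-lam i`.
  rw [tprod_one_add h1] at h2
  have h3 : HasProd (traceFactor (fun i => -lam i) σ z τ)
      (∑' S, ∏ k ∈ S, creationFactor lam σ z τ k) := by
    refine h2.prod_fiberwise fun n => ?_
    convert hasProd_fintype _ using 1
    rw [Fintype.prod_sum_type, traceFactor, Finset.prod_mul_distrib]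
    simp [creationFactor, dblEigenvalue, inv_neg]
  rw [h3.tprod_eq]
  exact h1.hasSum

/-- The contribution of a state to the graded trace. -/
def stateTerm (lam : κ → ℂ) (z τ : ℂ) (y : StateIdx κ) : ℂ :=
  eigenvalueOf lam y * expTwoPi (z * chargeOf y) *
    expTwoPi (τ * (degreeOf y - Fintype.card κ / 24))

/-- The contribution of the vacuum to the graded trace. -/
def vacTerm (κ : Type*) [Fintype κ] (σ : Sector) (z τ : ℂ) : ℂ :=
  expTwoPi (z * vacCharge κ σ) * expTwoPi (τ * (vacDegree κ σ - Fintype.card κ / 24))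

theorem stateTerm_sector (lam : κ → ℂ) (σ : Sector) (z τ : ℂ) (S : Finset (ℕ × (κ ⊕ κ))) :
    (∏ k ∈ S, dblEigenvalue lam k.2) * expTwoPi (z * stateCharge σ S) *
      expTwoPi (τ * (stateDegree σ S - Fintype.card κ / 24)) =
      vacTerm κ σ z τ * ∏ k ∈ S, creationFactor lam σ z τ k := by
  simp only [← creation_weight, Finset.prod_mul_distrib, ← expTwoPi_sum, ← Finset.mul_sum]
  have h1 : expTwoPi (z * stateCharge σ S) =
      expTwoPi (z * vacCharge κ σ) * expTwoPi (z * ∑ k ∈ S, (charge κ k.2 : ℂ)) := by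
    rw [← expTwoPi_add, stateCharge]
    push_cast
    ring_nf
  have h2 : expTwoPi (τ * (stateDegree σ S - Fintype.card κ / 24)) =
      expTwoPi (τ * (vacDegree κ σ - Fintype.card κ / 24)) *
        expTwoPi (τ * ∑ k ∈ S, -(σ.expo (creationIdx σ k) : ℂ)) := by
    rw [← expTwoPi_add, stateDegree]
    push_cast
    ring_nf
  rw [h1, h2, vacTerm]
  ring

/-- The sum of the contributions of all states. -/
def fullTrace (lam : κ → ℂ) (z τ : ℂ) : ℂ :=
  vacTerm κ .untwisted z τ * ∏' n, traceFactor (fun i => -lam i) .untwisted z τ n +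
    vacTerm κ .twisted z τ * ∏' n, traceFactor (fun i => -lam i) .twisted z τ n

theorem hasSum_stateTerm (lam : κ → ℂ) (z : ℂ) {τ : ℂ} (hτ : 0 < τ.im) :
    HasSum (stateTerm lam z τ) (fullTrace lam z τ) := by
  refine HasSum.sum ?_ ?_
  · refine ((hasSum_prod_creationFactor lam .untwisted z hτ).mul_left
      (vacTerm κ .untwisted z τ)).congr_fun ?_
    exact fun S => stateTerm_sector lam .untwisted z τ S
  · refine ((hasSum_prod_creationFactor lam .twisted z hτ).mul_left
      (vacTerm κ .twisted z τ)).congr_fun ?_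
    exact fun S => stateTerm_sector lam .twisted z τ S

theorem stateTerm_neg (lam : κ → ℂ) (z τ : ℂ) (y : StateIdx κ) :
    stateTerm (fun i => -lam i) z τ y = (-1) ^ stateCard y * stateTerm lam z τ y := by
  have h : ∀ S : Finset (ℕ × (κ ⊕ κ)), ∏ k ∈ S, dblEigenvalue (fun i => -lam i) k.2 =
      (-1) ^ S.card * ∏ k ∈ S, dblEigenvalue lam k.2 := by
    intro S
    rw [← Finset.prod_const, ← Finset.prod_mul_distrib]
    refine Finset.prod_congr rfl fun k _ => ?_
    rcases k with ⟨n, i | i⟩ <;> simp [dblEigenvalue, inv_neg]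
  rcases y with S | S <;> simp only [stateTerm, eigenvalueOf, stateCard, Sum.elim_inl,
    Sum.elim_inr, h] <;> ring

/-- Replacing `lam` by `-lam` multiplies a state's term by its parity, so the average of the two
full traces keeps exactly the even states. -/
theorem hasSum_evenStates (lam : κ → ℂ) (z : ℂ) {τ : ℂ} (hτ : 0 < τ.im) :
    HasSum (fun y : evenStates κ => stateTerm lam z τ y)
      (1 / 2 * (fullTrace lam z τ + fullTrace (fun i => -lam i) z τ)) := by
  refine (hasSum_subtype_iff_indicator (f := stateTerm lam z τ) (s := evenStates κ)).2 ?_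
  refine (((hasSum_stateTerm lam z hτ).add
    (hasSum_stateTerm (fun i => -lam i) z hτ)).mul_left (1 / 2)).congr_fun fun y => ?_
  rw [stateTerm_neg]
  by_cases hy : Even (stateCard y)
  · rw [Set.indicator_of_mem (show y ∈ evenStates κ from hy), hy.neg_one_pow]
    ring
  · rw [Set.indicator_of_notMem (show y ∉ evenStates κ from hy),
      (Nat.not_even_iff_odd.1 hy).neg_one_pow]
    ring

/-- The degree and the charge of an even state. -/
def bidegree (y : evenStates κ) : ℚ × ℚ := (degreeOf (y : StateIdx κ), chargeOf (y : StateIdx κ))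

/-- Finiteness follows from convergence: with all eigenvalues `1`, `z = 0` and `τ = I`, the states
of a given bidegree contribute terms of one fixed nonzero modulus, while the terms of a summable
family tend to zero. -/
theorem finite_bidegree (x : ℚ × ℚ) : {y : evenStates κ | bidegree y = x}.Finite := by
  have hI : 0 < I.im := by simp
  have h1 := (hasSum_evenStates (fun _ : κ => 1) 0 hI).summable.tendsto_cofinite_zero
  set r : ℝ := ‖expTwoPi (I * (x.1 - Fintype.card κ / 24))‖ with hr
  have hr0 : 0 < r := norm_pos_iff.2 (expTwoPi_ne_zero _)
  have h2 : ∀ᶠ y : evenStates κ in cofinite, ‖stateTerm (fun _ : κ => 1) 0 I y‖ < r := by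
    simpa using h1.norm.eventually_lt_const (by simpa using hr0)
  refine Set.Finite.subset h2 fun y hy => ?_
  have hy' : bidegree y = x := hy
  have h3 : eigenvalueOf (fun _ : κ => 1) (y : StateIdx κ) = 1 := by
    have h : ∀ s : κ ⊕ κ, dblEigenvalue (fun _ => 1) s = 1 := by
      rintro (i | i) <;> simp [dblEigenvalue]
    rcases y with ⟨S | S, _⟩ <;> simp [eigenvalueOf, h]
  have h4 : degreeOf (y : StateIdx κ) = x.1 := congrArg Prod.fst hy'
  simp only [Set.mem_compl_iff, Set.mem_ofPred_eq, not_lt, stateTerm]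
  rw [h3, h4, zero_mul, expTwoPi_zero, one_mul, one_mul]

end Summation

/-! ## Diagonalization of unitary maps -/

section Unitary

variable {V : Type*} [NormedAddCommGroup V] [InnerProductSpace ℂ V] [FiniteDimensional ℂ V]

/-- An invariant subspace is mapped onto itself by dimension, so its orthogonal complement is an
invariant complement. -/
theorem isSemisimple_of_isometry (T : V ≃ₗᵢ[ℂ] V) :
    Module.End.IsSemisimple (T.toLinearEquiv : V →ₗ[ℂ] V) := by
  refine Module.End.isSemisimple_iff.2 fun p hp => ?_
  have hmap : p.map (T.toLinearEquiv : V →ₗ[ℂ] V) = p :=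
    Submodule.eq_of_le_of_finrank_eq (Submodule.map_le_iff_le_comap.2 hp)
      (LinearEquiv.finrank_map_eq T.toLinearEquiv p)
  refine ⟨pᗮ, fun v hv => ?_, Submodule.isCompl_orthogonal p⟩
  rw [Submodule.mem_comap, Submodule.mem_orthogonal]
  intro w hw
  rw [← hmap] at hw
  obtain ⟨u, hu, rfl⟩ := hw
  exact (T.inner_map_map u v).trans ((Submodule.mem_orthogonal p v).1 hv u hu)

theorem exists_eigenbasis {κ : Type*} (b : Module.Basis κ ℂ V) (T : V ≃ₗᵢ[ℂ] V) :
    ∃ (b' : Module.Basis κ ℂ V) (lam : κ → ℂ),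
      (∀ i, T (b' i) = lam i • b' i) ∧ ∀ i, ‖lam i‖ = 1 := by
  classical
  set A : Module.End ℂ V := (T.toLinearEquiv : V →ₗ[ℂ] V) with hA
  have hint : DirectSum.IsInternal A.eigenspace :=
    DirectSum.isInternal_submodule_of_iSupIndep_of_iSup_eq_top A.eigenspaces_iSupIndep
      (isSemisimple_of_isometry T).iSup_eigenspace_eq_top
  set β := hint.collectedBasis fun μ => Module.finBasis ℂ (A.eigenspace μ) with hβ
  have hβe : ∀ x, A (β x) = x.1 • β x := fun x =>
    Module.End.mem_eigenspace_iff.1 (hint.collectedBasis_mem _ x)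
  -- The eigenbasis is reindexed by the index type of the given basis, so that the two can be
  -- compared by `gradedPiece_congr`.
  set e := β.indexEquiv b
  have hb : ∀ i, T (β.reindex e i) = (e.symm i).1 • β.reindex e i := fun i => by
    rw [Module.Basis.reindex_apply]
    exact hβe _
  refine ⟨β.reindex e, fun i => (e.symm i).1, hb, fun i => ?_⟩
  have h := congrArg norm (hb i)
  rw [T.norm_map, norm_smul] at h
  exact (mul_eq_right₀ (norm_ne_zero_iff.2 ((β.reindex e).ne_zero i))).1 h.symm

end Unitary

theorem charpolyRev_of_eigenbasis {V ι : Type*} [AddCommGroup V] [Module ℂ V] [Fintype ι]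
    [DecidableEq ι] (b b' : Module.Basis ι ℂ V) {T : V →ₗ[ℂ] V} {lam : ι → ℂ}
    (hT : ∀ i, T (b' i) = lam i • b' i) :
    (LinearMap.toMatrix b b T).charpolyRev =
      ∏ i, (1 - Polynomial.C (lam i) * Polynomial.X) := by
  refine Polynomial.funext fun x => ?_
  have h1 : ∀ c : Module.Basis ι ℂ V, (1 - x • LinearMap.toMatrix c c T) =
      LinearMap.toMatrix c c (1 - x • T) := fun c => by
    rw [map_sub, map_smul, LinearMap.toMatrix_one]
  have h2 : LinearMap.toMatrix b' b' T = Matrix.diagonal lam := by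
    ext i j
    rw [LinearMap.toMatrix_apply, hT, Matrix.diagonal_apply]
    simp [Finsupp.single_apply, eq_comm]
    aesop
  have h3 : Polynomial.eval x (LinearMap.toMatrix b b T).charpolyRev =
      (1 - x • LinearMap.toMatrix b b T).det := by
    rw [Matrix.charpolyRev, ← Polynomial.coe_evalRingHom, RingHom.map_det]
    congr 1
    ext i j
    simp [Matrix.one_apply, apply_ite, mul_comm x]
  rw [h3, h1, LinearMap.det_toMatrix, ← LinearMap.det_toMatrix b', ← h1, h2,
    Polynomial.eval_prod, ← Matrix.diagonal_one, ← Matrix.diagonal_smul, Matrix.diagonal_sub,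
    Matrix.det_diagonal]
  refine Finset.prod_congr rfl fun i _ => ?_
  rw [Pi.smul_apply, smul_eq_mul, Polynomial.eval_sub, Polynomial.eval_one, Polynomial.eval_mul,
    Polynomial.eval_C, Polynomial.eval_X, mul_comm]

/-! ## The two variable McKay-Thompson series -/

section Series

variable {V : Type*} [NormedAddCommGroup V] [InnerProductSpace ℂ V] {ι : Type*} [Fintype ι]

theorem finite_gradedPiece (b : Module.Basis ι ℂ V) (n m : ℚ) :
    Module.Finite ℂ (gradedPiece b n m) :=
  finite_of_subBasis (atwBasis b) _ _ (mem_gradedPiece_iff b n m) (finite_bidegree (n, m))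

variable (b b' : Module.Basis ι ℂ V) {h : SU V} {lam : ι → ℂ}

theorem hasSum_seriesTerm (hb : ∀ i, h.1 (b' i) = lam i • b' i) (hlam : ∀ i, lam i ≠ 0) (z : ℂ)
    {τ : ℂ} (hτ : 0 < τ.im) :
    HasSum (seriesTerm b (QuotientGroup.mk h) z τ)
      (1 / 2 * (fullTrace lam z τ + fullTrace (fun i => -lam i) z τ)) := by
  -- The even states are grouped by bidegree. Each fibre indexes a basis of one graded piece, on
  -- which the trace is the sum of the eigenvalues.
  have h1 := (Equiv.sigmaFiberEquiv (bidegree (κ := ι))).hasSum_iff.2 (hasSum_evenStates lam z hτ)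
  refine h1.sigma fun x => ?_
  let : Fintype ({y | bidegree y = x} : Set (evenStates ι)) := (finite_bidegree x).fintype
  have h2 : gradedTrace b (QuotientGroup.mk h) x.1 x.2 =
      ∑ y : ({y | bidegree y = x} : Set (evenStates ι)), eigenvalueOf lam (y.1 : StateIdx ι) :=
    trace_of_subBasis (atwBasis b') (gradedPiece b x.1 x.2) {y | bidegree y = x}
      (fun v => by rw [gradedPiece_congr b b']; exact mem_gradedPiece_iff b' x.1 x.2 v)
      (γ := fun y : evenStates ι => eigenvalueOf lam (y : StateIdx ι))
      (actTw_atwBasis b' (T := h.1.toLinearEquiv) hb hlam) _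
  have h5 := hasSum_fintype fun y : ({y | bidegree y = x} : Set (evenStates ι)) =>
    stateTerm lam z τ (y.1 : StateIdx ι)
  suffices h6 : seriesTerm b (QuotientGroup.mk h) z τ x =
      ∑ y : ({y | bidegree y = x} : Set (evenStates ι)), stateTerm lam z τ (y.1 : StateIdx ι) by
    rw [h6]
    exact h5
  rw [seriesTerm, h2, Finset.sum_mul, Finset.sum_mul]
  refine Finset.sum_congr rfl fun y _ => ?_
  have h3 : degreeOf (y.1 : StateIdx ι) = x.1 := congrArg Prod.fst y.2
  have h4 : chargeOf (y.1 : StateIdx ι) = x.2 := congrArg Prod.snd y.2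
  rw [stateTerm, h3, h4, Module.finrank_eq_card_basis b, expTwoPi, expTwoPi]
  ring_nf

end Series

/-- The product for `φ` carries the factor `q^(-N/24)` and that for `ψ` the factor `p^(N/2) q^(N/8 -
N/24)`. These are the contributions of the two vacua. -/
theorem phi_add_psi_eq_fullTrace {κ : Type*} [Fintype κ] {lam : κ → ℂ} (hlam : ∀ i, ‖lam i‖ = 1)
    {S : List FrameSymbol}
    (hS : algebraMap (Polynomial ℂ) (RatFunc ℂ)
      (∏ i, (1 - Polynomial.C (lam i) * Polynomial.X)) =
      (S.map fun f => (1 - RatFunc.C (Complex.exp (2 * Real.pi * I * (f.a : ℂ))) *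
        RatFunc.X ^ (f.k : ℕ)) ^ f.m).prod)
    (z : ℂ) {τ : ℂ} (hτ : 0 < τ.im) (hreg : IsRegularAt S z τ) :
    phi S z τ + psi S z τ = fullTrace (fun i => -lam i) z τ := by
  have h := charpolyRev_mul_prod hS
  rw [phi_eq_tprod hlam h z hτ hreg, psi_eq_tprod hlam h z hτ hreg, fullTrace, vacTerm, vacTerm]
  simp only [neg_neg, vacCharge, vacDegree]
  congr 1
  · congr 1
    rw [Rat.cast_zero, mul_zero, expTwoPi_zero, one_mul]
    congr 1
    ring
  · rw [← mul_assoc, mul_assoc (expTwoPi (z * _)), ← expTwoPi_add]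
    congr 2
    · congr 1
      push_cast
      ring
    · congr 1
      push_cast
      ring

end CliffordVOA

end

/-! ### The main theorem -/

theorem mainTheorem8 {V : Type*} [NormedAddCommGroup V] [InnerProductSpace ℂ V]
    [FiniteDimensional ℂ V] (hN : 4 ∣ Module.finrank ℂ V)
    {ι : Type*} [Fintype ι] [DecidableEq ι] (a : OrthonormalBasis ι ℂ V)
    (g : CliffordVOA.PMSU V) (gbar : CliffordVOA.SU V)
    (hg : (QuotientGroup.mk gbar : CliffordVOA.PMSU V) = g)
    (S S' : List CliffordVOA.FrameSymbol)
    (hS : CliffordVOA.IsWeakFrameShape a.toBasis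
      (gbar.1.toLinearEquiv : V →ₗ[ℂ] V) S)
    (hS' : CliffordVOA.IsWeakFrameShape a.toBasis
      (-(gbar.1.toLinearEquiv : V →ₗ[ℂ] V)) S') :
    (∀ n m : ℚ, Module.Finite ℂ (CliffordVOA.gradedPiece a.toBasis n m)) ∧
    (⨆ x : ℚ × ℚ, CliffordVOA.gradedPiece a.toBasis x.1 x.2) = ⊤ ∧
    (∀ (z : ℂ) (τ : UpperHalfPlane),
      Summable (CliffordVOA.seriesTerm a.toBasis g z τ)) ∧
    (∀ (z : ℂ) (τ : UpperHalfPlane),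
      CliffordVOA.IsRegularAt S z τ → CliffordVOA.IsRegularAt S' z τ →
      HasSum (CliffordVOA.seriesTerm a.toBasis g z τ)
        (1 / 2 * (CliffordVOA.phi S' z τ + CliffordVOA.phi S z τ +
          CliffordVOA.psi S' z τ + CliffordVOA.psi S z τ))) ∧
    (∀ τ : UpperHalfPlane,
      {z : ℂ | CliffordVOA.IsRegularAt S z τ ∧ CliffordVOA.IsRegularAt S' z τ} ∈
        Filter.codiscrete ℂ) := by
  subst hg
  obtain ⟨b', lam, hb, hlam⟩ := CliffordVOA.exists_eigenbasis a.toBasis gbar.1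
  have hlam0 : ∀ i, lam i ≠ 0 := fun i h => by simpa [h] using hlam i
  have hsum := fun (z : ℂ) (τ : UpperHalfPlane) =>
    CliffordVOA.hasSum_seriesTerm a.toBasis b' hb hlam0 z τ.im_pos
  refine ⟨CliffordVOA.finite_gradedPiece a.toBasis, CliffordVOA.iSup_gradedPiece a.toBasis,
    fun z τ => (hsum z τ).summable, fun z τ hz hz' => ?_, fun τ =>
      (CliffordVOA.eventually_isRegularAt S τ.im_pos).and
        (CliffordVOA.eventually_isRegularAt S' τ.im_pos)⟩
  rw [CliffordVOA.IsWeakFrameShape, CliffordVOA.charpolyRev_of_eigenbasis a.toBasis b' hb] at hS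
  rw [CliffordVOA.IsWeakFrameShape, CliffordVOA.charpolyRev_of_eigenbasis a.toBasis b'
    (lam := fun i => -lam i) fun i => by
      rw [LinearMap.neg_apply, neg_smul]; exact congrArg _ (hb i)] at hS'
  have h1 := CliffordVOA.phi_add_psi_eq_fullTrace hlam hS z τ.im_pos hz
  have h2 := CliffordVOA.phi_add_psi_eq_fullTrace (fun i => by rw [norm_neg, hlam]) hS' z
    τ.im_pos hz'
  simp only [neg_neg] at h2
  convert hsum z τ using 1
  -- The Frame shape `S` of `ḡ` accounts for the full trace of `-ḡ`, and `S'` for that of `ḡ`.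
  rw [← h1, ← h2]
  ring
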